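/- **Setting.** Let $k$ be a field, $n\in\mathbb N$, $I=\{1,\dots,n\}$, let $\alpha_1,\dots,\alpha_n$ be the standard basis of $\mathbb Z^n$, and let $\chi:\mathbb Z^n\times\mathbb Z^n\to k^\times$ be a bicharacter such that $q_{ij}=\chi(\alpha_i,\alpha_j)$ satisfies $q_{ij}=q_{ji}$. Let $T=k\langle x_1,\dots,x_n\rangle$ be the tensor algebra, with $\deg x_i=\alpha_i$, regarded as a braided Hopf algebra with braiding $x_i\otimes x_j\mapsto q_{ij}\,x_j\otimes x_i$ and primitive generators $x_i$. Let $\mathcal I\subseteq\bigoplus_{m\ge 2}T_m$ be a $\mathbb Z^n$-graded biideal of $T$ (so that $U^+=T/\mathcal I$ is an arbitrary pre-Nichols algebra of the diagonal braiding). Let $U(\chi)$ be the $k$-algebra generated by $E_i,F_i$ $(i\in I)$ and $K_\lambda$ $(\lambda\in\mathbb Z^n)$, $K_i=K_{\alpha_i}$, with relations $K_0=1$, $K_{\lambda+\mu}=K_\lambda K_\mu$, $K_\lambda E_i=\chi(\lambda,\alpha_i)E_iK_\lambda$, $K_\lambda F_i=\chi(\lambda,\alpha_i)^{-1}F_iK_\lambda$,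 $E_iF_j-F_jE_i=\delta_{ij}(K_i-K_i^{-1})$, and $p(E_1,\dots,E_n)=p(F_1,\dots,F_n)=0$ for all $p\in\mathcal I$. Let $U^+$, $U^-$, $G^-$, $H$ be the subalgebras generated by the $E_i$, by the $F_i$, by the $F_iK_i$, and by the $K_\lambda$, respectively; $U^+_\alpha$ and $U^-_{-\beta}$ $(\alpha,\beta\in\mathbb N^n)$ denote homogeneous components, where $\deg E_i=\alpha_i$ and $\deg F_i=-\alpha_i$. Let $\tau$ be a permutation of $I$ with $\tau^2=\mathrm{id}$, $q_{\tau(i)\tau(j)}=q_{ij}$ and $\tau(\mathcal I)=\mathcal I$, and let $\mathbf c=(c_1,\dots,c_n)\in k^n$. Put $B_i=F_i+c_iE_{\tau(i)}K_i^{-1}$; let $H_\theta$ be the subalgebra generated by the $K_iK_{\tau(i)}^{-1}$, let $H_\theta\ltimes U^-$ be the subalgebra generated by $H_\theta$ and $U^-$, and let $B_{\mathbf c}$ be the subalgebra generated by $H_\theta$ and the $B_i$. Filter $B_{\mathbf c}$ by $\deg B_i=1$, $\deg h=0$ for $h\in H_\theta$: $\mathcal F_m$ is spanned by the products of generators $K_iK_{\tau(i)}^{-1}$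 and $B_i$ with at most $m$ factors $B_i$ (so $\mathcal F_{-1}=0$), and $\mathrm{gr}(B_{\mathbf c})=\bigoplus_{m\ge 0}\mathcal F_m/\mathcal F_{m-1}$. For $p\in T$ write $p(\underline F)=p(F_1,\dots,F_n)$ and $p(\underline B)=p(B_1,\dots,B_n)$. Let $\mathbb N_{\mathrm{rel}}$ be the set of all $d\in\mathbb N$ such that, for every $m\le d$ and every polynomial $p\in T$ homogeneous of total degree $m$, $p(\underline F)=0$ implies $p(\underline B)\in\mathcal F_{m-1}$. **Theorem.** One has direct sum decompositions $U(\chi)=\bigoplus_{\lambda\in\mathbb Z^n}U^+K_\lambda G^-$ and $U(\chi)=\bigoplus_{\alpha,\beta\in\mathbb N^n}U^+_\alpha HU^-_{-\beta}$; let $P_\lambda:U(\chi)\to U^+K_\lambda G^-$ and $\pi_{\alpha,\beta}:U(\chi)\to U^+_\alpha HU^-_{-\beta}$ be the corresponding projections. There is a unique algebra homomorphism $\varphi:\mathrm{gr}(B_{\mathbf c})\to H_\theta\ltimes U^-$ which sends the class of $B_i$ in degree $1$ to $F_i$ and the class of $K_iK_{\tau(i)}^{-1}$ in degree $0$ to $K_iK_{\tau(i)}^{-1}$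 for all $i\in I$; it is surjective. The following are equivalent: 1. $\varphi$ is an isomorphism; 2. $\mathbb N_{\mathrm{rel}}=\mathbb N$; 3. condition $(\mathbf c)$: the two-sided ideal $\mathcal I$ is generated by a (possibly infinite) family of homogeneous noncommutative polynomials $p_j$ of degrees $\lambda_j\in\mathbb N^n$ with $\pi_{0,0}\big(P_{-\lambda_j}(p_j(\underline B))\big)=0$ for all $j$. If $\mathcal I$ is finitely generated as a two-sided ideal, then these conditions are also equivalent to $(\mathbf c)$ with a finite family. For every set $I_\tau\subseteq I$ of representatives of the $\tau$-orbits, these conditions are equivalent to the Iwasawa decomposition, that is, to the bijectivity of the multiplication map $U^+\otimes k[K_i^{\pm1}\mid i\in I_\tau]\otimes B_{\mathbf c}\to U(\chi)$. Moreover, if $\mathbb N_{\mathrm{rel}}\ne\mathbb N$, then there exists $\lambda\in\mathbb N^n\setminus\{0\}$ with $K_{-\lambda}\in B_{\mathbf c}$. -/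

import Mathlib

open scoped TensorProduct

namespace PreNichols

/-! ### Bicharacters and the tensor algebra -/

/-- A bicharacter `χ : ℤⁿ × ℤⁿ → kˣ`. -/
structure Bicharacter (k : Type*) [Field k] (n : ℕ) where
  toFun : (Fin n → ℤ) → (Fin n → ℤ) → kˣ
  map_add_left : ∀ a b c, toFun (a + b) c = toFun a c * toFun b c
  map_add_right : ∀ a b c, toFun a (b + c) = toFun a b * toFun a c

/-- The standard basis vector `α_i` of `ℤⁿ`. -/
def simpleRoot {n : ℕ} (i : Fin n) : Fin n → ℤ := Pi.single i 1

/-- The matrix entry `q_{ij} = χ(α_i, α_j)`. -/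
def Bicharacter.q {k : Type*} [Field k] {n : ℕ} (χ : Bicharacter k n) (i j : Fin n) : kˣ :=
  χ.toFun (simpleRoot i) (simpleRoot j)

/-- `ℕⁿ ⊆ ℤⁿ`. -/
def toInt {n : ℕ} (a : Fin n → ℕ) : Fin n → ℤ := fun i => (a i : ℤ)

/-- The tensor algebra `T(V)` of the vector space with basis `x_1, …, x_n`, that is, the algebra
of noncommutative polynomials. -/
abbrev T (k : Type*) [Field k] (n : ℕ) : Type _ := FreeAlgebra k (Fin n)

/-- The monomial `x_{j_1} ⋯ x_{j_m}` of a multi-index `J = (j_1, …, j_m)`. -/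
def monomial (k : Type*) [Field k] {n : ℕ} (J : List (Fin n)) : T k n :=
  (J.map (FreeAlgebra.ι k)).prod

/-- Polynomials that are homogeneous of degree `a ∈ ℕⁿ`, where `x_i` has degree `α_i`. -/
def homog (k : Type*) [Field k] {n : ℕ} (a : Fin n → ℕ) : Submodule k (T k n) :=
  Submodule.span k {p | ∃ J : List (Fin n), (∀ i, J.count i = a i) ∧ p = monomial k J}

/-- Polynomials that are homogeneous of total degree `m`. -/
def homogTotal (k : Type*) [Field k] (n : ℕ) (m : ℕ) : Submodule k (T k n) :=
  Submodule.span k {p | ∃ J : List (Fin n), J.length = m ∧ p = monomial k J}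

section Coproduct

variable {k : Type*} [Field k] {n : ℕ}

/-- The action of `K_i` on `T(V⁺)`: the algebra automorphism `x_j ↦ q_{ij} x_j`. -/
def actK (χ : Bicharacter k n) (i : Fin n) : T k n →ₐ[k] T k n :=
  FreeAlgebra.lift k fun j => (χ.q i j : k) • FreeAlgebra.ι k j

/-- Left multiplication by `x_i ⊗ 1 + 1 ⊗ x_i` in the braided tensor product algebra
`T(V⁺) ⊗ T(V⁺)`, in which `(1 ⊗ x_i)(a ⊗ b) = (K_i · a) ⊗ x_i b`. -/
def braidedMul (χ : Bicharacter k n) (i : Fin n) : Module.End k (T k n ⊗[k] T k n) :=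
  TensorProduct.map (LinearMap.mulLeft k (FreeAlgebra.ι k i)) LinearMap.id +
    TensorProduct.map (actK χ i).toLinearMap (LinearMap.mulLeft k (FreeAlgebra.ι k i))

/-- The coproduct of the braided Hopf algebra `T(V⁺)`: the algebra homomorphism into the braided
tensor product algebra `T(V⁺) ⊗ T(V⁺)` with `x_i ↦ x_i ⊗ 1 + 1 ⊗ x_i`; its value at `p` is
obtained by letting `p(x_1 ⊗ 1 + 1 ⊗ x_1, …, x_n ⊗ 1 + 1 ⊗ x_n)` act on `1 ⊗ 1` by left
multiplication. -/
def braidedCoproduct (χ : Bicharacter k n) : T k n →ₗ[k] T k n ⊗[k] T k n :=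
  LinearMap.applyₗ ((1 : T k n) ⊗ₜ[k] (1 : T k n)) ∘ₗ
    (FreeAlgebra.lift k (braidedMul χ)).toLinearMap

/-- A two-sided ideal of `T(V⁺)`, as a subspace. -/
def idealSubmodule (I : TwoSidedIdeal (T k n)) : Submodule k (T k n) :=
  (TwoSidedIdeal.asIdeal I).restrictScalars k

/-- The ideals which define pre-Nichols algebras `U⁺ = T(V⁺)/I`: the `ℤⁿ`-graded biideals of
`T(V⁺)` contained in `⨁_{m ≥ 2} T(V⁺)_m`.  (The counit vanishes on `I` by `two_le`.) -/
structure IsPreNicholsIdeal (χ : Bicharacter k n) (I : TwoSidedIdeal (T k n)) : Prop where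
  two_le : idealSubmodule I ≤ ⨆ m : {m : ℕ // 2 ≤ m}, homogTotal k n m
  graded : idealSubmodule I ≤ ⨆ a : Fin n → ℕ, idealSubmodule I ⊓ homog k a
  coideal : ∀ p ∈ I, braidedCoproduct χ p ∈
    LinearMap.range (TensorProduct.map (idealSubmodule I).subtype
      (LinearMap.id : T k n →ₗ[k] T k n)) ⊔
    LinearMap.range (TensorProduct.map (LinearMap.id : T k n →ₗ[k] T k n)
      (idealSubmodule I).subtype)

/-- The algebra automorphism of `T(V⁺)` induced by a permutation of the index set. -/
def diagramAut (τ : Equiv.Perm (Fin n)) : T k n →ₐ[k] T k n :=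
  FreeAlgebra.lift k fun i => FreeAlgebra.ι k (τ i)

end Coproduct

/-! ### The Drinfeld double `U(χ)` -/

/-- Generators of `U(χ)`: the `E_i`, the `F_i`, and the group elements
`K_a = K_1^{a_1} ⋯ K_n^{a_n}` for `a ∈ ℤⁿ`. -/
inductive Gen (n : ℕ) : Type
  | E (i : Fin n)
  | F (i : Fin n)
  | K (a : Fin n → ℤ)

section Double

variable {k : Type*} [Field k] {n : ℕ}

/-- The defining relations of `U(χ)`: the `K_a` form the group `ℤⁿ` (so they span the group algebra
`H = k[ℤⁿ]`), they commute with the `E_i` and `F_i` up to the bicharacter, the cross relations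
between `E_i` and `F_j` hold, and `p(E) = 0` and `p(F) = 0` for all `p ∈ I`. -/
inductive Rel (χ : Bicharacter k n) (I : TwoSidedIdeal (T k n)) :
    FreeAlgebra k (Gen n) → FreeAlgebra k (Gen n) → Prop
  | K_zero : Rel χ I (FreeAlgebra.ι k (Gen.K 0)) 1
  | K_add (a b : Fin n → ℤ) : Rel χ I (FreeAlgebra.ι k (Gen.K (a + b)))
      (FreeAlgebra.ι k (Gen.K a) * FreeAlgebra.ι k (Gen.K b))
  | K_E (a : Fin n → ℤ) (i : Fin n) : Rel χ I
      (FreeAlgebra.ι k (Gen.K a) * FreeAlgebra.ι k (Gen.E i))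
      ((χ.toFun a (simpleRoot i) : k) •
        (FreeAlgebra.ι k (Gen.E i) * FreeAlgebra.ι k (Gen.K a)))
  | K_F (a : Fin n → ℤ) (i : Fin n) : Rel χ I
      (FreeAlgebra.ι k (Gen.K a) * FreeAlgebra.ι k (Gen.F i))
      ((((χ.toFun a (simpleRoot i))⁻¹ : kˣ) : k) •
        (FreeAlgebra.ι k (Gen.F i) * FreeAlgebra.ι k (Gen.K a)))
  | E_F (i j : Fin n) : Rel χ I
      (FreeAlgebra.ι k (Gen.E i) * FreeAlgebra.ι k (Gen.F j) -
        FreeAlgebra.ι k (Gen.F j) * FreeAlgebra.ι k (Gen.E i))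
      (if i = j then FreeAlgebra.ι k (Gen.K (simpleRoot i)) -
        FreeAlgebra.ι k (Gen.K (-simpleRoot i)) else 0)
  | ideal_E (p : T k n) (hp : p ∈ I) :
      Rel χ I (FreeAlgebra.lift k (fun i => FreeAlgebra.ι k (Gen.E i)) p) 0
  | ideal_F (p : T k n) (hp : p ∈ I) :
      Rel χ I (FreeAlgebra.lift k (fun i => FreeAlgebra.ι k (Gen.F i)) p) 0

/-- The Drinfeld double `U(χ)` of the pre-Nichols algebra `U⁺ = T(V⁺)/I`. -/
abbrev U (χ : Bicharacter k n) (I : TwoSidedIdeal (T k n)) : Type _ := RingQuot (Rel χ I)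

variable (χ : Bicharacter k n) (I : TwoSidedIdeal (T k n))

/-- The generator `E_i` of `U(χ)`. -/
def E (i : Fin n) : U χ I := RingQuot.mkAlgHom k (Rel χ I) (FreeAlgebra.ι k (Gen.E i))

/-- The generator `F_i` of `U(χ)`. -/
def F (i : Fin n) : U χ I := RingQuot.mkAlgHom k (Rel χ I) (FreeAlgebra.ι k (Gen.F i))

/-- The group element `K_a` of `U(χ)`, for `a ∈ ℤⁿ`. -/
def K (a : Fin n → ℤ) : U χ I := RingQuot.mkAlgHom k (Rel χ I) (FreeAlgebra.ι k (Gen.K a))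

/-- The evaluation `p ↦ p(E_1, …, E_n)`. -/
def evalE : T k n →ₐ[k] U χ I := FreeAlgebra.lift k (E χ I)

/-- The evaluation `p ↦ p(F_1, …, F_n)`. -/
def evalF : T k n →ₐ[k] U χ I := FreeAlgebra.lift k (F χ I)

/-- The subalgebra `U⁺` generated by the `E_i`. -/
def Uplus : Subalgebra k (U χ I) := Algebra.adjoin k (Set.range (E χ I))

/-- The subalgebra `G⁻` generated by the `F_i K_i`. -/
def Gminus : Subalgebra k (U χ I) :=
  Algebra.adjoin k (Set.range fun i => F χ I i * K χ I (simpleRoot i))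

/-- The homogeneous component `U⁺_a` for `a ∈ ℕⁿ`. -/
def UplusDeg (a : Fin n → ℕ) : Submodule k (U χ I) := (homog k a).map (evalE χ I).toLinearMap

/-- The homogeneous component `U⁻_{-b}` for `b ∈ ℕⁿ`. -/
def UminusDeg (b : Fin n → ℕ) : Submodule k (U χ I) := (homog k b).map (evalF χ I).toLinearMap

/-- The group algebra `H = k[ℤⁿ]` inside `U(χ)`. -/
def H : Submodule k (U χ I) := Submodule.span k (Set.range (K χ I))

/-- The subspace `U⁺ K_a G⁻`, for `a ∈ ℤⁿ`. -/
def UKG (a : Fin n → ℤ) : Submodule k (U χ I) :=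
  Subalgebra.toSubmodule (Uplus χ I) * Submodule.span k {K χ I a} *
    Subalgebra.toSubmodule (Gminus χ I)

/-- The subspace `U⁺_a H U⁻_{-b}`, for `(a, b) ∈ ℕⁿ × ℕⁿ`. -/
def UHU (d : (Fin n → ℕ) × (Fin n → ℕ)) : Submodule k (U χ I) :=
  UplusDeg χ I d.1 * H χ I * UminusDeg χ I d.2

end Double

open Classical in
/-- The canonical projection `V → A_j ⊆ V` for a direct sum decomposition `V = ⨁_j A_j` (and zero
if the family `A` is not a direct sum decomposition of `V`). -/
noncomputable def canonicalProj {k V J : Type*} [Field k] [AddCommGroup V] [Module k V]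
    [DecidableEq J] (A : J → Submodule k V) (j : J) : V →ₗ[k] V :=
  if h : DirectSum.IsInternal A then
    (A j).subtype ∘ₗ DirectSum.component k J (fun i => A i) j ∘ₗ
      (LinearEquiv.ofBijective (DirectSum.coeLinearMap A) h).symm.toLinearMap
  else 0

section Projections

variable {k : Type*} [Field k] {n : ℕ} (χ : Bicharacter k n) (I : TwoSidedIdeal (T k n))

/-- The projection `P_a : U(χ) → U⁺ K_a G⁻` with respect to `U(χ) = ⨁_{a ∈ ℤⁿ} U⁺ K_a G⁻`. -/
noncomputable def P (a : Fin n → ℤ) : U χ I →ₗ[k] U χ I := canonicalProj (UKG χ I) a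

/-- The projection `π_{a,b} : U(χ) → U⁺_a H U⁻_{-b}` with respect to
`U(χ) = ⨁_{a, b ∈ ℕⁿ} U⁺_a H U⁻_{-b}`. -/
noncomputable def proj (a b : Fin n → ℕ) : U χ I →ₗ[k] U χ I := canonicalProj (UHU χ I) (a, b)

end Projections

/-! ### The associated graded algebra of a filtered algebra -/

section Graded

variable {k A : Type*} [Field k] [Ring A] [Algebra k A]

open Polynomial in
/-- The Rees algebra `⨁_{m ≥ 0} 𝓕_m t^m ⊆ A[t]` of a filtration `𝓕`. -/
def rees (𝓕 : ℤ → Submodule k A) [SetLike.GradedMonoid 𝓕] : Subalgebra k A[X] where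
  carrier := {f | ∀ m : ℕ, f.coeff m ∈ 𝓕 (m : ℤ)}
  mul_mem' := by
    intro f g hf hg m
    rw [Polynomial.coeff_mul]
    refine Submodule.sum_mem _ fun x hx => ?_
    have h : x.1 + x.2 = m := by simpa using hx
    rw [← h, Nat.cast_add]
    exact SetLike.mul_mem_graded (hf x.1) (hg x.2)
  add_mem' := by
    intro f g hf hg m
    rw [Polynomial.coeff_add]
    exact Submodule.add_mem _ (hf m) (hg m)
  algebraMap_mem' := by
    intro r m
    rw [Polynomial.algebraMap_apply, Polynomial.coeff_C]
    split_ifs with h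
    · subst h
      rw [Algebra.algebraMap_eq_smul_one]
      exact Submodule.smul_mem _ _ (SetLike.one_mem_graded 𝓕)
    · exact Submodule.zero_mem _

/-- The ideal `⨁_{m ≥ 0} 𝓕_{m-1} t^m` of the Rees algebra. -/
def reesIdeal (𝓕 : ℤ → Submodule k A) [SetLike.GradedMonoid 𝓕] : Ideal (rees 𝓕) where
  carrier := {f | ∀ m : ℕ, (f : Polynomial A).coeff m ∈ 𝓕 ((m : ℤ) - 1)}
  add_mem' := by
    intro f g hf hg m
    simpa using Submodule.add_mem _ (hf m) (hg m)
  zero_mem' := by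
    intro m
    simp
  smul_mem' := by
    intro f g hg m
    rw [smul_eq_mul, MulMemClass.coe_mul, Polynomial.coeff_mul]
    refine Submodule.sum_mem _ fun x hx => ?_
    have h : x.1 + x.2 = m := by simpa using hx
    have h' : ((m : ℤ) - 1) = (x.1 : ℤ) + ((x.2 : ℤ) - 1) := by omega
    rw [h']
    exact SetLike.mul_mem_graded (f.2 x.1) (hg x.2)

instance (𝓕 : ℤ → Submodule k A) [SetLike.GradedMonoid 𝓕] : (reesIdeal 𝓕).IsTwoSided where
  mul_mem_of_left := by
    intro f g hf m
    rw [MulMemClass.coe_mul, Polynomial.coeff_mul]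
    refine Submodule.sum_mem _ fun x hx => ?_
    have h : x.1 + x.2 = m := by simpa using hx
    have h' : ((m : ℤ) - 1) = ((x.1 : ℤ) - 1) + (x.2 : ℤ) := by omega
    rw [h']
    exact SetLike.mul_mem_graded (hf x.1) (g.2 x.2)

/-- The associated graded algebra `gr 𝓕 = ⨁_{m ≥ 0} 𝓕_m / 𝓕_{m-1}`, with the multiplication
`[x]_l [y]_m = [x y]_{l + m}`. -/
abbrev AssocGraded (𝓕 : ℤ → Submodule k A) [SetLike.GradedMonoid 𝓕] : Type _ :=
  rees 𝓕 ⧸ reesIdeal 𝓕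

/-- The class `[x]_m ∈ 𝓕_m / 𝓕_{m-1} ⊆ gr 𝓕` of an element `x ∈ 𝓕_m`. -/
noncomputable def symbol (𝓕 : ℤ → Submodule k A) [SetLike.GradedMonoid 𝓕] (m : ℕ) (x : A)
    (hx : x ∈ 𝓕 (m : ℤ)) : AssocGraded 𝓕 :=
  Ideal.Quotient.mk (reesIdeal 𝓕) ⟨Polynomial.monomial m x, by
    intro l
    rw [Polynomial.coeff_monomial]
    split_ifs with h
    · exact h ▸ hx
    · exact Submodule.zero_mem _⟩

end Graded

/-! ### The coideal subalgebra `B_c` -/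

section Coideal

variable {k : Type*} [Field k] {n : ℕ} (χ : Bicharacter k n) (I : TwoSidedIdeal (T k n))
  (τ : Equiv.Perm (Fin n)) (c : Fin n → k)

/-- The element `K_i K_{τ(i)}⁻¹`. -/
def Kθ (i : Fin n) : U χ I := K χ I (simpleRoot i - simpleRoot (τ i))

/-- The subalgebra `H_θ` of `H` generated by the `K_i K_{τ(i)}⁻¹`. -/
def Hθ : Subalgebra k (U χ I) := Algebra.adjoin k (Set.range (Kθ χ I τ))

/-- The partial bosonization `H_θ ⋉ U⁻`: the subalgebra generated by `H_θ` and `U⁻`. -/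
def partialBosonization : Subalgebra k (U χ I) :=
  Algebra.adjoin k (Set.range (Kθ χ I τ) ∪ Set.range (F χ I))

/-- The element `B_i = F_i + c_i E_{τ(i)} K_i⁻¹`. -/
def B (i : Fin n) : U χ I := F χ I i + c i • (E χ I (τ i) * K χ I (-simpleRoot i))

/-- The evaluation `p ↦ p(B_1, …, B_n)`. -/
def evalB : T k n →ₐ[k] U χ I := FreeAlgebra.lift k (B χ I τ c)

/-- The coideal subalgebra `B_c` generated by `H_θ` and the `B_i`. -/
def Bc : Subalgebra k (U χ I) :=
  Algebra.adjoin k (Set.range (Kθ χ I τ) ∪ Set.range (B χ I τ c))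

/-- The generators of `B_c`: `inl i` stands for `K_i K_{τ(i)}⁻¹`, `inr i` for `B_i`. -/
def genB : Fin n ⊕ Fin n → U χ I := Sum.elim (Kθ χ I τ) (B χ I τ c)

/-- The filtration `𝓕` of `B_c` given by `deg B_i = 1` and `deg h = 0` for `h ∈ H_θ`: `𝓕_m` is
spanned by the products of generators in which at most `m` factors are of the form `B_i`.  In
particular `𝓕_m = 0` for `m < 0`. -/
def filt (m : ℤ) : Submodule k (U χ I) :=
  Submodule.span k {x | ∃ w : List (Fin n ⊕ Fin n),
    (w.countP (fun s => s.isRight) : ℤ) ≤ m ∧ x = (w.map (genB χ I τ c)).prod}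

instance filt_gradedMonoid : SetLike.GradedMonoid (filt χ I τ c) where
  one_mem := Submodule.subset_span ⟨[], by simp, by simp⟩
  mul_mem := by
    intro l m x y hx hy
    have h : x * y ∈ filt χ I τ c l * filt χ I τ c m := Submodule.mul_mem_mul hx hy
    refine (?_ : filt χ I τ c l * filt χ I τ c m ≤ filt χ I τ c (l + m)) h
    rw [filt, filt, Submodule.span_mul_span]
    refine Submodule.span_le.2 ?_
    rintro _ ⟨_, ⟨v, hv, rfl⟩, _, ⟨w, hw, rfl⟩, rfl⟩
    refine Submodule.subset_span ⟨v ++ w, ?_, by simp⟩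
    rw [List.countP_append]
    push_cast
    omega

theorem B_mem_filt (i : Fin n) : B χ I τ c i ∈ filt χ I τ c ((1 : ℕ) : ℤ) :=
  Submodule.subset_span ⟨[Sum.inr i], by simp, by simp [genB]⟩

theorem Kθ_mem_filt (i : Fin n) : Kθ χ I τ i ∈ filt χ I τ c ((0 : ℕ) : ℤ) :=
  Submodule.subset_span ⟨[Sum.inl i], by simp, by simp [genB]⟩

/-- The associated graded algebra `gr(B_c)` for the filtration `𝓕`. -/
abbrev grB : Type _ := AssocGraded (filt χ I τ c)

theorem F_mem_partialBosonization (i : Fin n) : F χ I i ∈ partialBosonization χ I τ :=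
  Algebra.subset_adjoin (Or.inr ⟨i, rfl⟩)

theorem Kθ_mem_partialBosonization (i : Fin n) : Kθ χ I τ i ∈ partialBosonization χ I τ :=
  Algebra.subset_adjoin (Or.inl ⟨i, rfl⟩)

/-- `φ : gr(B_c) → H_θ ⋉ U⁻` is the natural homomorphism: `φ(B_i) = F_i` and `φ(h) = h` for the
generators `h = K_i K_{τ(i)}⁻¹` of `H_θ`. -/
structure IsNaturalMap (φ : grB χ I τ c →ₐ[k] partialBosonization χ I τ) : Prop where
  map_B : ∀ i, φ (symbol (filt χ I τ c) 1 (B χ I τ c i) (B_mem_filt χ I τ c i)) =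
    ⟨F χ I i, F_mem_partialBosonization χ I τ i⟩
  map_H : ∀ i, φ (symbol (filt χ I τ c) 0 (Kθ χ I τ i) (Kθ_mem_filt χ I τ c i)) =
    ⟨Kθ χ I τ i, Kθ_mem_partialBosonization χ I τ i⟩

/-- The set of all `d ∈ ℕ` such that every homogeneous polynomial `p` of total degree `m ≤ d` has
the property `p(F) = 0 ⟹ p(B) ∈ 𝓕_{m-1}`. -/
def Nrel : Set ℕ :=
  {d | ∀ m ≤ d, ∀ p ∈ homogTotal k n m, evalF χ I p = 0 → evalB χ I τ c p ∈ filt χ I τ c (m - 1)}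

/-- A set `S` of homogeneous polynomials which generates the ideal `I`, such that
`π_{0,0}(P_{-a}(p(B))) = 0` for each `p ∈ S`, where `a ∈ ℕⁿ` is the degree of `p`. -/
def IsGoodGeneratingSet (S : Set (T k n)) : Prop :=
  TwoSidedIdeal.span S = I ∧
    ∀ p ∈ S, ∃ a : Fin n → ℕ, p ∈ homog k a ∧
      proj χ I 0 0 (P χ I (-toInt a) (evalB χ I τ c p)) = 0

/-- `R` is a set of representatives of the `τ`-orbits in `{1, …, n}` (for an involution `τ`). -/
def IsOrbitReps (R : Set (Fin n)) : Prop := ∀ i, ∃! j, j ∈ R ∧ (j = i ∨ j = τ i)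

/-- The subalgebra `k[K_i, K_i⁻¹ | i ∈ R]`. -/
def HR (R : Set (Fin n)) : Subalgebra k (U χ I) :=
  Algebra.adjoin k ((fun i => K χ I (simpleRoot i)) '' R ∪ (fun i => K χ I (-simpleRoot i)) '' R)

/-- The multiplication map `U⁺ ⊗ k[K_i^{±1} | i ∈ R] ⊗ B_c → U(χ)`. -/
def iwasawaMap (R : Set (Fin n)) :
    (Uplus χ I ⊗[k] HR χ I R) ⊗[k] Bc χ I τ c →ₗ[k] U χ I :=
  LinearMap.mul' k (U χ I) ∘ₗ
    TensorProduct.map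
      (LinearMap.mul' k (U χ I) ∘ₗ
        TensorProduct.map (Uplus χ I).val.toLinearMap (HR χ I R).val.toLinearMap)
      (Bc χ I τ c).val.toLinearMap

end Coideal

end PreNichols

/-! The algebra U(χ) acts on T/I ⊗ k[ℤⁿ] ⊗ T/I: E_i and K_a act in the obvious way, F_i through the
skew derivations ∂_i^L and ∂_i^R (`isDouble_tri`, `triRep`). These descend to T/I because I is a
biideal without terms of degree 0 and 1. Acting on 1 ⊗ 1 ⊗ 1 inverts multiplication (`toTri_apply`),
so operators that respect I may be prescribed on the normally ordered monomials E_J K_a F_L. This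
gives both direct sum decompositions, their projections P and π, and the coefficient `coeffK` of
each group element.

In a word with m letters B_i and further letters K_i K_{τ(i)}⁻¹, the part with exactly m factors F
is the same word with B_i replaced by F_i. Taking this top part is multiplicative on the filtration
and induces φ (`topHom`). So φ is injective iff elements of 𝓕_m with vanishing top part lie in
𝓕_{m-1}. The F_i satisfy no relations besides I (`evalF_eq_zero_iff`), so this amounts to p(B) ∈
𝓕_{m-1} for all p ∈ I of total degree m (`IsNaturalMap.bijective_iff`).

The heart is `P_evalB_eq_smul_K`. Let p ∈ I have degree d with |d| = m, and let all relations of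
smaller degree lift. The three summands of Δ(B_i) = 1 ⊗ F_i + B_i ⊗ K_i⁻¹ + c_i K_{τ(i)}K_i⁻¹ ⊗
E_{τ(i)}K_i⁻¹ q-commute, those with 1 ⊗ F_i only up to lower terms. Hence Δ(p(B)) expands according
to the braided coproduct of p. As I is a coideal, each term contains an element of I evaluated at
some summand. This is zero for the first and third summands, and one filtration step lower for the
second, except for p(B) ⊗ K_{-d} itself. So Δ(p(B)) is one step smaller than expected modulo U ⊗ H
(`comul_evalB_mem`), and contracting its left leg with coefficients of group elements leaves only a
multiple of K_{-d} in P_{-d}(p(B)).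

Contracting the right leg instead shows p(B) ≡ P_{-d}(p(B)) modulo 𝓕_{m-1} (`evalB_sub_P_mem`),
while K_{-d} cannot occur in elements of 𝓕_{m-1} (`filt_le_wt`). Thus p(B) ∈ 𝓕_{m-1} iff the scalar
vanishes, which is condition (c) for p. Induction on the degree reduces this to generators
(`Nrel_of_isGoodGeneratingSet`), and in the least degree where lifting fails the nonzero scalar puts
K_{-d} into B_c (`exists_K_mem_Bc`).

The Iwasawa map is always surjective, since F_L equals B_L up to terms with fewer F's. If relations
lift, comparing top parts gives injectivity; if not, K_{-d} ∈ B_c has two different preimages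
(`iwasawaMap_bijective_iff`). -/

namespace PreNichols

/-! ### Degrees and heights of multi-indices. -/

section Degrees

variable {n : ℕ}

/-- The degree in `ℤⁿ` of the monomial with multi-index `J`. -/
def deg (J : List (Fin n)) : Fin n → ℤ := fun i => (J.count i : ℤ)

/-- The height `∑ i, a i` of `a ∈ ℤⁿ`. -/
def ht (a : Fin n → ℤ) : ℤ := ∑ i, a i

@[simp] theorem deg_nil : deg ([] : List (Fin n)) = 0 := by ext i; simp [deg]

@[simp] theorem deg_cons (j : Fin n) (J : List (Fin n)) :
    deg (j :: J) = simpleRoot j + deg J := by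
  ext i
  simp only [deg, List.count_cons, simpleRoot, Pi.add_apply, Pi.single_apply, beq_iff_eq]
  rcases eq_or_ne j i with h | h
  · subst h; simp [add_comm]
  · simp [h, h.symm]

@[simp] theorem ht_zero : ht (0 : Fin n → ℤ) = 0 := by simp [ht]
@[simp] theorem ht_add (a b : Fin n → ℤ) : ht (a + b) = ht a + ht b := by
  simp [ht, Finset.sum_add_distrib]
@[simp] theorem ht_neg (a : Fin n → ℤ) : ht (-a) = -ht a := by simp [ht]
@[simp] theorem ht_sub (a b : Fin n → ℤ) : ht (a - b) = ht a - ht b := by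
  simp [ht, Finset.sum_sub_distrib]
@[simp] theorem ht_simpleRoot (i : Fin n) : ht (simpleRoot i) = 1 := by
  simp [ht, simpleRoot]
@[simp] theorem ht_deg (J : List (Fin n)) : ht (deg J) = J.length := by
  induction J with
  | nil => simp
  | cons j J ih => simp [ih, add_comm]

theorem toInt_injective : Function.Injective (toInt : (Fin n → ℕ) → Fin n → ℤ) := by
  intro a b h
  ext i
  have := congrFun h i
  simpa [toInt] using this

theorem toInt_count (J : List (Fin n)) : toInt (fun i => J.count i) = deg J := rfl

theorem deg_eq_toInt_iff (J : List (Fin n)) (a : Fin n → ℕ) :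
    deg J = toInt a ↔ ∀ i, J.count i = a i := by
  rw [funext_iff]
  simp [deg, toInt]

theorem deg_eq_zero_iff (J : List (Fin n)) : deg J = 0 ↔ J = [] := by
  refine ⟨fun h => ?_, fun h => by simp [h]⟩
  have := congrArg ht h
  simpa using this

end Degrees

/-! ### Bicharacter identities. -/

section Bichar

variable {k : Type*} [Field k] {n : ℕ} (χ : Bicharacter k n)

@[simp] theorem Bicharacter.zero_left (a : Fin n → ℤ) : χ.toFun 0 a = 1 := by
  have := χ.map_add_left 0 0 a
  simpa using this

@[simp] theorem Bicharacter.zero_right (a : Fin n → ℤ) : χ.toFun a 0 = 1 := by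
  have := χ.map_add_right a 0 0
  simpa using this

@[simp] theorem Bicharacter.neg_left (a b : Fin n → ℤ) :
    χ.toFun (-a) b = (χ.toFun a b)⁻¹ := by
  have := χ.map_add_left (-a) a b
  rw [neg_add_cancel, χ.zero_left] at this
  exact eq_inv_of_mul_eq_one_left this.symm

end Bichar

/-! ### Monomials, skew derivations and gradings of the tensor algebra. -/

section TensorAlgebra

variable {k : Type*} [Field k] {n : ℕ}

open FreeAlgebra (ι)

@[simp] theorem monomial_nil : monomial k ([] : List (Fin n)) = 1 := by simp [monomial]

@[simp] theorem monomial_cons (j : Fin n) (J : List (Fin n)) :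
    monomial k (j :: J) = ι k j * monomial k J := by simp [monomial]

@[simp] theorem monomial_append (J L : List (Fin n)) :
    monomial k (J ++ L) = monomial k J * monomial k L := by simp [monomial]

theorem basisFreeMonoid_apply (w : FreeMonoid (Fin n)) :
    FreeAlgebra.basisFreeMonoid k (Fin n) w = monomial k w.toList := by
  simp only [FreeAlgebra.basisFreeMonoid, Module.Basis.map_apply]
  induction w using FreeMonoid.inductionOn' with
  | one =>
    simp [FreeAlgebra.equivMonoidAlgebraFreeMonoid, monomial]
  | of_mul x w ih =>
    simp [FreeAlgebra.equivMonoidAlgebraFreeMonoid, monomial] at ih ⊢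
    rw [ih]

/-- The linear map on the tensor algebra with prescribed values on the monomials. -/
noncomputable def monoLift {M : Type*} [AddCommGroup M] [Module k M] (f : List (Fin n) → M) :
    T k n →ₗ[k] M :=
  (FreeAlgebra.basisFreeMonoid k (Fin n)).constr k fun w => f w.toList

@[simp] theorem monoLift_monomial {M : Type*} [AddCommGroup M] [Module k M]
    (f : List (Fin n) → M) (J : List (Fin n)) : monoLift f (monomial k J) = f J := by
  have := basisFreeMonoid_apply (k := k) (FreeMonoid.ofList J)
  rw [FreeMonoid.toList_ofList] at this
  rw [← this, monoLift, Module.Basis.constr_basis, FreeMonoid.toList_ofList]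

theorem linearMap_ext_monomial {M : Type*} [AddCommGroup M] [Module k M] {f g : T k n →ₗ[k] M}
    (h : ∀ J, f (monomial k J) = g (monomial k J)) : f = g :=
  (FreeAlgebra.basisFreeMonoid k (Fin n)).ext fun w => by
    rw [basisFreeMonoid_apply]; exact h _

theorem span_monomial : Submodule.span k (Set.range (monomial k (n := n))) = ⊤ := by
  rw [← (FreeAlgebra.basisFreeMonoid k (Fin n)).span_eq]
  congr 1
  ext p
  constructor
  · rintro ⟨J, rfl⟩
    exact ⟨FreeMonoid.ofList J, by rw [basisFreeMonoid_apply, FreeMonoid.toList_ofList]⟩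
  · rintro ⟨w, rfl⟩
    exact ⟨w.toList, (basisFreeMonoid_apply w).symm⟩

theorem monomial_induction {C : T k n → Prop} (hm : ∀ J, C (monomial k J))
    (h0 : C 0) (hadd : ∀ p q, C p → C q → C (p + q)) (hsmul : ∀ (r : k) p, C p → C (r • p))
    (p : T k n) : C p := by
  have hp : p ∈ Submodule.span k (Set.range (monomial k (n := n))) := by
    rw [span_monomial]; trivial
  induction hp using Submodule.span_induction with
  | mem x hx => obtain ⟨J, rfl⟩ := hx; exact hm J
  | zero => exact h0
  | add x y _ _ hx hy => exact hadd x y hx hy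
  | smul r x _ hx => exact hsmul r x hx

/-- The diagonal operator `x_J ↦ f (deg J) x_J`. -/
noncomputable def diag (f : (Fin n → ℤ) → k) : T k n →ₗ[k] T k n :=
  monoLift fun J => f (deg J) • monomial k J

@[simp] theorem diag_monomial (f : (Fin n → ℤ) → k) (J : List (Fin n)) :
    diag f (monomial k J) = f (deg J) • monomial k J := by simp [diag]

/-- The counit of the tensor algebra. -/
noncomputable def counit : T k n →ₗ[k] k := monoLift fun J => if J = [] then 1 else 0

/-- The coefficient of `x_i`. -/
noncomputable def coord (i : Fin n) : T k n →ₗ[k] k := monoLift fun J => if J = [i] then 1 else 0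

theorem actK_monomial (χ : Bicharacter k n) (i : Fin n) (J : List (Fin n)) :
    actK χ i (monomial k J) = (χ.toFun (simpleRoot i) (deg J) : k) • monomial k J := by
  induction J with
  | nil => simp
  | cons j J ih =>
    simp only [monomial_cons, map_mul, ih, deg_cons, χ.map_add_right]
    simp [actK, Bicharacter.q, smul_smul, mul_comm]

theorem actK_eq_diag (χ : Bicharacter k n) (i : Fin n) :
    (actK χ i).toLinearMap = diag fun a => (χ.toFun (simpleRoot i) a : k) :=
  linearMap_ext_monomial fun J => by simp [actK_monomial]

theorem counit_x_mul (j : Fin n) (p : T k n) : counit (ι k j * p) = 0 := by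
  have : counit ∘ₗ LinearMap.mulLeft k (ι k j) = (0 : T k n →ₗ[k] k) :=
    linearMap_ext_monomial fun J => by
      simp [← monomial_cons, counit]
  exact LinearMap.congr_fun this p

theorem coord_x_mul (i j : Fin n) (p : T k n) :
    coord i (ι k j * p) = if i = j then counit p else 0 := by
  have : coord i ∘ₗ LinearMap.mulLeft k (ι k j) =
      (if i = j then counit else 0 : T k n →ₗ[k] k) :=
    linearMap_ext_monomial fun J => by
      simp only [LinearMap.comp_apply, LinearMap.mulLeft_apply, ← monomial_cons, coord,
        monoLift_monomial, List.cons.injEq, counit]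
      rcases eq_or_ne i j with h | h
      · simp [h]
      · simp [h, h.symm]
  have := LinearMap.congr_fun this p
  split_ifs with h <;> simpa [h] using this

theorem counit_actK (χ : Bicharacter k n) (i : Fin n) (p : T k n) :
    counit (actK χ i p) = counit p := by
  have : counit ∘ₗ (actK χ i).toLinearMap = (counit : T k n →ₗ[k] k) :=
    linearMap_ext_monomial fun J => by
      simp only [LinearMap.comp_apply, AlgHom.toLinearMap_apply, actK_monomial, map_smul, counit,
        monoLift_monomial]
      split_ifs with h <;> simp [h]
  exact LinearMap.congr_fun this p

theorem coord_actK (χ : Bicharacter k n) (i j : Fin n) (p : T k n) :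
    coord i (actK χ j p) = (χ.q j i : k) * coord i p := by
  have : coord i ∘ₗ (actK χ j).toLinearMap = ((χ.q j i : k) • coord i : T k n →ₗ[k] k) :=
    linearMap_ext_monomial fun J => by
      simp only [LinearMap.comp_apply, AlgHom.toLinearMap_apply, actK_monomial, map_smul, coord,
        monoLift_monomial, LinearMap.smul_apply]
      split_ifs with h <;> simp [h, Bicharacter.q]
  exact LinearMap.congr_fun this p

@[simp] theorem braidedCoproduct_one (χ : Bicharacter k n) :
    braidedCoproduct χ (1 : T k n) = 1 ⊗ₜ 1 := by
  simp [braidedCoproduct]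

theorem braidedCoproduct_x_mul (χ : Bicharacter k n) (j : Fin n) (p : T k n) :
    braidedCoproduct χ (ι k j * p) = braidedMul χ j (braidedCoproduct χ p) := by
  simp [braidedCoproduct]

theorem braidedMul_tmul (χ : Bicharacter k n) (j : Fin n) (a b : T k n) :
    braidedMul χ j (a ⊗ₜ b) = (ι k j * a) ⊗ₜ b + (actK χ j a) ⊗ₜ (ι k j * b) := by
  simp [braidedMul]

/-- `(f ⊗ id) ∘ Δ` for a functional `f`. -/
noncomputable def leftContract (χ : Bicharacter k n) (f : T k n →ₗ[k] k) : T k n →ₗ[k] T k n :=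
  (TensorProduct.lid k (T k n)).toLinearMap ∘ₗ TensorProduct.map f LinearMap.id ∘ₗ
    braidedCoproduct χ

/-- `(id ⊗ f) ∘ Δ` for a functional `f`. -/
noncomputable def rightContract (χ : Bicharacter k n) (f : T k n →ₗ[k] k) : T k n →ₗ[k] T k n :=
  (TensorProduct.rid k (T k n)).toLinearMap ∘ₗ TensorProduct.map LinearMap.id f ∘ₗ
    braidedCoproduct χ

/-- This is the counit axiom. Applying ε to the left leg kills the summand x_j ⊗ 1 and ignores the
action of K_j, so it intertwines `braidedMul` with left multiplication by x_j. -/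
theorem leftContract_counit (χ : Bicharacter k n) (p : T k n) :
    leftContract χ counit p = p := by
  have key : ∀ j, (TensorProduct.lid k (T k n)).toLinearMap ∘ₗ
      TensorProduct.map counit LinearMap.id ∘ₗ braidedMul χ j =
      LinearMap.mulLeft k (ι k j) ∘ₗ (TensorProduct.lid k (T k n)).toLinearMap ∘ₗ
      TensorProduct.map counit LinearMap.id := fun j => TensorProduct.ext' fun a b => by
    simp [braidedMul_tmul, counit_x_mul, counit_actK]
  have : leftContract χ counit = (LinearMap.id : T k n →ₗ[k] T k n) :=
    linearMap_ext_monomial fun J => by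
      induction J with
      | nil =>
        have := monoLift_monomial (k := k) (n := n) (fun J => if J = [] then (1 : k) else 0) []
        simp only [if_true, monomial_nil] at this
        simp [leftContract, counit, this]
      | cons j J ih =>
        have := LinearMap.congr_fun (key j) (braidedCoproduct χ (monomial k J))
        simp only [leftContract, LinearMap.comp_apply, LinearMap.id_apply] at ih this ⊢
        rw [monomial_cons, braidedCoproduct_x_mul, this, ih]
        simp
  exact LinearMap.congr_fun this p

theorem rightContract_counit (χ : Bicharacter k n) (p : T k n) :
    rightContract χ counit p = p := by
  have key : ∀ j, (TensorProduct.rid k (T k n)).toLinearMap ∘ₗ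
      TensorProduct.map LinearMap.id counit ∘ₗ braidedMul χ j =
      LinearMap.mulLeft k (ι k j) ∘ₗ (TensorProduct.rid k (T k n)).toLinearMap ∘ₗ
      TensorProduct.map LinearMap.id counit := fun j => TensorProduct.ext' fun a b => by
    simp [braidedMul_tmul, counit_x_mul]
  have : rightContract χ counit = (LinearMap.id : T k n →ₗ[k] T k n) :=
    linearMap_ext_monomial fun J => by
      induction J with
      | nil =>
        have := monoLift_monomial (k := k) (n := n) (fun J => if J = [] then (1 : k) else 0) []
        simp only [if_true, monomial_nil] at this
        simp [rightContract, counit, this]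
      | cons j J ih =>
        have := LinearMap.congr_fun (key j) (braidedCoproduct χ (monomial k J))
        simp only [rightContract, LinearMap.comp_apply, LinearMap.id_apply] at ih this ⊢
        rw [monomial_cons, braidedCoproduct_x_mul, this, ih]
        simp
  exact LinearMap.congr_fun this p

/-- The left skew derivation `∂_i^L = (x_i^* ⊗ id) ∘ Δ`. -/
noncomputable def skewL (χ : Bicharacter k n) (i : Fin n) : T k n →ₗ[k] T k n :=
  leftContract χ (coord i)

/-- The right skew derivation `∂_i^R = (id ⊗ x_i^*) ∘ Δ`. -/
noncomputable def skewR (χ : Bicharacter k n) (i : Fin n) : T k n →ₗ[k] T k n :=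
  rightContract χ (coord i)

theorem coord_one (i : Fin n) : coord i (1 : T k n) = 0 := by
  have := monoLift_monomial (k := k) (n := n) (fun J => if J = [i] then (1 : k) else 0) []
  simpa [coord] using this

@[simp] theorem skewL_one (χ : Bicharacter k n) (i : Fin n) : skewL χ i (1 : T k n) = 0 := by
  simp [skewL, leftContract, coord_one]

@[simp] theorem skewR_one (χ : Bicharacter k n) (i : Fin n) : skewR χ i (1 : T k n) = 0 := by
  simp [skewR, rightContract, coord_one]

/-- In (x_j ⊗ 1 + 1 ⊗ x_j)Δ(p) the functional x_i^* on the left leg meets either x_j times a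
constant, which returns p by the counit axiom, or K_j acting on a part of degree α_i, which costs
q_{ji}. -/
theorem skewL_x_mul (χ : Bicharacter k n) (i j : Fin n) (p : T k n) :
    skewL χ i (ι k j * p) =
      (if i = j then p else 0) + (χ.q j i : k) • (ι k j * skewL χ i p) := by
  have key : (TensorProduct.lid k (T k n)).toLinearMap ∘ₗ
      TensorProduct.map (coord i) LinearMap.id ∘ₗ braidedMul χ j =
      (if i = j then (TensorProduct.lid k (T k n)).toLinearMap ∘ₗ
        TensorProduct.map counit LinearMap.id else 0) +
      (χ.q j i : k) • (LinearMap.mulLeft k (ι k j) ∘ₗ (TensorProduct.lid k (T k n)).toLinearMap ∘ₗ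
        TensorProduct.map (coord i) LinearMap.id) := TensorProduct.ext' fun a b => by
    simp only [LinearMap.comp_apply, braidedMul_tmul, map_add, TensorProduct.map_tmul,
      coord_x_mul, coord_actK, LinearMap.id_apply, LinearEquiv.coe_coe, TensorProduct.lid_tmul,
      LinearMap.add_apply, LinearMap.smul_apply, LinearMap.mulLeft_apply]
    split_ifs with h <;> simp [mul_smul]
  have h1 := LinearMap.congr_fun key (braidedCoproduct χ p)
  have h2 := leftContract_counit χ p
  simp only [skewL, leftContract, LinearMap.comp_apply, LinearMap.add_apply,
    LinearMap.smul_apply] at h1 h2 ⊢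
  rw [braidedCoproduct_x_mul, h1]
  split_ifs with h
  · simp only [LinearMap.comp_apply, h2]; rfl
  · simp

/-- Here the roles are exchanged: the summand 1 ⊗ x_j contributes when the right leg is constant,
and then K_j has acted on the whole of p. -/
theorem skewR_x_mul (χ : Bicharacter k n) (i j : Fin n) (p : T k n) :
    skewR χ i (ι k j * p) = (if i = j then actK χ j p else 0) + ι k j * skewR χ i p := by
  have key : (TensorProduct.rid k (T k n)).toLinearMap ∘ₗ
      TensorProduct.map LinearMap.id (coord i) ∘ₗ braidedMul χ j =
      (if i = j then (actK χ j).toLinearMap ∘ₗ (TensorProduct.rid k (T k n)).toLinearMap ∘ₗ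
        TensorProduct.map LinearMap.id counit else 0) +
      LinearMap.mulLeft k (ι k j) ∘ₗ (TensorProduct.rid k (T k n)).toLinearMap ∘ₗ
        TensorProduct.map LinearMap.id (coord i) := TensorProduct.ext' fun a b => by
    simp only [LinearMap.comp_apply, braidedMul_tmul, map_add, TensorProduct.map_tmul,
      coord_x_mul, LinearMap.id_apply, LinearEquiv.coe_coe, TensorProduct.rid_tmul,
      LinearMap.add_apply, LinearMap.mulLeft_apply]
    split_ifs with h <;> simp [add_comm]
  have h1 := LinearMap.congr_fun key (braidedCoproduct χ p)
  have h2 := rightContract_counit χ p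
  simp only [skewR, rightContract, LinearMap.comp_apply, LinearMap.add_apply] at h1 h2 ⊢
  rw [braidedCoproduct_x_mul, h1]
  split_ifs with h
  · simp only [LinearMap.comp_apply, h2]; rfl
  · simp

/-- The action of `K_a` on the tensor algebra. -/
noncomputable def act (χ : Bicharacter k n) (a : Fin n → ℤ) : T k n →ₗ[k] T k n :=
  diag fun b => (χ.toFun a b : k)

@[simp] theorem act_monomial (χ : Bicharacter k n) (a : Fin n → ℤ) (J : List (Fin n)) :
    act χ a (monomial k J) = (χ.toFun a (deg J) : k) • monomial k J := by simp [act]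

theorem actK_apply (χ : Bicharacter k n) (i : Fin n) (p : T k n) :
    actK χ i p = act χ (simpleRoot i) p :=
  LinearMap.congr_fun (actK_eq_diag χ i) p

@[simp] theorem act_one (χ : Bicharacter k n) (a : Fin n → ℤ) : act χ a (1 : T k n) = 1 := by
  simpa using act_monomial (k := k) χ a []

theorem act_x_mul (χ : Bicharacter k n) (a : Fin n → ℤ) (j : Fin n) (p : T k n) :
    act χ a (ι k j * p) = (χ.toFun a (simpleRoot j) : k) • (ι k j * act χ a p) := by
  have : act χ a ∘ₗ LinearMap.mulLeft k (ι k j) =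
      (χ.toFun a (simpleRoot j) : k) • (LinearMap.mulLeft k (ι k j) ∘ₗ act χ a) :=
    linearMap_ext_monomial fun J => by
      simp [← monomial_cons, χ.map_add_right, smul_smul]
  exact LinearMap.congr_fun this p

@[simp] theorem act_zero (χ : Bicharacter k n) (p : T k n) : act χ 0 p = p := by
  have : act χ 0 = LinearMap.id := linearMap_ext_monomial fun J => by simp
  rw [this]; rfl

theorem act_act (χ : Bicharacter k n) (a b : Fin n → ℤ) (p : T k n) :
    act χ a (act χ b p) = act χ (a + b) p := by
  have : act χ a ∘ₗ act χ b = act χ (a + b) := linearMap_ext_monomial fun J => by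
    simp [χ.map_add_left, smul_smul, mul_comm]
  exact LinearMap.congr_fun this p

theorem skewL_act (χ : Bicharacter k n) (a : Fin n → ℤ) (i : Fin n) (p : T k n) :
    skewL χ i (act χ a p) = (χ.toFun a (simpleRoot i) : k) • act χ a (skewL χ i p) := by
  have : skewL χ i ∘ₗ act χ a = (χ.toFun a (simpleRoot i) : k) • (act χ a ∘ₗ skewL χ i) :=
    linearMap_ext_monomial fun J => by
      induction J with
      | nil => simp
      | cons j J ih =>
        simp only [LinearMap.comp_apply, LinearMap.smul_apply, monomial_cons, act_x_mul,
          map_smul, skewL_x_mul, map_add] at ih ⊢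
        rw [ih]
        split_ifs with h
        · subst h; simp [smul_smul, mul_comm, mul_left_comm]
        · simp only [zero_add, map_zero, smul_smul]
          rw [mul_smul_comm, smul_smul, mul_comm, mul_comm (χ.q j i : k)]
  exact LinearMap.congr_fun this p

theorem skewR_act (χ : Bicharacter k n) (a : Fin n → ℤ) (i : Fin n) (p : T k n) :
    skewR χ i (act χ a p) = (χ.toFun a (simpleRoot i) : k) • act χ a (skewR χ i p) := by
  have : skewR χ i ∘ₗ act χ a = (χ.toFun a (simpleRoot i) : k) • (act χ a ∘ₗ skewR χ i) :=
    linearMap_ext_monomial fun J => by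
      induction J with
      | nil => simp
      | cons j J ih =>
        simp only [LinearMap.comp_apply, LinearMap.smul_apply, monomial_cons, act_x_mul,
          map_smul, skewR_x_mul, map_add] at ih ⊢
        rw [ih]
        split_ifs with h
        · subst h; simp [smul_smul, mul_comm, actK_monomial]
        · simp [smul_smul, mul_comm]
  exact LinearMap.congr_fun this p

theorem homog_eq_span (a : Fin n → ℕ) :
    homog k a = Submodule.span k {p | ∃ J, deg J = toInt a ∧ p = monomial k J} := by
  simp only [homog, deg_eq_toInt_iff]

theorem diag_of_mem_homog (f : (Fin n → ℤ) → k) {a : Fin n → ℕ} {p : T k n} (hp : p ∈ homog k a) :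
    diag f p = f (toInt a) • p := by
  rw [homog_eq_span] at hp
  induction hp using Submodule.span_induction with
  | mem x hx => obtain ⟨J, hJ, rfl⟩ := hx; rw [diag_monomial, hJ]
  | zero => simp
  | add x y _ _ hx hy => rw [map_add, hx, hy, smul_add]
  | smul r x _ hx => rw [map_smul, hx, smul_comm]

theorem homogTotal_of_mem_homog {a : Fin n → ℕ} {p : T k n} (hp : p ∈ homog k a) :
    p ∈ homogTotal k n (∑ i, a i) := by
  rw [homog_eq_span] at hp
  refine Submodule.span_mono ?_ hp
  rintro _ ⟨J, hJ, rfl⟩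
  refine ⟨J, ?_, rfl⟩
  have := congrArg ht hJ
  rw [ht_deg] at this
  have h2 : ht (toInt a) = ((∑ i, a i : ℕ) : ℤ) := by simp [ht, toInt]
  exact_mod_cast this.trans h2

theorem diag_ht_of_mem_homogTotal (f : ℤ → k) {m : ℕ} {p : T k n} (hp : p ∈ homogTotal k n m) :
    diag (fun a => f (ht a)) p = f m • p := by
  induction hp using Submodule.span_induction with
  | mem x hx => obtain ⟨J, hJ, rfl⟩ := hx; rw [diag_monomial, ht_deg, hJ]
  | zero => simp
  | add x y _ _ hx hy => rw [map_add, hx, hy, smul_add]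
  | smul r x _ hx => rw [map_smul, hx, smul_comm]

/-! ### Ideals -/

variable {χ : Bicharacter k n} {I : TwoSidedIdeal (T k n)}

@[simp] theorem mem_idealSubmodule {p : T k n} : p ∈ idealSubmodule I ↔ p ∈ I := Iff.rfl

theorem smul_mem_ideal (r : k) {p : T k n} (hp : p ∈ I) : r • p ∈ I :=
  (idealSubmodule I).smul_mem r hp

namespace IsPreNicholsIdeal

variable (hI : IsPreNicholsIdeal χ I)
include hI

/-- A diagonal operator is a scalar on each homogeneous component, so gradedness of I suffices. The
stability of I under the K_a and under all degree projections comes from here. -/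
theorem diag_mem (f : (Fin n → ℤ) → k) {p : T k n} (hp : p ∈ I) : diag f p ∈ I := by
  have h : idealSubmodule I ≤ (idealSubmodule I).comap (diag f) := by
    refine hI.graded.trans (iSup_le fun a => ?_)
    rintro q ⟨hq, hqa⟩
    rw [Submodule.mem_comap, diag_of_mem_homog f hqa]
    exact Submodule.smul_mem _ _ hq
  exact h hp

theorem act_mem (a : Fin n → ℤ) {p : T k n} (hp : p ∈ I) : act χ a p ∈ I := hI.diag_mem _ hp

theorem counit_eq_zero {p : T k n} (hp : p ∈ I) : counit p = 0 := by
  have h : idealSubmodule I ≤ LinearMap.ker (counit (k := k) (n := n)) := by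
    refine hI.two_le.trans (iSup_le fun m => Submodule.span_le.2 ?_)
    rintro _ ⟨J, hJ, rfl⟩
    have : J ≠ [] := by rintro rfl; have := m.2; simp at hJ; omega
    simp [counit, this]
  exact h hp

theorem coord_eq_zero (i : Fin n) {p : T k n} (hp : p ∈ I) : coord i p = 0 := by
  have h : idealSubmodule I ≤ LinearMap.ker (coord (k := k) i) := by
    refine hI.two_le.trans (iSup_le fun m => Submodule.span_le.2 ?_)
    rintro _ ⟨J, hJ, rfl⟩
    have : J ≠ [i] := by rintro rfl; have := m.2; simp at hJ; omega
    simp [coord, this]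
  exact h hp

/-- A linear map on `T ⊗ T` which maps `I ⊗ T` and `T ⊗ I` to `N` maps `Δ(I)` to `N`. -/
theorem map_coproduct_mem {X : Type*} [AddCommGroup X] [Module k X] (N : Submodule k X)
    (G : T k n ⊗[k] T k n →ₗ[k] X) (hl : ∀ a ∈ I, ∀ b, G (a ⊗ₜ b) ∈ N)
    (hr : ∀ a, ∀ b ∈ I, G (a ⊗ₜ b) ∈ N) {p : T k n} (hp : p ∈ I) :
    G (braidedCoproduct χ p) ∈ N := by
  obtain ⟨_, ⟨y, rfl⟩, _, ⟨z, rfl⟩, h⟩ := Submodule.mem_sup.1 (hI.coideal p hp)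
  rw [← h, map_add]
  clear h
  refine N.add_mem ?_ ?_
  · induction y using TensorProduct.induction_on with
    | zero => simp
    | add x y hx hy => rw [map_add, map_add]; exact add_mem hx hy
    | tmul a b => exact hl _ a.2 _
  · induction z using TensorProduct.induction_on with
    | zero => simp
    | add x y hx hy => rw [map_add, map_add]; exact add_mem hx hy
    | tmul a b => exact hr _ _ b.2

/-- Of Δ(I) ⊆ I ⊗ T + T ⊗ I only the second part survives, because x_i^* vanishes on I; this is
where the absence of terms of degree less than 2 enters. -/
theorem skewL_mem (i : Fin n) {p : T k n} (hp : p ∈ I) : skewL χ i p ∈ I := by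
  refine hI.map_coproduct_mem (idealSubmodule I) ((TensorProduct.lid k (T k n)).toLinearMap ∘ₗ
    TensorProduct.map (coord i) LinearMap.id) (fun a ha b => ?_) (fun a b hb => ?_) hp
  · simp [hI.coord_eq_zero i ha]
  · simpa using smul_mem_ideal _ hb

theorem skewR_mem (i : Fin n) {p : T k n} (hp : p ∈ I) : skewR χ i p ∈ I := by
  refine hI.map_coproduct_mem (idealSubmodule I) ((TensorProduct.rid k (T k n)).toLinearMap ∘ₗ
    TensorProduct.map LinearMap.id (coord i)) (fun a ha b => ?_) (fun a b hb => ?_) hp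
  · simpa using smul_mem_ideal _ ha
  · simp [hI.coord_eq_zero i hb]

end IsPreNicholsIdeal

/-! ### The grading by total degree -/

/-- The projection of the tensor algebra onto its part of total degree `m`. -/
noncomputable def totalPart (m : ℕ) : T k n →ₗ[k] T k n :=
  diag fun a => if ht a = m then 1 else 0

theorem totalPart_monomial (m : ℕ) (J : List (Fin n)) :
    totalPart m (monomial k J) = if J.length = m then monomial k J else 0 := by
  simp only [totalPart, diag_monomial, ht_deg, Nat.cast_inj]
  split_ifs <;> simp

theorem monomial_mem_homogTotal (J : List (Fin n)) : monomial k J ∈ homogTotal k n J.length :=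
  Submodule.subset_span ⟨J, rfl, rfl⟩

theorem totalPart_mem (m : ℕ) (p : T k n) : totalPart m p ∈ homogTotal k n m := by
  induction p using monomial_induction with
  | hm J =>
    rw [totalPart_monomial]
    split_ifs with h
    · exact h ▸ monomial_mem_homogTotal J
    · exact zero_mem _
  | h0 => simp
  | hadd p q hp hq => rw [map_add]; exact add_mem hp hq
  | hsmul r p hp => rw [map_smul]; exact Submodule.smul_mem _ _ hp

/-- The projection of `T ⊗ T` onto its part of total degree `m`. -/
noncomputable def totalPart₂ (m : ℕ) : T k n ⊗[k] T k n →ₗ[k] T k n ⊗[k] T k n :=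
  ∑ x ∈ Finset.HasAntidiagonal.antidiagonal m, TensorProduct.map (totalPart x.1) (totalPart x.2)

theorem totalPart₂_monomial (J L : List (Fin n)) :
    totalPart₂ (J.length + L.length) (monomial k J ⊗ₜ[k] monomial k L) =
      monomial k J ⊗ₜ monomial k L := by
  rw [totalPart₂, LinearMap.sum_apply, Finset.sum_eq_single (J.length, L.length)]
  · simp [totalPart_monomial]
  · rintro ⟨a, b⟩ _ hab
    simp only [TensorProduct.map_tmul, totalPart_monomial]
    split_ifs with h1 h2
    · exact absurd (by rw [h1, h2]) hab
    all_goals simp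
  · intro h; simp at h

theorem braidedCoproduct_monomial_mem (χ : Bicharacter k n) (J : List (Fin n)) :
    braidedCoproduct χ (monomial k J) ∈ Submodule.span k
      {x | ∃ A B : List (Fin n), A.length + B.length = J.length ∧
        x = monomial k A ⊗ₜ[k] monomial k B} := by
  induction J with
  | nil => exact Submodule.subset_span ⟨[], [], by simp, by simp⟩
  | cons j J ih =>
    rw [monomial_cons, braidedCoproduct_x_mul]
    rw [← Submodule.mem_comap]
    refine (Submodule.span_le).2 ?_ ih
    rintro _ ⟨A, B, h, rfl⟩
    rw [SetLike.mem_coe, Submodule.mem_comap, braidedMul_tmul, actK_monomial,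
      ← TensorProduct.smul_tmul', ← monomial_cons, ← monomial_cons]
    refine add_mem (Submodule.subset_span ⟨j :: A, B, ?_, rfl⟩)
      (Submodule.smul_mem _ _ (Submodule.subset_span ⟨A, j :: B, ?_, rfl⟩)) <;>
    simp <;> omega

/-- The coproduct preserves total degree. This lets the inclusion Δ(I) ⊆ I ⊗ T + T ⊗ I be refined to
bihomogeneous pieces, as inductions on the degree require. -/
theorem totalPart₂_braidedCoproduct (χ : Bicharacter k n) {m : ℕ} {p : T k n}
    (hp : p ∈ homogTotal k n m) :
    totalPart₂ m (braidedCoproduct χ p) = braidedCoproduct χ p := by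
  induction hp using Submodule.span_induction with
  | mem x hx =>
    obtain ⟨J, rfl, rfl⟩ := hx
    refine LinearMap.eqOn_span (f := totalPart₂ J.length) (g := LinearMap.id) ?_
      (braidedCoproduct_monomial_mem χ J)
    rintro _ ⟨A, B, h, rfl⟩
    rw [← h, totalPart₂_monomial]; rfl
  | zero => simp
  | add x y _ _ hx hy => simp only [map_add, hx, hy]
  | smul r x _ hx => simp only [map_smul, hx]

/-- A linear map on `T ⊗ T` maps `Δ(p)` to `N` for all `p` of total degree `m` if it maps
`T_r ⊗ T_s` to `N` whenever `r + s = m`. -/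
theorem map_coproduct_mem_of_homogTotal (χ : Bicharacter k n) {X : Type*} [AddCommGroup X]
    [Module k X] (N : Submodule k X) (G : T k n ⊗[k] T k n →ₗ[k] X) {m : ℕ}
    (h : ∀ A B : List (Fin n), A.length + B.length = m →
      G (monomial k A ⊗ₜ monomial k B) ∈ N)
    {p : T k n} (hp : p ∈ homogTotal k n m) : G (braidedCoproduct χ p) ∈ N := by
  induction hp using Submodule.span_induction with
  | mem x hx =>
    obtain ⟨J, rfl, rfl⟩ := hx
    refine (Submodule.span_le (p := Submodule.comap G N)).2 ?_ (braidedCoproduct_monomial_mem χ J)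
    rintro _ ⟨A, B, hAB, rfl⟩
    exact h A B hAB
  | zero => simp
  | add x y _ _ hx hy => simpa only [map_add] using add_mem hx hy
  | smul r x _ hx => simpa only [map_smul] using Submodule.smul_mem _ _ hx

theorem IsPreNicholsIdeal.totalPart_mem (hI : IsPreNicholsIdeal χ I) (m : ℕ) {p : T k n}
    (hp : p ∈ I) : totalPart m p ∈ I :=
  hI.diag_mem _ hp

/-- The homogeneous version of `IsPreNicholsIdeal.map_coproduct_mem`. -/
theorem IsPreNicholsIdeal.map_coproduct_mem_of_homogTotal (hI : IsPreNicholsIdeal χ I)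
    {X : Type*} [AddCommGroup X] [Module k X] (N : Submodule k X)
    (G : T k n ⊗[k] T k n →ₗ[k] X) {m : ℕ}
    (hl : ∀ r s, r + s = m → ∀ a ∈ I, a ∈ homogTotal k n r → ∀ b ∈ homogTotal k n s,
      G (a ⊗ₜ b) ∈ N)
    (hr : ∀ r s, r + s = m → ∀ a ∈ homogTotal k n r, ∀ b ∈ I, b ∈ homogTotal k n s →
      G (a ⊗ₜ b) ∈ N) {p : T k n} (hp : p ∈ I) (hpm : p ∈ homogTotal k n m) :
    G (braidedCoproduct χ p) ∈ N := by
  -- Inserting the degree projection does not change Δ(p), but it replaces the arbitrary tensors in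
  -- I ⊗ T and T ⊗ I by bihomogeneous ones; these stay in place since I is graded.
  rw [← totalPart₂_braidedCoproduct χ hpm]
  refine hI.map_coproduct_mem N (G ∘ₗ totalPart₂ m) (fun a ha b => ?_) (fun a b hb => ?_) hp
  · rw [LinearMap.comp_apply, totalPart₂, LinearMap.sum_apply, map_sum]
    refine sum_mem fun x hx => ?_
    exact hl x.1 x.2 (Finset.HasAntidiagonal.mem_antidiagonal.1 hx) _ (hI.totalPart_mem _ ha)
      (PreNichols.totalPart_mem _ _) _ (PreNichols.totalPart_mem _ _)
  · rw [LinearMap.comp_apply, totalPart₂, LinearMap.sum_apply, map_sum]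
    refine sum_mem fun x hx => ?_
    exact hr x.1 x.2 (Finset.HasAntidiagonal.mem_antidiagonal.1 hx) _ (PreNichols.totalPart_mem _ _) _
      (hI.totalPart_mem _ hb) (PreNichols.totalPart_mem _ _)

end TensorAlgebra

/-! ### Evaluation of noncommutative polynomials and the relations of the double. -/

section Relations

open FreeAlgebra (ι)

variable {k : Type*} [Field k] {n : ℕ}

/-- Evaluation of noncommutative polynomials at a family of elements of an algebra. -/
abbrev ev {R : Type*} [Ring R] [Algebra k R] (x : Fin n → R) : T k n →ₐ[k] R :=
  FreeAlgebra.lift k x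

/-- If `y_i x_j = q_{ij} x_j y_i`, then `p(x + y)` is the evaluation of `Δ(p)` at `x` and `y`. -/
theorem ev_add_eq_coproduct (χ : Bicharacter k n) {R : Type*} [Ring R] [Algebra k R]
    (x y : Fin n → R) (hxy : ∀ i j, y i * x j = (χ.q i j : k) • (x j * y i)) (p : T k n) :
    ev (x + y) p = LinearMap.mul' k R
      (TensorProduct.map (ev x).toLinearMap (ev y).toLinearMap (braidedCoproduct χ p)) := by
  -- Moving y_i to the right past a polynomial in the x_j lets K_i act on that polynomial, exactly
  -- as in the braided tensor product.
  have hact : ∀ i a, y i * ev x a = ev x (actK χ i a) * y i := fun i a => by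
    induction a using monomial_induction with
    | hm J =>
      induction J with
      | nil => simp
      | cons j J ih =>
        rw [monomial_cons, map_mul, map_mul, map_mul, ← mul_assoc, FreeAlgebra.lift_ι_apply, hxy,
          smul_mul_assoc, mul_assoc, ih, ← mul_assoc]
        simp [actK]
    | h0 => simp
    | hadd p q hp hq => simp only [map_add, mul_add, add_mul, hp, hq]
    | hsmul r p hp => simp only [map_smul, mul_smul_comm, smul_mul_assoc, hp]
  set G : T k n ⊗[k] T k n →ₗ[k] R := LinearMap.mul' k R ∘ₗ
    TensorProduct.map (ev x).toLinearMap (ev y).toLinearMap with hG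
  have key : ∀ j, G ∘ₗ braidedMul χ j = LinearMap.mulLeft k (x j + y j) ∘ₗ G := fun j =>
    TensorProduct.ext' fun a b => by
      simp [hG, braidedMul_tmul, add_mul, mul_assoc]
      rw [← mul_assoc, ← mul_assoc, hact]
  have : (ev (x + y)).toLinearMap = G ∘ₗ braidedCoproduct χ :=
    linearMap_ext_monomial fun J => by
      induction J with
      | nil => simp [hG]
      | cons j J ih =>
        rw [monomial_cons, LinearMap.comp_apply, braidedCoproduct_x_mul]
        have h2 := LinearMap.congr_fun (key j) (braidedCoproduct χ (monomial k J))
        rw [LinearMap.comp_apply] at h2 ih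
        rw [h2, LinearMap.comp_apply, ← ih]
        simp
  exact LinearMap.congr_fun this p

/-- Each term of Δ(p) has a leg in I, and this leg evaluates to zero. This is how the coproduct of
U(χ) is seen to respect the relations from I. -/
theorem IsPreNicholsIdeal.ev_add_eq_zero {χ : Bicharacter k n} {I : TwoSidedIdeal (T k n)}
    (hI : IsPreNicholsIdeal χ I) {R : Type*} [Ring R] [Algebra k R]
    (x y : Fin n → R) (hxy : ∀ i j, y i * x j = (χ.q i j : k) • (x j * y i))
    (hx : ∀ p ∈ I, ev x p = 0) (hy : ∀ p ∈ I, ev y p = 0) {p : T k n} (hp : p ∈ I) :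
    ev (x + y) p = 0 := by
  rw [ev_add_eq_coproduct χ x y hxy]
  have := hI.map_coproduct_mem ⊥ (LinearMap.mul' k R ∘ₗ
    TensorProduct.map (ev x).toLinearMap (ev y).toLinearMap) (fun a ha b => by simp [hx a ha])
    (fun a b hb => by simp [hy b hb]) hp
  simpa using this

/-- Elements `e_i`, `f_i`, `κ_a` of an algebra which satisfy all defining relations of `U(χ)`
except possibly the relations `p(e) = 0 = p(f)` for `p ∈ I`. -/
structure IsDouble (χ : Bicharacter k n) {R : Type*} [Ring R] [Algebra k R] (e f : Fin n → R)
    (κ : (Fin n → ℤ) → R) : Prop where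
  K_zero : κ 0 = 1
  K_add : ∀ a b, κ (a + b) = κ a * κ b
  K_E : ∀ a i, κ a * e i = (χ.toFun a (simpleRoot i) : k) • (e i * κ a)
  K_F : ∀ a i, κ a * f i = (((χ.toFun a (simpleRoot i))⁻¹ : kˣ) : k) • (f i * κ a)
  E_F : ∀ i j, e i * f j - f j * e i =
    if i = j then κ (simpleRoot i) - κ (-simpleRoot i) else 0

namespace IsDouble

variable {χ : Bicharacter k n} {R : Type*} [Ring R] [Algebra k R] {e f : Fin n → R}
    {κ : (Fin n → ℤ) → R} (h : IsDouble χ e f κ)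
include h

theorem K_neg_mul (a : Fin n → ℤ) : κ (-a) * κ a = 1 := by rw [← h.K_add, neg_add_cancel, h.K_zero]

theorem K_comm (a b : Fin n → ℤ) : κ a * κ b = κ b * κ a := by
  rw [← h.K_add, ← h.K_add, add_comm]

theorem E_K (a : Fin n → ℤ) (i : Fin n) :
    e i * κ a = (((χ.toFun a (simpleRoot i))⁻¹ : kˣ) : k) • (κ a * e i) := by
  rw [h.K_E, smul_smul]; simp

theorem F_K (a : Fin n → ℤ) (i : Fin n) :
    f i * κ a = (χ.toFun a (simpleRoot i) : k) • (κ a * f i) := by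
  rw [h.K_F, smul_smul]; simp

theorem E_mul_F (i j : Fin n) : e i * f j =
    f j * e i + if i = j then κ (simpleRoot i) - κ (-simpleRoot i) else 0 := by
  rw [← h.E_F i j]; abel

theorem F_mul_E (i j : Fin n) : f j * e i =
    e i * f j - if i = j then κ (simpleRoot i) - κ (-simpleRoot i) else 0 := by
  rw [← h.E_F i j]; abel

theorem K_mul_ev_E (a : Fin n → ℤ) (p : T k n) : κ a * ev e p = ev e (act χ a p) * κ a := by
  induction p using monomial_induction with
  | hm J =>
    induction J with
    | nil => simp
    | cons j J ih =>
      rw [monomial_cons, map_mul, act_x_mul, map_smul, map_mul, ← mul_assoc,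
        FreeAlgebra.lift_ι_apply, h.K_E, smul_mul_assoc, mul_assoc, ih, smul_mul_assoc, mul_assoc]
  | h0 => simp
  | hadd p q hp hq => simp only [map_add, mul_add, add_mul, hp, hq]
  | hsmul r p hp => simp only [map_smul, mul_smul_comm, smul_mul_assoc, hp]

theorem K_mul_ev_F (a : Fin n → ℤ) (p : T k n) : κ a * ev f p = ev f (act χ (-a) p) * κ a := by
  induction p using monomial_induction with
  | hm J =>
    induction J with
    | nil => simp
    | cons j J ih =>
      rw [monomial_cons, map_mul, act_x_mul, map_smul, map_mul, ← mul_assoc,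
        FreeAlgebra.lift_ι_apply, h.K_F, smul_mul_assoc, mul_assoc, ih, smul_mul_assoc, mul_assoc,
        χ.neg_left]
  | h0 => simp
  | hadd p q hp hq => simp only [map_add, mul_add, add_mul, hp, hq]
  | hsmul r p hp => simp only [map_smul, mul_smul_comm, smul_mul_assoc, hp]

/-- The commutator of `e_i` with `p(f)` in terms of the skew derivatives of `p`. -/
theorem E_mul_ev_F (hχ : ∀ i j, χ.q i j = χ.q j i) (i : Fin n) (p : T k n) :
    e i * ev f p = ev f p * e i + κ (simpleRoot i) * ev f (skewL χ i p) -
      ev f (skewR χ i p) * κ (-simpleRoot i) := by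
  induction p using monomial_induction with
  | hm J =>
    induction J with
    | nil => simp
    | cons j J ih =>
      -- Commuting f_j past κ produces q_{ij}, whereas the Leibniz rule for ∂^L contains q_{ji}; the
      -- symmetry of q matches them.
      have h1 : f j * (κ (simpleRoot i) * ev f (skewL χ i (monomial k J))) =
          (χ.q j i : k) • (κ (simpleRoot i) * (f j * ev f (skewL χ i (monomial k J)))) := by
        rw [← mul_assoc, h.F_K, smul_mul_assoc, mul_assoc, hχ j i]; rfl
      rw [monomial_cons, map_mul, FreeAlgebra.lift_ι_apply, ← mul_assoc, h.E_mul_F, add_mul,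
        mul_assoc, ih, mul_sub, mul_add, h1, skewL_x_mul, skewR_x_mul]
      simp only [map_add, map_smul, map_mul, FreeAlgebra.lift_ι_apply, mul_add, add_mul,
        mul_smul_comm]
      split_ifs with hij
      · subst hij
        have h2 := h.K_mul_ev_F (-simpleRoot i) (monomial k J)
        rw [neg_neg] at h2
        rw [actK_apply, ← h2, sub_mul]
        simp only [mul_assoc]
        abel
      · simp only [map_zero, zero_mul, mul_zero, zero_add, mul_assoc]
        abel
  | h0 => simp
  | hadd p q hp hq => simp only [map_add, mul_add, add_mul, hp, hq]; abel
  | hsmul r p hp => simp only [map_smul, mul_smul_comm, smul_mul_assoc, hp, smul_sub, smul_add]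

end IsDouble

end Relations

/-! ### The universal property of U(χ). -/

section Universal

variable {k : Type*} [Field k] {n : ℕ} (χ : Bicharacter k n) (I : TwoSidedIdeal (T k n))

theorem isDouble_U : IsDouble χ (E χ I) (F χ I) (K χ I) where
  K_zero := by simpa [K] using RingQuot.mkAlgHom_rel k (Rel.K_zero (χ := χ) (I := I))
  K_add a b := by simpa [K] using RingQuot.mkAlgHom_rel k (Rel.K_add (χ := χ) (I := I) a b)
  K_E a i := by simpa [K, E] using RingQuot.mkAlgHom_rel k (Rel.K_E (χ := χ) (I := I) a i)
  K_F a i := by simpa [K, F] using RingQuot.mkAlgHom_rel k (Rel.K_F (χ := χ) (I := I) a i)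
  E_F i j := by
    have := RingQuot.mkAlgHom_rel k (Rel.E_F (χ := χ) (I := I) i j)
    rw [map_sub, map_mul, map_mul] at this
    refine this.trans ?_
    split_ifs <;> simp [K]

theorem evalE_eq_zero {p : T k n} (hp : p ∈ I) : evalE χ I p = 0 := by
  have h := RingQuot.mkAlgHom_rel k (Rel.ideal_E (χ := χ) (I := I) p hp)
  have : (RingQuot.mkAlgHom k (Rel χ I)).comp
      (FreeAlgebra.lift k fun i => FreeAlgebra.ι k (Gen.E i)) = evalE χ I := by
    ext i; simp [evalE, E]
  rw [← this]
  simpa using h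

theorem evalF_eq_zero {p : T k n} (hp : p ∈ I) : evalF χ I p = 0 := by
  have h := RingQuot.mkAlgHom_rel k (Rel.ideal_F (χ := χ) (I := I) p hp)
  have : (RingQuot.mkAlgHom k (Rel χ I)).comp
      (FreeAlgebra.lift k fun i => FreeAlgebra.ι k (Gen.F i)) = evalF χ I := by
    ext i; simp [evalF, F]
  rw [← this]
  simpa using h

variable {χ I}
variable {R : Type*} [Ring R] [Algebra k R] {e f : Fin n → R} {κ : (Fin n → ℤ) → R}

/-- The family of generators as a function on `Gen n`. -/
def genFun (e f : Fin n → R) (κ : (Fin n → ℤ) → R) : Gen n → R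
  | Gen.E i => e i
  | Gen.F i => f i
  | Gen.K a => κ a

/-- The universal property of `U(χ)`. -/
noncomputable def IsDouble.lift (h : IsDouble χ e f κ) (he : ∀ p ∈ I, ev e p = 0)
    (hf : ∀ p ∈ I, ev f p = 0) : U χ I →ₐ[k] R :=
  RingQuot.liftAlgHom k ⟨FreeAlgebra.lift k (genFun e f κ), by
    intro x y hxy
    cases hxy with
    | K_zero => simpa [genFun] using h.K_zero
    | K_add a b => simpa [genFun] using h.K_add a b
    | K_E a i => simpa [genFun] using h.K_E a i
    | K_F a i => simpa [genFun] using h.K_F a i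
    | E_F i j =>
      rw [map_sub, map_mul, map_mul]
      simp only [FreeAlgebra.lift_ι_apply, genFun]
      rw [h.E_F]
      split_ifs <;> simp [genFun]
    | ideal_E p hp =>
      have : (FreeAlgebra.lift k (genFun e f κ)).comp
          (FreeAlgebra.lift k fun i => FreeAlgebra.ι k (Gen.E i)) = ev e := by
        ext i; simp [genFun]
      rw [map_zero, ← he p hp, ← this]; rfl
    | ideal_F p hp =>
      have : (FreeAlgebra.lift k (genFun e f κ)).comp
          (FreeAlgebra.lift k fun i => FreeAlgebra.ι k (Gen.F i)) = ev f := by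
        ext i; simp [genFun]
      rw [map_zero, ← hf p hp, ← this]; rfl⟩

section Lift

variable (h : IsDouble χ e f κ) (he : ∀ p ∈ I, ev e p = 0) (hf : ∀ p ∈ I, ev f p = 0)

@[simp] theorem IsDouble.lift_E (i : Fin n) : h.lift he hf (E χ I i) = e i := by
  simp [IsDouble.lift, E, genFun]

@[simp] theorem IsDouble.lift_F (i : Fin n) : h.lift he hf (F χ I i) = f i := by
  simp [IsDouble.lift, F, genFun]

@[simp] theorem IsDouble.lift_K (a : Fin n → ℤ) : h.lift he hf (K χ I a) = κ a := by
  simp [IsDouble.lift, K, genFun]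

@[simp] theorem IsDouble.lift_evalE (p : T k n) : h.lift he hf (evalE χ I p) = ev e p := by
  have : (h.lift he hf).comp (evalE χ I) = ev e := by ext i; simp [evalE]
  rw [← this]; rfl

@[simp] theorem IsDouble.lift_evalF (p : T k n) : h.lift he hf (evalF χ I p) = ev f p := by
  have : (h.lift he hf).comp (evalF χ I) = ev f := by ext i; simp [evalF]
  rw [← this]; rfl

end Lift

/-- A subspace of `U(χ)` which contains `1` and is stable under left multiplication by the
generators is everything. -/
theorem eq_top_of_mul_mem (N : Submodule k (U χ I)) (h1 : 1 ∈ N)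
    (hE : ∀ i, ∀ x ∈ N, E χ I i * x ∈ N) (hF : ∀ i, ∀ x ∈ N, F χ I i * x ∈ N)
    (hK : ∀ a, ∀ x ∈ N, K χ I a * x ∈ N) : N = ⊤ := by
  have key : ∀ y : FreeAlgebra k (Gen n), ∀ x ∈ N, RingQuot.mkAlgHom k (Rel χ I) y * x ∈ N := by
    intro y
    induction y using FreeAlgebra.induction with
    | grade0 r =>
      intro x hx
      rw [AlgHom.commutes, ← Algebra.smul_def]
      exact N.smul_mem _ hx
    | grade1 g =>
      cases g with
      | E i => exact hE i
      | F i => exact hF i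
      | K a => exact hK a
    | mul a b ha hb => intro x hx; rw [map_mul, mul_assoc]; exact ha _ (hb _ hx)
    | add a b ha hb => intro x hx; rw [map_add, add_mul]; exact add_mem (ha _ hx) (hb _ hx)
  refine eq_top_iff.2 fun x _ => ?_
  obtain ⟨y, rfl⟩ := RingQuot.mkAlgHom_surjective k (Rel χ I) x
  simpa using key y 1 h1

end Universal

/-! ### The triangular decomposition from an action on T/I ⊗ k[ℤⁿ] ⊗ T/I. -/

section Verma

open FreeAlgebra (ι)

variable {k : Type*} [Field k] {n : ℕ}

/-- The underlying vector space of the pre-Nichols algebra `T/I`. -/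
abbrev QuotSpace (I : TwoSidedIdeal (T k n)) : Type _ := T k n ⧸ idealSubmodule I

/-- The class of a polynomial in `T/I`. -/
def qmk (I : TwoSidedIdeal (T k n)) : T k n →ₗ[k] QuotSpace I := (idealSubmodule I).mkQ

theorem qmk_surjective (I : TwoSidedIdeal (T k n)) : Function.Surjective (qmk I) :=
  (idealSubmodule I).mkQ_surjective

theorem qmk_eq_zero {I : TwoSidedIdeal (T k n)} {p : T k n} : qmk I p = 0 ↔ p ∈ I :=
  Submodule.Quotient.mk_eq_zero (idealSubmodule I)

/-- The operator on `T/I` induced by an operator on `T` which preserves `I`. -/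
noncomputable def descend {I : TwoSidedIdeal (T k n)} (g : T k n →ₗ[k] T k n)
    (hg : ∀ p ∈ I, g p ∈ I) : QuotSpace I →ₗ[k] QuotSpace I :=
  (idealSubmodule I).mapQ (idealSubmodule I) g hg

@[simp] theorem descend_qmk {I : TwoSidedIdeal (T k n)} (g : T k n →ₗ[k] T k n)
    (hg : ∀ p ∈ I, g p ∈ I) (p : T k n) : descend g hg (qmk I p) = qmk I (g p) := rfl

/-- Left multiplication by `x_i` on `T/I`. -/
noncomputable def lmulQ (I : TwoSidedIdeal (T k n)) (i : Fin n) : QuotSpace I →ₗ[k] QuotSpace I :=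
  descend (LinearMap.mulLeft k (ι k i)) fun p hp => I.mul_mem_left _ p hp

@[simp] theorem lmulQ_qmk (I : TwoSidedIdeal (T k n)) (i : Fin n) (p : T k n) :
    lmulQ I i (qmk I p) = qmk I (ι k i * p) := rfl

/-- The vector space `k[ℤⁿ] ⊗ T/I` of `U^{≤ 0}`. -/
abbrev BorelSpace (I : TwoSidedIdeal (T k n)) : Type _ := (Fin n → ℤ) →₀ QuotSpace I

/-- The action of `K_a` on `U^{≤ 0}`. -/
noncomputable def borelK (I : TwoSidedIdeal (T k n)) (a : Fin n → ℤ) :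
    BorelSpace I →ₗ[k] BorelSpace I :=
  Finsupp.lmapDomain (QuotSpace I) k (a + ·)

@[simp] theorem borelK_single (I : TwoSidedIdeal (T k n)) (a b : Fin n → ℤ) (q : QuotSpace I) :
    borelK I a (Finsupp.single b q) = Finsupp.single (a + b) q := by
  simp [borelK, Finsupp.mapDomain_single]

variable (χ : Bicharacter k n) (I : TwoSidedIdeal (T k n))

/-- The action of `F_i` on `U^{≤ 0}`. -/
noncomputable def borelF (i : Fin n) : BorelSpace I →ₗ[k] BorelSpace I :=
  Finsupp.lsum k fun a => Finsupp.lsingle a ∘ₗ ((χ.toFun a (simpleRoot i) : k) • lmulQ I i)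

@[simp] theorem borelF_single (i : Fin n) (a : Fin n → ℤ) (q : QuotSpace I) :
    borelF χ I i (Finsupp.single a q) =
      Finsupp.single a ((χ.toFun a (simpleRoot i) : k) • lmulQ I i q) := by
  simp [borelF]

theorem borelK_zero (w : BorelSpace I) : borelK I 0 w = w := by
  have : borelK I 0 = LinearMap.id := Finsupp.lhom_ext fun a q => by simp
  rw [this]; rfl

theorem borelK_borelK (a b : Fin n → ℤ) (w : BorelSpace I) :
    borelK I a (borelK I b w) = borelK I (a + b) w := by
  have : borelK I a ∘ₗ borelK I b = borelK I (a + b) := Finsupp.lhom_ext fun c q => by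
    simp [add_assoc]
  exact LinearMap.congr_fun this w

theorem borelK_borelF (a : Fin n → ℤ) (i : Fin n) (w : BorelSpace I) :
    borelK I a (borelF χ I i w) =
      (((χ.toFun a (simpleRoot i))⁻¹ : kˣ) : k) • borelF χ I i (borelK I a w) := by
  have : borelK I a ∘ₗ borelF χ I i =
      (((χ.toFun a (simpleRoot i))⁻¹ : kˣ) : k) • (borelF χ I i ∘ₗ borelK I a) :=
    Finsupp.lhom_ext fun c q => by
      simp [χ.map_add_left, smul_smul]
  exact LinearMap.congr_fun this w

theorem ev_borelF_single (p q : T k n) (a : Fin n → ℤ) :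
    ev (borelF χ I) p (Finsupp.single a (qmk I q)) =
      Finsupp.single a (qmk I (act χ a p * q)) := by
  induction p using monomial_induction with
  | hm J =>
    induction J with
    | nil => simp
    | cons j J ih =>
      rw [monomial_cons, map_mul, Module.End.mul_apply, ih, FreeAlgebra.lift_ι_apply,
        borelF_single, act_x_mul, lmulQ_qmk, smul_mul_assoc, mul_assoc, map_smul]
  | h0 => simp
  | hadd p q hp hq => simp only [map_add, LinearMap.add_apply, hp, hq, add_mul, Finsupp.single_add]
  | hsmul r p hp => simp only [map_smul, LinearMap.smul_apply, hp, smul_mul_assoc,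
      Finsupp.smul_single]

variable {χ I} (hI : IsPreNicholsIdeal χ I)

/-- The action of `K_a` on `T/I`. -/
noncomputable def actQ (a : Fin n → ℤ) : QuotSpace I →ₗ[k] QuotSpace I :=
  descend (act χ a) fun _ hp => hI.act_mem a hp

/-- The skew derivation `∂_i^L` of `T/I`. -/
noncomputable def skewLQ (i : Fin n) : QuotSpace I →ₗ[k] QuotSpace I :=
  descend (skewL χ i) fun _ hp => hI.skewL_mem i hp

/-- The skew derivation `∂_i^R` of `T/I`. -/
noncomputable def skewRQ (i : Fin n) : QuotSpace I →ₗ[k] QuotSpace I :=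
  descend (skewR χ i) fun _ hp => hI.skewR_mem i hp

/-- The triangular space `T/I ⊗ k[ℤⁿ] ⊗ T/I`. -/
abbrev TriSpace (I : TwoSidedIdeal (T k n)) : Type _ := QuotSpace I ⊗[k] BorelSpace I

/-- The action of `E_i` on the triangular space. -/
noncomputable def triE (I : TwoSidedIdeal (T k n)) (i : Fin n) : Module.End k (TriSpace I) :=
  TensorProduct.map (lmulQ I i) LinearMap.id

/-- The action of `K_a` on the triangular space. -/
noncomputable def triK (a : Fin n → ℤ) : Module.End k (TriSpace I) :=
  TensorProduct.map (actQ hI a) (borelK I a)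

/-- The action of `F_i` on the triangular space. -/
noncomputable def triF (i : Fin n) : Module.End k (TriSpace I) :=
  -- The formula is forced by the identity F_i p(E) = p(E) F_i − (∂_i^R p)(E) K_i + K_i⁻¹ (∂_i^L
  -- p)(E), with K_i⁻¹ moved to the right of the E's.
  TensorProduct.map LinearMap.id (borelF χ I i) -
    TensorProduct.map (skewRQ hI i) (borelK I (simpleRoot i)) +
    TensorProduct.map (actQ hI (-simpleRoot i) ∘ₗ skewLQ hI i) (borelK I (-simpleRoot i))

@[simp] theorem triE_tmul (i : Fin n) (p : T k n) (w : BorelSpace I) :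
    triE I i (qmk I p ⊗ₜ w) = qmk I (ι k i * p) ⊗ₜ w := rfl

@[simp] theorem triK_tmul (a : Fin n → ℤ) (p : T k n) (w : BorelSpace I) :
    triK hI a (qmk I p ⊗ₜ w) = qmk I (act χ a p) ⊗ₜ borelK I a w := rfl

theorem triF_tmul (i : Fin n) (p : T k n) (w : BorelSpace I) :
    triF hI i (qmk I p ⊗ₜ w) = qmk I p ⊗ₜ borelF χ I i w -
      qmk I (skewR χ i p) ⊗ₜ borelK I (simpleRoot i) w +
      qmk I (act χ (-simpleRoot i) (skewL χ i p)) ⊗ₜ borelK I (-simpleRoot i) w := rfl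

theorem triSpace_ext {g h : Module.End k (TriSpace I)}
    (H : ∀ p w, g (qmk I p ⊗ₜ w) = h (qmk I p ⊗ₜ w)) : g = h :=
  TensorProduct.ext' fun a w => by
    obtain ⟨p, rfl⟩ := qmk_surjective I a
    exact H p w

/-- The cross relation is the pair of Leibniz rules for ∂^L and ∂^R: their inhomogeneous terms give
K_i⁻¹ and K_i, and the other terms cancel. -/
theorem isDouble_tri (hχ : ∀ i j, χ.q i j = χ.q j i) : IsDouble χ (triE I) (triF hI) (triK hI) where
  K_zero := triSpace_ext fun p w => by simp [borelK_zero]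
  K_add a b := triSpace_ext fun p w => by
    rw [Module.End.mul_apply, triK_tmul, triK_tmul, triK_tmul, act_act, borelK_borelK]
  K_E a i := triSpace_ext fun p w => by
    rw [Module.End.mul_apply, LinearMap.smul_apply, Module.End.mul_apply, triE_tmul, triK_tmul,
      triK_tmul, triE_tmul, act_x_mul, map_smul, TensorProduct.smul_tmul']
  K_F a i := triSpace_ext fun p w => by
    rw [Module.End.mul_apply, LinearMap.smul_apply, Module.End.mul_apply, triF_tmul, triK_tmul,
      triF_tmul, map_add, map_sub, triK_tmul, triK_tmul, triK_tmul, skewL_act, skewR_act,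
      borelK_borelK, borelK_borelK, borelK_borelK, borelK_borelK, borelK_borelF, map_smul,
      map_smul, act_act, act_act, map_smul]
    simp only [TensorProduct.tmul_smul, ← TensorProduct.smul_tmul', smul_add, smul_sub, smul_smul,
      Units.inv_mul, one_smul, add_comm a]
  E_F i j := triSpace_ext fun p w => by
    rw [LinearMap.sub_apply, Module.End.mul_apply, Module.End.mul_apply, triE_tmul, triF_tmul,
      triF_tmul, map_add, map_sub, triE_tmul, triE_tmul, triE_tmul, skewL_x_mul, skewR_x_mul]
    rcases eq_or_ne i j with h | h
    · subst h
      simp only [if_true, map_add, map_smul, act_x_mul, TensorProduct.add_tmul,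
        LinearMap.sub_apply, triK_tmul, actK_apply, smul_smul, χ.neg_left, Bicharacter.q,
        Units.mul_inv, one_smul]
      abel
    -- The factor q_{ij} of the Leibniz rule cancels against the scalar q_{ji}⁻¹ from the action of
    -- K_j⁻¹ on x_i, by symmetry.
    · have hq : (χ.q i j : k) * ((χ.toFun (simpleRoot j) (simpleRoot i))⁻¹ : kˣ) = 1 := by
        rw [hχ i j]; simp [Bicharacter.q]
      simp only [h, h.symm, if_false, map_smul, act_x_mul, smul_smul, χ.neg_left, hq,
        one_smul, zero_add, LinearMap.zero_apply]
      abel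

theorem ev_triE_tmul (p q : T k n) (w : BorelSpace I) :
    ev (triE I) p (qmk I q ⊗ₜ w) = qmk I (p * q) ⊗ₜ w := by
  induction p using monomial_induction with
  | hm J =>
    induction J with
    | nil => simp
    | cons j J ih =>
      rw [monomial_cons, map_mul, Module.End.mul_apply, ih, FreeAlgebra.lift_ι_apply, triE_tmul,
        mul_assoc]
  | h0 => simp
  | hadd p q hp hq => simp only [map_add, LinearMap.add_apply, hp, hq, add_mul,
      TensorProduct.add_tmul]
  | hsmul r p hp => simp only [map_smul, LinearMap.smul_apply, hp, smul_mul_assoc,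
      TensorProduct.smul_tmul']

theorem ev_triF_one_tmul (p : T k n) (w : BorelSpace I) :
    ev (triF hI) p (qmk I 1 ⊗ₜ w) = qmk I 1 ⊗ₜ ev (borelF χ I) p w := by
  induction p using monomial_induction with
  | hm J =>
    induction J with
    | nil => simp
    | cons j J ih =>
      rw [monomial_cons, map_mul, Module.End.mul_apply, ih, FreeAlgebra.lift_ι_apply, triF_tmul]
      simp
  | h0 => simp
  | hadd p q hp hq => simp only [map_add, LinearMap.add_apply, hp, hq, TensorProduct.tmul_add]
  | hsmul r p hp => simp only [map_smul, LinearMap.smul_apply, hp, TensorProduct.tmul_smul]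

theorem ev_triE_eq_zero {p : T k n} (hp : p ∈ I) : ev (triE I) p = 0 :=
  triSpace_ext fun q w => by
    rw [ev_triE_tmul, qmk_eq_zero.2 (I.mul_mem_right _ _ hp)]; simp

include hI in
theorem ev_borelF_eq_zero {p : T k n} (hp : p ∈ I) : ev (borelF χ I) p = 0 :=
  Finsupp.lhom_ext fun a q => by
    obtain ⟨q, rfl⟩ := qmk_surjective I q
    have := ev_borelF_single χ I p q a
    rw [qmk_eq_zero.2 (I.mul_mem_right _ _ (hI.act_mem a hp))] at this
    simpa using this

/-- For p ∈ I the commutator of E_j with p(F) involves only skew derivatives of p, which are again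
in I. So vanishing propagates from the vectors 1 ⊗ w, where p(F) acts on the Borel factor, to all
x_J ⊗ w. -/
theorem ev_triF_eq_zero (hχ : ∀ i j, χ.q i j = χ.q j i) {p : T k n} (hp : p ∈ I) :
    ev (triF hI) p = 0 := by
  -- The quantifier over p must stay inside the induction on J, since the inductive step passes to
  -- the skew derivatives of p.
  have key : ∀ J : List (Fin n), ∀ p ∈ I, ∀ w, ev (triF hI) p (qmk I (monomial k J) ⊗ₜ w) = 0 := by
    intro J
    induction J with
    | nil =>
      intro p hp w
      rw [monomial_nil, ev_triF_one_tmul, ev_borelF_eq_zero hI hp]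
      simp
    | cons j J ih =>
      intro p hp w
      have h := LinearMap.congr_fun ((isDouble_tri hI hχ).E_mul_ev_F hχ j p)
        (qmk I (monomial k J) ⊗ₜ w)
      simp only [LinearMap.sub_apply, LinearMap.add_apply, Module.End.mul_apply, triE_tmul,
        ih p hp, ih _ (hI.skewL_mem j hp), triK_tmul, act_monomial, map_smul,
        ← TensorProduct.smul_tmul', ih _ (hI.skewR_mem j hp), map_zero, smul_zero, sub_zero,
        add_zero] at h
      rw [monomial_cons, ← h]
  refine triSpace_ext fun q w => ?_
  rw [LinearMap.zero_apply]
  induction q using monomial_induction with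
  | hm J => exact key J p hp w
  | h0 => simp
  | hadd p q hp hq => simp only [map_add, TensorProduct.add_tmul, hp, hq, add_zero]
  | hsmul r p hp => simp only [map_smul, ← TensorProduct.smul_tmul', hp, smul_zero]

/-- The representation of `U(χ)` on the triangular space. -/
noncomputable def triRep (hχ : ∀ i j, χ.q i j = χ.q j i) : U χ I →ₐ[k] Module.End k (TriSpace I) :=
  (isDouble_tri hI hχ).lift (fun _ hp => ev_triE_eq_zero hp) fun _ hp => ev_triF_eq_zero hI hχ hp

/-- The map `U(χ) → T/I ⊗ k[ℤⁿ] ⊗ T/I` inverse to multiplication. -/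
noncomputable def toTri (hχ : ∀ i j, χ.q i j = χ.q j i) : U χ I →ₗ[k] TriSpace I :=
  LinearMap.applyₗ (qmk I 1 ⊗ₜ Finsupp.single 0 (qmk I 1)) ∘ₗ (triRep hI hχ).toLinearMap

/-- Applied to 1 ⊗ 1 ⊗ 1, the F's act only on the last factor, then K_a shifts the middle one, and
the E's fill the first. This formula carries the linear independence in the triangular
decomposition. -/
theorem toTri_apply (hχ : ∀ i j, χ.q i j = χ.q j i) (p q : T k n) (a : Fin n → ℤ) :
    toTri hI hχ (evalE χ I p * K χ I a * evalF χ I q) = qmk I p ⊗ₜ Finsupp.single a (qmk I q) := by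
  simp only [toTri, LinearMap.comp_apply, AlgHom.toLinearMap_apply, map_mul,
    LinearMap.applyₗ_apply_apply, triRep, IsDouble.lift_evalE, IsDouble.lift_evalF,
    IsDouble.lift_K, Module.End.mul_apply]
  rw [ev_triF_one_tmul, ev_borelF_single, triK_tmul, borelK_single, ev_triE_tmul]
  simp

variable (χ I)

/-- The evaluation `T/I → U⁺`. -/
noncomputable def evalEQ : QuotSpace I →ₗ[k] U χ I :=
  (idealSubmodule I).liftQ (evalE χ I).toLinearMap fun _ hp => evalE_eq_zero χ I hp

/-- The evaluation `T/I → U⁻`. -/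
noncomputable def evalFQ : QuotSpace I →ₗ[k] U χ I :=
  (idealSubmodule I).liftQ (evalF χ I).toLinearMap fun _ hp => evalF_eq_zero χ I hp

@[simp] theorem evalEQ_qmk (p : T k n) : evalEQ χ I (qmk I p) = evalE χ I p := rfl

@[simp] theorem evalFQ_qmk (p : T k n) : evalFQ χ I (qmk I p) = evalF χ I p := rfl

/-- The multiplication map `k[ℤⁿ] ⊗ T/I → U(χ)`. -/
noncomputable def ofBorel : BorelSpace I →ₗ[k] U χ I :=
  Finsupp.lsum k fun a => LinearMap.mulLeft k (K χ I a) ∘ₗ evalFQ χ I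

@[simp] theorem ofBorel_single (a : Fin n → ℤ) (q : QuotSpace I) :
    ofBorel χ I (Finsupp.single a q) = K χ I a * evalFQ χ I q := by simp [ofBorel]

/-- The multiplication map `T/I ⊗ k[ℤⁿ] ⊗ T/I → U(χ)`. -/
noncomputable def ofTri : TriSpace I →ₗ[k] U χ I :=
  LinearMap.mul' k (U χ I) ∘ₗ TensorProduct.map (evalEQ χ I) (ofBorel χ I)

@[simp] theorem ofTri_tmul (p : QuotSpace I) (w : BorelSpace I) :
    ofTri χ I (p ⊗ₜ w) = evalEQ χ I p * ofBorel χ I w := by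
  simp [ofTri]

variable {χ I}

/-- The operator on `U(χ)` which maps `p(E) K_a q(F)` to `(g p)(E) K_a (h_a q)(F)`. -/
noncomputable def triOp (hχ : ∀ i j, χ.q i j = χ.q j i) (g : QuotSpace I →ₗ[k] QuotSpace I)
    (h : (Fin n → ℤ) → QuotSpace I →ₗ[k] QuotSpace I) : U χ I →ₗ[k] U χ I :=
  ofTri χ I ∘ₗ TensorProduct.map g (Finsupp.lsum k fun a => Finsupp.lsingle a ∘ₗ h a) ∘ₗ
    toTri hI hχ

theorem triOp_apply (hχ : ∀ i j, χ.q i j = χ.q j i) (g : QuotSpace I →ₗ[k] QuotSpace I)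
    (h : (Fin n → ℤ) → QuotSpace I →ₗ[k] QuotSpace I) (p q : T k n) (a : Fin n → ℤ) :
    triOp hI hχ g h (evalE χ I p * K χ I a * evalF χ I q) =
      evalEQ χ I (g (qmk I p)) * K χ I a * evalFQ χ I (h a (qmk I q)) := by
  rw [triOp, LinearMap.comp_apply, LinearMap.comp_apply, toTri_apply, TensorProduct.map_tmul,
    ofTri_tmul, mul_assoc]
  simp

/-- The normally ordered monomial `E_J K_a F_L`. -/
def nf (χ : Bicharacter k n) (I : TwoSidedIdeal (T k n)) (J : List (Fin n)) (a : Fin n → ℤ)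
    (L : List (Fin n)) : U χ I :=
  evalE χ I (monomial k J) * K χ I a * evalF χ I (monomial k L)

/-- The diagonal operator on `U(χ)` which maps `E_J K_a F_L` to
`f (deg J) * h a (deg L) • E_J K_a F_L`. -/
noncomputable def diagOp (hχ : ∀ i j, χ.q i j = χ.q j i) (f : (Fin n → ℤ) → k)
    (h : (Fin n → ℤ) → (Fin n → ℤ) → k) : U χ I →ₗ[k] U χ I :=
  triOp hI hχ (descend (diag f) fun _ hp => hI.diag_mem f hp) fun a =>
    descend (diag (h a)) fun _ hp => hI.diag_mem (h a) hp

theorem diagOp_nf (hχ : ∀ i j, χ.q i j = χ.q j i) (f : (Fin n → ℤ) → k)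
    (h : (Fin n → ℤ) → (Fin n → ℤ) → k) (J : List (Fin n)) (a : Fin n → ℤ) (L : List (Fin n)) :
    diagOp hI hχ f h (nf χ I J a L) = (f (deg J) * h a (deg L)) • nf χ I J a L := by
  rw [nf, diagOp, triOp_apply]
  simp [smul_smul, mul_comm]

-- The class of p is recovered from p(F) through `toTri`; the counit of T/I serves to strip off the
-- trivial E-factor.
include hI in
theorem evalF_eq_zero_iff (hχ : ∀ i j, χ.q i j = χ.q j i) {p : T k n} :
    evalF χ I p = 0 ↔ p ∈ I := by
  refine ⟨fun h => ?_, evalF_eq_zero χ I⟩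
  have h1 := toTri_apply hI hχ 1 p 0
  rw [h, mul_zero, map_zero] at h1
  have hc : idealSubmodule I ≤ LinearMap.ker (counit (k := k) (n := n)) :=
    fun q hq => hI.counit_eq_zero hq
  have h2 := congrArg (TensorProduct.lid k (BorelSpace I) ∘
    TensorProduct.map ((idealSubmodule I).liftQ counit hc) LinearMap.id) h1
  have h3 : counit (1 : T k n) = 1 := by
    have := monoLift_monomial (k := k) (n := n) (fun J => if J = [] then (1 : k) else 0) []
    simpa [counit] using this
  simp only [Function.comp_apply, map_zero, TensorProduct.map_tmul, 
    TensorProduct.lid_tmul, LinearMap.id_apply] at h2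
  have h4 : (idealSubmodule I).liftQ counit hc (qmk I 1) = 1 := h3
  rw [h4, one_smul] at h2
  exact qmk_eq_zero.1 (Finsupp.single_eq_zero.1 h2.symm)

end Verma

/-! ### Normally ordered monomials and weight filtrations. -/

section NormalOrder

open FreeAlgebra (ι)

variable {k : Type*} [Field k] {n : ℕ} (χ : Bicharacter k n) (I : TwoSidedIdeal (T k n))

@[simp] theorem evalE_x_mul (i : Fin n) (p : T k n) :
    evalE χ I (ι k i * p) = E χ I i * evalE χ I p := by simp [evalE]

@[simp] theorem evalF_x_mul (i : Fin n) (p : T k n) :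
    evalF χ I (ι k i * p) = F χ I i * evalF χ I p := by simp [evalF]

theorem K_mul_evalE (a : Fin n → ℤ) (p : T k n) :
    K χ I a * evalE χ I p = evalE χ I (act χ a p) * K χ I a := (isDouble_U χ I).K_mul_ev_E a p

theorem K_mul_evalF (a : Fin n → ℤ) (p : T k n) :
    K χ I a * evalF χ I p = evalF χ I (act χ (-a) p) * K χ I a := (isDouble_U χ I).K_mul_ev_F a p

@[simp] theorem nf_nil_zero_nil : nf χ I [] 0 [] = 1 := by simp [nf, (isDouble_U χ I).K_zero]

theorem nf_nil_nil (a : Fin n → ℤ) : nf χ I [] a [] = K χ I a := by simp [nf]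

theorem E_mul_nf (i : Fin n) (J : List (Fin n)) (a : Fin n → ℤ) (L : List (Fin n)) :
    E χ I i * nf χ I J a L = nf χ I (i :: J) a L := by simp [nf, mul_assoc]

theorem K_mul_nf (b : Fin n → ℤ) (J : List (Fin n)) (a : Fin n → ℤ) (L : List (Fin n)) :
    K χ I b * nf χ I J a L = (χ.toFun b (deg J) : k) • nf χ I J (b + a) L := by
  rw [nf, ← mul_assoc, ← mul_assoc, K_mul_evalE, act_monomial, map_smul, smul_mul_assoc,
    smul_mul_assoc, smul_mul_assoc, mul_assoc (evalE χ I _), ← (isDouble_U χ I).K_add, nf]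

theorem evalE_mul_nf (J' J : List (Fin n)) (a : Fin n → ℤ) (L : List (Fin n)) :
    evalE χ I (monomial k J') * nf χ I J a L = nf χ I (J' ++ J) a L := by
  simp [nf, mul_assoc]

theorem F_mul_nf_nil (i : Fin n) (a : Fin n → ℤ) (L : List (Fin n)) :
    F χ I i * nf χ I [] a L = (χ.toFun a (simpleRoot i) : k) • nf χ I [] a (i :: L) := by
  simp only [nf, monomial_nil, map_one, one_mul, monomial_cons, evalF_x_mul]
  rw [← mul_assoc, (isDouble_U χ I).F_K, smul_mul_assoc, mul_assoc]

theorem F_mul_nf_cons (j i : Fin n) (J : List (Fin n)) (a : Fin n → ℤ) (L : List (Fin n)) :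
    F χ I j * nf χ I (i :: J) a L = E χ I i * (F χ I j * nf χ I J a L) -
      if i = j then K χ I (simpleRoot i) * nf χ I J a L - K χ I (-simpleRoot i) * nf χ I J a L
      else 0 := by
  rw [← E_mul_nf, ← mul_assoc, (isDouble_U χ I).F_mul_E, sub_mul, mul_assoc]
  split_ifs
  · rw [sub_mul]
  · rw [zero_mul]

/-- The filtration of `U(χ)` by normally ordered monomials in which `E_i`, `F_i` and `K_a` have
weights `e`, `f` and `t * ht a`. -/
def wt (e f t r : ℤ) : Submodule k (U χ I) :=
  Submodule.span k {x | ∃ J a L, e * (J.length : ℤ) + t * ht a + f * (L.length : ℤ) ≤ r ∧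
    x = nf χ I J a L}

variable {χ I}

theorem nf_mem_wt {e f t r : ℤ} {J : List (Fin n)} {a : Fin n → ℤ} {L : List (Fin n)}
    (h : e * (J.length : ℤ) + t * ht a + f * (L.length : ℤ) ≤ r) : nf χ I J a L ∈ wt χ I e f t r :=
  Submodule.subset_span ⟨J, a, L, h, rfl⟩

theorem wt_mono {e f t r s : ℤ} (h : r ≤ s) : wt χ I e f t r ≤ wt χ I e f t s :=
  Submodule.span_mono fun _ ⟨J, a, L, h1, h2⟩ => ⟨J, a, L, h1.trans h, h2⟩

theorem wt_le_iff {e f t r : ℤ} {N : Submodule k (U χ I)} : wt χ I e f t r ≤ N ↔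
    ∀ J a L, e * (J.length : ℤ) + t * ht a + f * (L.length : ℤ) ≤ r → nf χ I J a L ∈ N :=
  Submodule.span_le.trans ⟨fun h J a L hw => h ⟨J, a, L, hw, rfl⟩,
    fun h _ ⟨J, a, L, hw, hx⟩ => hx ▸ h J a L hw⟩

theorem E_mul_mem_wt {e f t r : ℤ} (i : Fin n) {x : U χ I} (hx : x ∈ wt χ I e f t r) :
    E χ I i * x ∈ wt χ I e f t (r + e) := by
  refine (wt_le_iff (N := (wt χ I e f t (r + e)).comap (LinearMap.mulLeft k (E χ I i)))).2
    (fun J a L h => ?_) hx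
  rw [Submodule.mem_comap, LinearMap.mulLeft_apply, E_mul_nf]
  refine nf_mem_wt ?_
  push_cast [List.length_cons]
  linarith

theorem K_mul_mem_wt {e f t r : ℤ} (b : Fin n → ℤ) {x : U χ I} (hx : x ∈ wt χ I e f t r) :
    K χ I b * x ∈ wt χ I e f t (r + t * ht b) := by
  refine (wt_le_iff (N := (wt χ I e f t (r + t * ht b)).comap (LinearMap.mulLeft k (K χ I b)))).2
    (fun J a L h => ?_) hx
  rw [Submodule.mem_comap, LinearMap.mulLeft_apply, K_mul_nf]
  refine Submodule.smul_mem _ _ (nf_mem_wt ?_)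
  rw [ht_add]
  linarith

/-- The two inequalities say that replacing a pair E_i, F_i by K_i or by K_i⁻¹ does not raise the
weight. They make normal ordering, and with it multiplication, compatible with the filtration. -/
theorem F_mul_mem_wt {e f t r : ℤ} (h1 : t ≤ e + f) (h2 : -t ≤ e + f) (j : Fin n) {x : U χ I}
    (hx : x ∈ wt χ I e f t r) : F χ I j * x ∈ wt χ I e f t (r + f) := by
  refine (wt_le_iff (N := (wt χ I e f t (r + f)).comap (LinearMap.mulLeft k (F χ I j)))).2
    (fun J a L h => ?_) hx
  rw [Submodule.mem_comap, LinearMap.mulLeft_apply]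
  clear hx
  induction J generalizing r with
  | nil =>
    rw [F_mul_nf_nil]
    refine Submodule.smul_mem _ _ (nf_mem_wt ?_)
    push_cast [List.length_cons]
    linarith
  | cons i J ih =>
    have h' : e * (J.length : ℤ) + t * ht a + f * (L.length : ℤ) ≤ r - e := by
      push_cast [List.length_cons] at h
      linarith
    rw [F_mul_nf_cons]
    refine sub_mem ?_ ?_
    · have := E_mul_mem_wt i (ih h')
      rwa [show r - e + f + e = r + f by ring] at this
    · split_ifs
      · refine sub_mem (wt_mono ?_ (K_mul_mem_wt (simpleRoot i) (nf_mem_wt h')))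
          (wt_mono ?_ (K_mul_mem_wt (-simpleRoot i) (nf_mem_wt h')))
        · rw [ht_simpleRoot]; linarith
        · rw [ht_neg, ht_simpleRoot]; linarith
      · exact zero_mem _

theorem one_mem_wt {e f t : ℤ} : (1 : U χ I) ∈ wt χ I e f t 0 := by
  rw [← nf_nil_zero_nil]
  exact nf_mem_wt (by simp)

theorem E_mem_wt {e f t : ℤ} (i : Fin n) : E χ I i ∈ wt χ I e f t e := by
  simpa using E_mul_mem_wt i (one_mem_wt (χ := χ) (I := I) (e := e) (f := f) (t := t))

theorem K_mem_wt {e f t : ℤ} (a : Fin n → ℤ) : K χ I a ∈ wt χ I e f t (t * ht a) := by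
  simpa using K_mul_mem_wt a (one_mem_wt (χ := χ) (I := I) (e := e) (f := f) (t := t))

theorem F_mem_wt {e f t : ℤ} (i : Fin n) : F χ I i ∈ wt χ I e f t f := by
  have := F_mul_nf_nil χ I i 0 []
  rw [nf_nil_zero_nil, mul_one] at this
  rw [this]
  exact Submodule.smul_mem _ _ (nf_mem_wt (by simp))

theorem mul_mem_wt {e f t r s : ℤ} (h1 : t ≤ e + f) (h2 : -t ≤ e + f) {x y : U χ I}
    (hx : x ∈ wt χ I e f t r) (hy : y ∈ wt χ I e f t s) : x * y ∈ wt χ I e f t (r + s) := by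
  refine (wt_le_iff (N := (wt χ I e f t (r + s)).comap (LinearMap.mulRight k y))).2
    (fun J a L h => ?_) hx
  rw [Submodule.mem_comap, LinearMap.mulRight_apply, nf, mul_assoc, mul_assoc]
  have hF : ∀ L : List (Fin n), evalF χ I (monomial k L) * y ∈
      wt χ I e f t (s + f * (L.length : ℤ)) := by
    intro L
    induction L with
    | nil => simpa using hy
    | cons i L ih =>
      rw [monomial_cons, evalF_x_mul, mul_assoc]
      refine wt_mono (le_of_eq ?_) (F_mul_mem_wt h1 h2 i ih)
      push_cast [List.length_cons]; ring
  have hE : ∀ (J : List (Fin n)) (z : U χ I) (u : ℤ), z ∈ wt χ I e f t u →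
      evalE χ I (monomial k J) * z ∈ wt χ I e f t (u + e * (J.length : ℤ)) := by
    intro J z u hz
    induction J with
    | nil => simpa using hz
    | cons i J ih =>
      rw [monomial_cons, evalE_x_mul, mul_assoc]
      refine wt_mono (le_of_eq ?_) (E_mul_mem_wt i ih)
      push_cast [List.length_cons]; ring
  exact wt_mono (by linarith) (hE J _ _ (K_mul_mem_wt a (hF L)))

/-- With all weights zero the filtration imposes no bound, so its stability under the generators
says that normally ordered monomials span U(χ). -/
theorem wt_zero : wt χ I 0 0 0 0 = ⊤ := by
  refine eq_top_of_mul_mem _ one_mem_wt (fun i x hx => ?_) (fun i x hx => ?_) fun a x hx => ?_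
  · simpa using E_mul_mem_wt i hx
  · simpa using F_mul_mem_wt (by simp) (by simp) i hx
  · simpa using K_mul_mem_wt a hx

theorem span_nf_eq_top (N : Submodule k (U χ I)) (h : ∀ J a L, nf χ I J a L ∈ N) : N = ⊤ := by
  rw [eq_top_iff, ← wt_zero, wt_le_iff]
  exact fun J a L _ => h J a L

theorem linearMap_ext_nf {M : Type*} [AddCommGroup M] [Module k M] {g h : U χ I →ₗ[k] M}
    (H : ∀ J a L, g (nf χ I J a L) = h (nf χ I J a L)) : g = h := by
  have := span_nf_eq_top (LinearMap.eqLocus g h) H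
  ext x
  have hx : x ∈ LinearMap.eqLocus g h := by rw [this]; trivial
  exact hx

end NormalOrder

/-! ### Direct sum decompositions recognised by their projections. -/

section Internal

variable {k V J : Type*} [Field k] [AddCommGroup V] [Module k V] [DecidableEq J]

/-- Maps that are the identity on one summand and vanish on the others separate the summands. They
must then coincide with the canonical projections, which makes the latter computable. -/
theorem isInternal_of_proj (A : J → Submodule k V) (π : J → V →ₗ[k] V)
    (h1 : ∀ j, ∀ x ∈ A j, π j x = x) (h2 : ∀ i j, i ≠ j → ∀ x ∈ A i, π j x = 0)
    (htop : ⨆ j, A j = ⊤) : DirectSum.IsInternal A ∧ ∀ j, canonicalProj A j = π j := by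
  have hint : DirectSum.IsInternal A := by
    rw [DirectSum.isInternal_submodule_iff_iSupIndep_and_iSup_eq_top]
    refine ⟨fun i => ?_, htop⟩
    rw [Submodule.disjoint_def]
    intro x hx hx'
    have : ⨆ j, ⨆ (_ : j ≠ i), A j ≤ LinearMap.ker (π i) :=
      iSup₂_le fun j hj y hy => h2 j i hj y hy
    rw [← h1 i x hx]
    exact this hx'
  refine ⟨hint, fun j => ?_⟩
  have hle : ⨆ i, A i ≤ LinearMap.eqLocus (canonicalProj A j) (π j) := by
    refine iSup_le fun i x hx => ?_
    rw [LinearMap.mem_eqLocus, canonicalProj, dif_pos hint]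
    have hs : (LinearEquiv.ofBijective (DirectSum.coeLinearMap A) hint).symm x =
        DirectSum.lof k J (fun i => A i) i ⟨x, hx⟩ := by
      rw [LinearEquiv.symm_apply_eq]
      exact (DirectSum.coeLinearMap_lof A i ⟨x, hx⟩).symm
    simp only [LinearMap.comp_apply, LinearEquiv.coe_coe, hs, DirectSum.component.of,
      Submodule.subtype_apply]
    split_ifs with h
    · subst h; exact (h1 _ x hx).symm
    · exact (h2 _ _ h x hx).symm
  ext x
  have hx : x ∈ ⨆ i, A i := by rw [htop]; trivial
  exact hle hx

end Internal

/-! ### The decompositions of U(χ) and the projections P and π. -/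

section Projections

variable {k : Type*} [Field k] {n : ℕ} (χ : Bicharacter k n) (I : TwoSidedIdeal (T k n))

theorem adjoin_range_eq_span {R : Type*} [Ring R] [Algebra k R] (x : Fin n → R) :
    Subalgebra.toSubmodule (Algebra.adjoin k (Set.range x)) =
      Submodule.span k (Set.range fun J => ev x (monomial k J)) := by
  rw [Algebra.adjoin_range_eq_range_freeAlgebra_lift]
  change LinearMap.range (ev x).toLinearMap = _
  rw [LinearMap.range_eq_map, ← span_monomial, Submodule.map_span, ← Set.range_comp]
  rfl

theorem ev_FK_monomial (L : List (Fin n)) : ∃ s : kˣ,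
    ev (fun i => F χ I i * K χ I (simpleRoot i)) (monomial k L) =
      (s : k) • (K χ I (deg L) * evalF χ I (monomial k L)) := by
  induction L with
  | nil => exact ⟨1, by simp [(isDouble_U χ I).K_zero]⟩
  | cons i L ih =>
    obtain ⟨s, hs⟩ := ih
    refine ⟨s * χ.toFun (simpleRoot i + deg L) (simpleRoot i), ?_⟩
    rw [monomial_cons, map_mul, hs, FreeAlgebra.lift_ι_apply, mul_smul_comm, ← mul_assoc,
      mul_assoc (F χ I i), ← (isDouble_U χ I).K_add, (isDouble_U χ I).F_K, smul_mul_assoc,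
      smul_smul, evalF_x_mul, deg_cons, mul_assoc, Units.val_mul]

/-- A product of the F_iK_i is a unit multiple of K_{deg L} F_L, so the index of the summand
containing E_J K_a F_L is a − deg L. -/
theorem UKG_eq_span (b : Fin n → ℤ) : UKG χ I b =
    Submodule.span k {x | ∃ J a L, a - deg L = b ∧ x = nf χ I J a L} := by
  have hval : ∀ J L, ∃ s : kˣ, ev (E χ I) (monomial k J) * K χ I b *
      ev (fun i => F χ I i * K χ I (simpleRoot i)) (monomial k L) =
      (s : k) • nf χ I J (b + deg L) L := fun J L => by
    obtain ⟨s, hs⟩ := ev_FK_monomial χ I L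
    refine ⟨s, ?_⟩
    rw [hs, nf, (isDouble_U χ I).K_add, mul_smul_comm]
    simp only [mul_assoc]
    rfl
  rw [UKG, Uplus, Gminus, adjoin_range_eq_span, adjoin_range_eq_span, Submodule.span_mul_span,
    Submodule.span_mul_span]
  refine le_antisymm (Submodule.span_le.2 ?_) (Submodule.span_le.2 ?_)
  · rintro _ ⟨_, ⟨_, ⟨J, rfl⟩, _, rfl, rfl⟩, _, ⟨L, rfl⟩, rfl⟩
    obtain ⟨s, hs⟩ := hval J L
    beta_reduce
    rw [hs]
    exact Submodule.smul_mem _ _ (Submodule.subset_span ⟨J, _, L, by simp, rfl⟩)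
  · rintro _ ⟨J, a, L, rfl, rfl⟩
    obtain ⟨s, hs⟩ := hval J L
    rw [sub_add_cancel] at hs
    rw [← inv_smul_smul s (nf χ I J a L), Units.smul_def s, ← hs]
    exact Submodule.smul_mem _ (s⁻¹ : kˣ).val (Submodule.subset_span
      ⟨_, ⟨_, ⟨J, rfl⟩, _, rfl, rfl⟩, _, ⟨L, rfl⟩, rfl⟩)

theorem UHU_eq_span (d : (Fin n → ℕ) × (Fin n → ℕ)) : UHU χ I d =
    Submodule.span k {x | ∃ J a L, deg J = toInt d.1 ∧ deg L = toInt d.2 ∧ x = nf χ I J a L} := by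
  rw [UHU, UplusDeg, UminusDeg, H, homog_eq_span, homog_eq_span, Submodule.map_span,
    Submodule.map_span, Submodule.span_mul_span, Submodule.span_mul_span]
  congr 1
  ext x
  constructor
  · rintro ⟨_, ⟨_, ⟨_, ⟨J, hJ, rfl⟩, rfl⟩, _, ⟨a, rfl⟩, rfl⟩, _, ⟨_, ⟨L, hL, rfl⟩, rfl⟩, rfl⟩
    exact ⟨J, a, L, hJ, hL, rfl⟩
  · rintro ⟨J, a, L, hJ, hL, rfl⟩
    exact ⟨_, ⟨_, ⟨_, ⟨J, hJ, rfl⟩, rfl⟩, _, ⟨a, rfl⟩, rfl⟩, _, ⟨_, ⟨L, hL, rfl⟩, rfl⟩, rfl⟩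

variable {χ I} (hI : IsPreNicholsIdeal χ I) (hχ : ∀ i j, χ.q i j = χ.q j i)
include hI hχ

theorem UKG_aux : DirectSum.IsInternal (UKG χ I) ∧ ∀ b, P χ I b =
    diagOp hI hχ (fun _ => 1) fun a l => if a - l = b then 1 else 0 := by
  refine isInternal_of_proj (UKG χ I) _ (fun b x hx => ?_) (fun b b' hb x hx => ?_) ?_
  · rw [UKG_eq_span] at hx
    refine LinearMap.eqOn_span (g := LinearMap.id) ?_ hx
    rintro _ ⟨J, a, L, h, rfl⟩
    simp [diagOp_nf, h]
  · rw [UKG_eq_span] at hx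
    refine LinearMap.eqOn_span (g := 0) ?_ hx
    rintro _ ⟨J, a, L, rfl, rfl⟩
    simp [diagOp_nf, hb]
  · refine span_nf_eq_top _ fun J a L => ?_
    refine (le_iSup (UKG χ I) (a - deg L)) ?_
    rw [UKG_eq_span]
    exact Submodule.subset_span ⟨J, a, L, rfl, rfl⟩

theorem UHU_aux : DirectSum.IsInternal (UHU χ I) ∧ ∀ d, canonicalProj (UHU χ I) d =
    diagOp hI hχ (fun j => if j = toInt d.1 then 1 else 0)
      fun _ l => if l = toInt d.2 then 1 else 0 := by
  refine isInternal_of_proj (UHU χ I) _ (fun b x hx => ?_) (fun b b' hb x hx => ?_) ?_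
  · rw [UHU_eq_span] at hx
    refine LinearMap.eqOn_span (g := LinearMap.id) ?_ hx
    rintro _ ⟨J, a, L, h1, h2, rfl⟩
    simp [diagOp_nf, h1, h2]
  · rw [UHU_eq_span] at hx
    refine LinearMap.eqOn_span (g := 0) ?_ hx
    rintro _ ⟨J, a, L, h1, h2, rfl⟩
    rw [diagOp_nf, h1, h2]
    split_ifs with h3 h4
    · exact absurd (Prod.ext (toInt_injective h3) (toInt_injective h4)) hb
    all_goals simp
  · refine span_nf_eq_top _ fun J a L => ?_
    refine (le_iSup (UHU χ I) (fun i => J.count i, fun i => L.count i)) ?_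
    rw [UHU_eq_span]
    exact Submodule.subset_span ⟨J, a, L, rfl, rfl, rfl⟩

theorem P_nf (b : Fin n → ℤ) (J : List (Fin n)) (a : Fin n → ℤ) (L : List (Fin n)) :
    P χ I b (nf χ I J a L) = if a - deg L = b then nf χ I J a L else 0 := by
  rw [(UKG_aux hI hχ).2, diagOp_nf]
  split_ifs <;> simp

theorem proj_nf (b c : Fin n → ℕ) (J : List (Fin n)) (a : Fin n → ℤ) (L : List (Fin n)) :
    proj χ I b c (nf χ I J a L) =
      if deg J = toInt b ∧ deg L = toInt c then nf χ I J a L else 0 := by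
  rw [proj, (UHU_aux hI hχ).2, diagOp_nf]
  split_ifs with h1 h2 h3 h3 h4 h4 <;> simp_all

end Projections

/-! ### The filtration of B_c and the leading terms of words. -/

section Filtration

open FreeAlgebra (ι)

variable {k : Type*} [Field k] {n : ℕ} (χ : Bicharacter k n) (I : TwoSidedIdeal (T k n))
  (τ : Equiv.Perm (Fin n)) (c : Fin n → k)

@[simp] theorem evalB_x_mul (i : Fin n) (p : T k n) :
    evalB χ I τ c (ι k i * p) = B χ I τ c i * evalB χ I τ c p := by simp [evalB]

/-- The lattice spanned by the `α_i - α_{τ(i)}`. -/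
def thetaLattice (τ : Equiv.Perm (Fin n)) : AddSubgroup (Fin n → ℤ) :=
  AddSubgroup.closure (Set.range fun i => simpleRoot i - simpleRoot (τ i))

theorem root_sub_mem (i : Fin n) : simpleRoot i - simpleRoot (τ i) ∈ thetaLattice τ :=
  AddSubgroup.subset_closure ⟨i, rfl⟩

theorem ht_of_mem_thetaLattice {a : Fin n → ℤ} (ha : a ∈ thetaLattice τ) : ht a = 0 := by
  induction ha using AddSubgroup.closure_induction with
  | mem x hx => obtain ⟨i, rfl⟩ := hx; simp
  | zero => simp
  | add x y _ _ hx hy => simp [hx, hy]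
  | neg x _ hx => simp [hx]

variable {τ}

/-- For a = α_i − α_{τ(i)} the invariance of q under τ interchanges the two factors of χ(a, α_j). As
a consequence, F_j and E_{τ(j)}K_j⁻¹ have the same weight under H_θ. -/
theorem chi_thetaLattice {χ : Bicharacter k n} (hτ : ∀ i, τ (τ i) = i)
    (hτχ : ∀ i j, χ.q (τ i) (τ j) = χ.q i j) {a : Fin n → ℤ} (ha : a ∈ thetaLattice τ)
    (j : Fin n) : χ.toFun a (simpleRoot (τ j)) = (χ.toFun a (simpleRoot j))⁻¹ := by
  induction ha using AddSubgroup.closure_induction with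
  | mem x hx =>
    obtain ⟨i, rfl⟩ := hx
    have h1 := hτχ i j
    have h2 := hτχ (τ i) j
    rw [hτ] at h2
    simp only [Bicharacter.q] at h1 h2
    simp only [sub_eq_add_neg, χ.map_add_left, χ.neg_left]
    rw [h1, h2, mul_inv, inv_inv, mul_comm]
  | zero => simp
  | add x y _ _ hx hy => simp only [χ.map_add_left, hx, hy, mul_inv]
  | neg x _ hx => simp only [χ.neg_left, hx]

/-- Both summands of B_j commute with K_a up to the same scalar, so H_θ can be collected on the left
of any word in B_c. -/
theorem B_K (hτ : ∀ i, τ (τ i) = i) (hτχ : ∀ i j, χ.q (τ i) (τ j) = χ.q i j) {a : Fin n → ℤ}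
    (ha : a ∈ thetaLattice τ) (j : Fin n) :
    B χ I τ c j * K χ I a = (χ.toFun a (simpleRoot j) : k) • (K χ I a * B χ I τ c j) := by
  have D := isDouble_U χ I
  rw [B, add_mul, mul_add, D.F_K, smul_add, smul_mul_assoc, mul_smul_comm, mul_assoc,
    D.K_comm _ a, ← mul_assoc, ← mul_assoc, D.E_K, chi_thetaLattice hτ hτχ ha, inv_inv,
    smul_mul_assoc, smul_comm (c j)]

/-- The generators of `H_θ ⋉ U⁻`. -/
def genF (χ : Bicharacter k n) (I : TwoSidedIdeal (T k n)) (τ : Equiv.Perm (Fin n)) :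
    Fin n ⊕ Fin n → U χ I := Sum.elim (Kθ χ I τ) (F χ I)

/-- The number of factors `B_i` in a word in the generators. -/
def bCount (w : List (Fin n ⊕ Fin n)) : ℕ := w.countP fun s => s.isRight

@[simp] theorem bCount_nil : bCount ([] : List (Fin n ⊕ Fin n)) = 0 := rfl

@[simp] theorem bCount_inl (i : Fin n) (w : List (Fin n ⊕ Fin n)) :
    bCount (Sum.inl i :: w) = bCount w := by simp [bCount]

@[simp] theorem bCount_inr (i : Fin n) (w : List (Fin n ⊕ Fin n)) :
    bCount (Sum.inr i :: w) = bCount w + 1 := by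
  rw [bCount, List.countP_cons_of_pos (by simp), bCount]

theorem B_sub_F_mem (i : Fin n) : B χ I τ c i - F χ I i ∈ wt χ I 0 1 0 0 := by
  rw [B, add_sub_cancel_left]
  refine Submodule.smul_mem _ _ ?_
  have := mul_mem_wt (by simp) (by simp) (E_mem_wt (χ := χ) (I := I) (e := 0) (f := 1) (t := 0)
    (τ i)) (K_mem_wt (-simpleRoot i))
  simpa using this

theorem genF_word_mem (w : List (Fin n ⊕ Fin n)) :
    (w.map (genF χ I τ)).prod ∈ wt χ I 0 1 0 (bCount w) := by
  induction w with
  | nil => simpa using one_mem_wt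
  | cons s w ih =>
    rw [List.map_cons, List.prod_cons]
    cases s with
    | inl i =>
      have := mul_mem_wt (by simp) (by simp) (K_mem_wt (χ := χ) (I := I) (e := 0) (f := 1) (t := 0)
        (simpleRoot i - simpleRoot (τ i))) ih
      simpa [genF, Kθ] using this
    | inr i =>
      have := mul_mem_wt (by simp) (by simp) (F_mem_wt (χ := χ) (I := I) (e := 0) (f := 1) (t := 0)
        i) ih
      simpa [genF, add_comm] using this

/-- With weights e = 0, f = 1, t = 0 only the F's are counted. The letters B_i and F_i differ by a
term without F, and a telescoping product does the rest. -/
theorem genB_word_sub_mem (w : List (Fin n ⊕ Fin n)) :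
    (w.map (genB χ I τ c)).prod - (w.map (genF χ I τ)).prod ∈ wt χ I 0 1 0 (bCount w - 1) := by
  induction w with
  | nil => simp
  | cons s w ih =>
    rw [List.map_cons, List.prod_cons, List.map_cons, List.prod_cons]
    cases s with
    | inl i =>
      have := mul_mem_wt (by simp) (by simp) (K_mem_wt (χ := χ) (I := I) (e := 0) (f := 1) (t := 0)
        (simpleRoot i - simpleRoot (τ i))) ih
      simpa [genF, genB, Kθ, mul_sub] using this
    | inr i =>
      have hB : B χ I τ c i ∈ wt χ I 0 1 0 1 := by
        have := add_mem (wt_mono (by norm_num) (B_sub_F_mem χ I (τ := τ) c i)) (F_mem_wt (χ := χ) (I := I)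
          (e := 0) (f := 1) (t := 0) i)
        simpa using this
      have h1 := mul_mem_wt (by simp) (by simp) hB ih
      have h2 := mul_mem_wt (by simp) (by simp) (B_sub_F_mem χ I (τ := τ) c i) (genF_word_mem χ I (τ := τ) w)
      have h3 : B χ I τ c i * (w.map (genB χ I τ c)).prod - F χ I i * (w.map (genF χ I τ)).prod =
          B χ I τ c i * ((w.map (genB χ I τ c)).prod - (w.map (genF χ I τ)).prod) +
          (B χ I τ c i - F χ I i) * (w.map (genF χ I τ)).prod := by
        rw [mul_sub, sub_mul]; abel
      simp only [genB, genF, Sum.elim_inr]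
      refine h3 ▸ wt_mono (le_of_eq ?_) (add_mem h1 (wt_mono (le_of_eq ?_) h2))
      · simp
      · ring

/-- Normal form of words in the generators of `B_c` and of `H_θ ⋉ U⁻`. -/
theorem word_normal_form (hτ : ∀ i, τ (τ i) = i) (hτχ : ∀ i j, χ.q (τ i) (τ j) = χ.q i j)
    (w : List (Fin n ⊕ Fin n)) : ∃ s : k, ∃ a ∈ thetaLattice τ, ∃ L : List (Fin n),
      L.length = bCount w ∧
      (w.map (genB χ I τ c)).prod = s • (K χ I a * evalB χ I τ c (monomial k L)) ∧
      (w.map (genF χ I τ)).prod = s • (K χ I a * evalF χ I (monomial k L)) := by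
  have D := isDouble_U χ I
  induction w with
  | nil => exact ⟨1, 0, zero_mem _, [], by simp, by simp [D.K_zero], by simp [D.K_zero]⟩
  | cons t w ih =>
    obtain ⟨s, a, ha, L, hL, h1, h2⟩ := ih
    cases t with
    | inl i =>
      refine ⟨s, simpleRoot i - simpleRoot (τ i) + a, add_mem (root_sub_mem τ i) ha, L,
        by simp [hL], ?_, ?_⟩
      · rw [List.map_cons, List.prod_cons, h1, D.K_add, mul_smul_comm, mul_assoc]; rfl
      · rw [List.map_cons, List.prod_cons, h2, D.K_add, mul_smul_comm, mul_assoc]; rfl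
    | inr i =>
      refine ⟨s * χ.toFun a (simpleRoot i), a, ha, i :: L, by simp [hL], ?_, ?_⟩
      · rw [List.map_cons, List.prod_cons, h1, mul_smul_comm, ← mul_assoc, monomial_cons,
          evalB_x_mul, mul_smul, ← mul_assoc (K χ I a), ← smul_mul_assoc _ (K χ I a * _),
          ← B_K χ I c hτ hτχ ha]
        rfl
      · rw [List.map_cons, List.prod_cons, h2, mul_smul_comm, ← mul_assoc, monomial_cons,
          evalF_x_mul, mul_smul, ← mul_assoc (K χ I a), ← smul_mul_assoc _ (K χ I a * _),
          ← D.F_K]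
        rfl

variable {χ I c}

theorem filt_mono {l m : ℤ} (h : l ≤ m) : filt χ I τ c l ≤ filt χ I τ c m :=
  Submodule.span_mono fun _ ⟨w, hw, hx⟩ => ⟨w, hw.trans h, hx⟩

theorem filt_of_neg {m : ℤ} (h : m < 0) : filt χ I τ c m = ⊥ := by
  rw [eq_bot_iff]
  refine Submodule.span_le.2 ?_
  rintro _ ⟨w, hw, rfl⟩
  omega

theorem mul_mem_filt {l m : ℤ} {x y : U χ I} (hx : x ∈ filt χ I τ c l)
    (hy : y ∈ filt χ I τ c m) : x * y ∈ filt χ I τ c (l + m) := SetLike.mul_mem_graded hx hy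

theorem word_mem_filt {w : List (Fin n ⊕ Fin n)} {m : ℤ} (h : (bCount w : ℤ) ≤ m) :
    (w.map (genB χ I τ c)).prod ∈ filt χ I τ c m := Submodule.subset_span ⟨w, h, rfl⟩

theorem filt_le_iff {m : ℤ} {N : Submodule k (U χ I)} : filt χ I τ c m ≤ N ↔
    ∀ w : List (Fin n ⊕ Fin n), (bCount w : ℤ) ≤ m → (w.map (genB χ I τ c)).prod ∈ N :=
  Submodule.span_le.trans ⟨fun h w hw => h ⟨w, hw, rfl⟩, fun h _ ⟨w, hw, hx⟩ => hx ▸ h w hw⟩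

theorem K_mem_filt (hτ : ∀ i, τ (τ i) = i) {a : Fin n → ℤ} (ha : a ∈ thetaLattice τ) :
    K χ I a ∈ filt χ I τ c 0 := by
  have D := isDouble_U χ I
  have h : K χ I a ∈ filt χ I τ c 0 ∧ K χ I (-a) ∈ filt χ I τ c 0 := by
    induction ha using AddSubgroup.closure_induction with
    | mem x hx =>
      obtain ⟨i, rfl⟩ := hx
      refine ⟨Kθ_mem_filt χ I τ c i, ?_⟩
      have := Kθ_mem_filt χ I τ c (τ i)
      rw [Kθ, hτ] at this
      simpa using this
    | zero => simpa [D.K_zero] using word_mem_filt (w := []) le_rfl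
    | add x y _ _ hx hy =>
      rw [neg_add, D.K_add, D.K_add]
      exact ⟨by simpa using mul_mem_filt hx.1 hy.1, by simpa using mul_mem_filt hx.2 hy.2⟩
    | neg x _ hx => exact ⟨hx.2, by simpa using hx.1⟩
  exact h.1

theorem evalB_monomial_mem_filt (L : List (Fin n)) :
    evalB χ I τ c (monomial k L) ∈ filt χ I τ c L.length := by
  induction L with
  | nil => simpa using word_mem_filt (w := []) le_rfl
  | cons i L ih =>
    rw [monomial_cons, evalB_x_mul]
    have := mul_mem_filt (B_mem_filt χ I τ c i) ih
    rw [add_comm] at this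
    exact_mod_cast this

theorem evalB_mem_filt {m : ℕ} {p : T k n} (hp : p ∈ homogTotal k n m) :
    evalB χ I τ c p ∈ filt χ I τ c m := by
  refine (Submodule.span_le (p := (filt χ I τ c m).comap (evalB χ I τ c).toLinearMap)).2 ?_ hp
  rintro _ ⟨L, rfl, rfl⟩
  exact evalB_monomial_mem_filt L

theorem filt_le_Bc (m : ℤ) : filt χ I τ c m ≤ Subalgebra.toSubmodule (Bc χ I τ c) := by
  refine filt_le_iff.2 fun w _ => ?_
  refine Subalgebra.list_prod_mem _ fun x hx => ?_
  obtain ⟨s, _, rfl⟩ := List.mem_map.1 hx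
  cases s with
  | inl i => exact Algebra.subset_adjoin (Or.inl ⟨i, rfl⟩)
  | inr i => exact Algebra.subset_adjoin (Or.inr ⟨i, rfl⟩)

theorem exists_mem_filt {x : U χ I} (hx : x ∈ Bc χ I τ c) : ∃ m : ℕ, x ∈ filt χ I τ c m := by
  induction hx using Algebra.adjoin_induction with
  | mem x hx =>
    obtain ⟨i, rfl⟩ | ⟨i, rfl⟩ := hx
    · exact ⟨0, Kθ_mem_filt χ I τ c i⟩
    · exact ⟨1, B_mem_filt χ I τ c i⟩
  | algebraMap r =>
    refine ⟨0, ?_⟩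
    rw [Algebra.algebraMap_eq_smul_one]
    exact Submodule.smul_mem _ _ (by simpa using word_mem_filt (w := []) le_rfl)
  | add x y _ _ hx hy =>
    obtain ⟨l, hl⟩ := hx
    obtain ⟨m, hm⟩ := hy
    exact ⟨l + m, add_mem (filt_mono (by push_cast; omega) hl) (filt_mono (by push_cast; omega) hm)⟩
  | mul x y _ _ hx hy =>
    obtain ⟨l, hl⟩ := hx
    obtain ⟨m, hm⟩ := hy
    exact ⟨l + m, by simpa using mul_mem_filt hl hm⟩

/-- The weight counts F's and subtracts the height of the group element. Both F_i and E_{τ(i)}K_i⁻¹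
have weight 1, elements of H_θ have weight 0, and the group element K_{-d} has weight |d|, which
will keep it out of 𝓕_{|d|-1}. -/
theorem filt_le_wt (m : ℤ) :
    filt χ I τ c m ≤ wt χ I 0 1 (-1) m := by
  refine filt_le_iff.2 fun w hw => ?_
  refine wt_mono hw ?_
  clear hw
  induction w with
  | nil => simpa using one_mem_wt
  | cons s w ih =>
    rw [List.map_cons, List.prod_cons]
    cases s with
    | inl i =>
      have := mul_mem_wt (by simp) (by simp) (K_mem_wt (χ := χ) (I := I) (e := 0) (f := 1)
        (t := -1) (simpleRoot i - simpleRoot (τ i))) ih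
      simpa [genB, Kθ] using this
    | inr i =>
      have hB : B χ I τ c i ∈ wt χ I 0 1 (-1) 1 := by
        refine add_mem (F_mem_wt i) (Submodule.smul_mem _ _ ?_)
        have := mul_mem_wt (by simp) (by simp) (E_mem_wt (χ := χ) (I := I) (e := 0) (f := 1)
          (t := -1) (τ i)) (K_mem_wt (-simpleRoot i))
        simpa using this
      have := mul_mem_wt (by simp) (by simp) hB ih
      simpa [genB, add_comm] using this

end Filtration

/-! ### Top parts with respect to the number of F's. -/

section TopPart

variable {k : Type*} [Field k] {n : ℕ} {χ : Bicharacter k n} {I : TwoSidedIdeal (T k n)}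
  {τ : Equiv.Perm (Fin n)} {c : Fin n → k}
  (hI : IsPreNicholsIdeal χ I) (hχ : ∀ i j, χ.q i j = χ.q j i)

/-- The projection `⨁_a U⁺ H U⁻_{-a} → ⨁_{ht a = m} U⁺ H U⁻_{-a}`. -/
noncomputable def topPart (m : ℤ) : U χ I →ₗ[k] U χ I :=
  diagOp hI hχ (fun _ => 1) fun _ l => if ht l = m then 1 else 0

theorem topPart_nf (m : ℤ) (J : List (Fin n)) (a : Fin n → ℤ) (L : List (Fin n)) :
    topPart hI hχ m (nf χ I J a L) = if (L.length : ℤ) = m then nf χ I J a L else 0 := by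
  rw [topPart, diagOp_nf, ht_deg]
  split_ifs <;> simp

theorem topPart_eq_zero {r m : ℤ} (h : r < m) {x : U χ I} (hx : x ∈ wt χ I 0 1 0 r) :
    topPart hI hχ m x = 0 := by
  refine (wt_le_iff (N := LinearMap.ker (topPart hI hχ m))).2 (fun J a L hw => ?_) hx
  rw [LinearMap.mem_ker, topPart_nf, if_neg (by omega)]

theorem topPart_topPart (l m : ℤ) (x : U χ I) :
    topPart hI hχ l (topPart hI hχ m x) = if l = m then topPart hI hχ m x else 0 := by
  have : topPart hI hχ l ∘ₗ topPart hI hχ m = if l = m then topPart hI hχ m else 0 :=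
    linearMap_ext_nf fun J a L => by
      rw [LinearMap.comp_apply, topPart_nf]
      split_ifs with h1 h2 h2
      · rw [topPart_nf, topPart_nf, h2]
      · rw [topPart_nf, if_neg (by omega)]; rfl
      · rw [topPart_nf, map_zero, if_neg h1]
      · simp
  have h := LinearMap.congr_fun this x
  rw [LinearMap.comp_apply] at h
  rw [h]
  split_ifs <;> rfl

/-- Left multiplication by E's and by group elements does not change the number of F's in a normally
ordered monomial. The injectivity of the Iwasawa map relies on this. -/
theorem topPart_evalE_mul_K_mul (m : ℤ) (p : T k n) (b : Fin n → ℤ) (x : U χ I) :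
    topPart hI hχ m (evalE χ I p * K χ I b * x) =
      evalE χ I p * K χ I b * topPart hI hχ m x := by
  have : topPart hI hχ m ∘ₗ LinearMap.mulLeft k (evalE χ I p * K χ I b) =
      LinearMap.mulLeft k (evalE χ I p * K χ I b) ∘ₗ topPart hI hχ m :=
    linearMap_ext_nf fun J a L => by
      simp only [LinearMap.comp_apply, LinearMap.mulLeft_apply, topPart_nf, mul_assoc, K_mul_nf,
        mul_smul_comm, map_smul]
      have key : topPart hI hχ m (evalE χ I p * nf χ I J (b + a) L) =
          if (L.length : ℤ) = m then evalE χ I p * nf χ I J (b + a) L else 0 := by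
        induction p using monomial_induction with
        | hm J' => rw [evalE_mul_nf, topPart_nf]
        | h0 => simp
        | hadd p q hp hq =>
          rw [map_add, add_mul, map_add, hp, hq]; split_ifs <;> simp
        | hsmul r p hp => rw [map_smul, smul_mul_assoc, map_smul, hp]; split_ifs <;> simp
      rw [key]
      split_ifs <;> simp [K_mul_nf]
  exact LinearMap.congr_fun this x

theorem topPart_genF_word (w : List (Fin n ⊕ Fin n)) (hτ : ∀ i, τ (τ i) = i)
    (hτχ : ∀ i j, χ.q (τ i) (τ j) = χ.q i j) :
    topPart hI hχ (bCount w) ((w.map (genF χ I τ)).prod) = (w.map (genF χ I τ)).prod := by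
  obtain ⟨s, a, -, L, hL, -, h⟩ := word_normal_form χ I 0 hτ hτχ w
  have h' : K χ I a * evalF χ I (monomial k L) = nf χ I [] a L := by simp [nf]
  rw [h, map_smul, h', topPart_nf, if_pos (by rw [hL])]

variable (hτ : ∀ i, τ (τ i) = i) (hτχ : ∀ i j, χ.q (τ i) (τ j) = χ.q i j)
include hτ hτχ

theorem topPart_genB_word (w : List (Fin n ⊕ Fin n)) {m : ℤ} (hw : (bCount w : ℤ) ≤ m) :
    topPart hI hχ m ((w.map (genB χ I τ c)).prod) =
      if (bCount w : ℤ) = m then (w.map (genF χ I τ)).prod else 0 := by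
  have h1 := genB_word_sub_mem χ I (τ := τ) c w
  have h2 := genF_word_mem χ I (τ := τ) w
  have h3 : topPart hI hχ m ((w.map (genB χ I τ c)).prod) =
      topPart hI hχ m ((w.map (genF χ I τ)).prod) := by
    rw [← sub_eq_zero, ← map_sub]
    exact topPart_eq_zero hI hχ (by omega) h1
  rw [h3]
  split_ifs with h
  · rw [← h, topPart_genF_word hI hχ w hτ hτχ]
  · exact topPart_eq_zero hI hχ (by omega) h2

/-- It suffices to consider words: the top part of a word with the full number of B's is the
corresponding word in the F's, and for shorter words both sides vanish. -/
theorem topPart_mul {l m : ℤ} {x y : U χ I} (hx : x ∈ filt χ I τ c l) (hy : y ∈ filt χ I τ c m) :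
    topPart hI hχ (l + m) (x * y) = topPart hI hχ l x * topPart hI hχ m y := by
  refine LinearMap.eqOn_span (f := topPart hI hχ (l + m) ∘ₗ LinearMap.mulRight k y)
    (g := LinearMap.mulRight k (topPart hI hχ m y) ∘ₗ topPart hI hχ l) ?_ hx
  rintro _ ⟨v, hv, rfl⟩
  refine LinearMap.eqOn_span
    (f := topPart hI hχ (l + m) ∘ₗ LinearMap.mulLeft k ((v.map (genB χ I τ c)).prod))
    (g := LinearMap.mulLeft k (topPart hI hχ l ((v.map (genB χ I τ c)).prod)) ∘ₗ
      topPart hI hχ m) ?_ hy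
  rintro _ ⟨w, hw, rfl⟩
  have hc : bCount (v ++ w) = bCount v + bCount w := List.countP_append
  simp only [LinearMap.comp_apply, LinearMap.mulLeft_apply]
  rw [← List.prod_append, ← List.map_append,
    topPart_genB_word hI hχ hτ hτχ _ (by rw [hc]; push_cast; exact add_le_add hv hw),
    topPart_genB_word hI hχ hτ hτχ _ hv, topPart_genB_word hI hχ hτ hτχ _ hw, hc]
  push_cast
  change (bCount v : ℤ) ≤ l at hv
  change (bCount w : ℤ) ≤ m at hw
  split_ifs with h1 h2 h3 h2 h3
  · simp
  all_goals first | omega | simp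

theorem topPart_mem_partialBosonization {m : ℤ} {x : U χ I} (hx : x ∈ filt χ I τ c m) :
    topPart hI hχ m x ∈ partialBosonization χ I τ := by
  refine (filt_le_iff (N := (Subalgebra.toSubmodule (partialBosonization χ I τ)).comap
    (topPart hI hχ m))).2 (fun w hw => ?_) hx
  rw [Submodule.mem_comap, topPart_genB_word hI hχ hτ hτχ w hw]
  split_ifs
  · refine Subalgebra.list_prod_mem _ fun x hx => ?_
    obtain ⟨s, _, rfl⟩ := List.mem_map.1 hx
    cases s with
    | inl i => exact Kθ_mem_partialBosonization χ I τ i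
    | inr i => exact F_mem_partialBosonization χ I τ i
  · exact zero_mem _

theorem topPart_filt_pred {m : ℤ} {x : U χ I} (hx : x ∈ filt χ I τ c (m - 1)) :
    topPart hI hχ m x = 0 := by
  refine (filt_le_iff (N := LinearMap.ker (topPart hI hχ m))).2 (fun w hw => ?_) hx
  rw [LinearMap.mem_ker, topPart_genB_word hI hχ hτ hτχ w (by omega), if_neg (by omega)]

theorem topPart_evalB {m : ℕ} {p : T k n} (hp : p ∈ homogTotal k n m) :
    topPart hI hχ m (evalB χ I τ c p) = evalF χ I p := by
  refine LinearMap.eqOn_span (f := topPart hI hχ m ∘ₗ (evalB χ I τ c).toLinearMap)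
    (g := (evalF χ I).toLinearMap) ?_ hp
  rintro _ ⟨L, rfl, rfl⟩
  clear hp
  have hB : evalB χ I τ c (monomial k L) = ((L.map Sum.inr).map (genB χ I τ c)).prod := by
    clear * -
    induction L with
    | nil => simp
    | cons i L ih => rw [monomial_cons, evalB_x_mul, ih]; simp [genB]
  have hF : evalF χ I (monomial k L) = ((L.map Sum.inr).map (genF χ I τ)).prod := by
    clear * -
    induction L with
    | nil => simp
    | cons i L ih => rw [monomial_cons, evalF_x_mul, ih]; simp [genF]
  have hc : bCount (L.map (Sum.inr : Fin n → Fin n ⊕ Fin n)) = L.length := by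
    simp [bCount, List.countP_map, Function.comp_def]
  simp only [LinearMap.comp_apply, AlgHom.toLinearMap_apply]
  rw [hB, topPart_genB_word hI hχ hτ hτχ _ (by rw [hc]), if_pos (by rw [hc]), hF]

end TopPart

/-! ### The natural map φ and the lifting of relations. -/

section NaturalMap

variable {k : Type*} [Field k] {n : ℕ} {χ : Bicharacter k n} {I : TwoSidedIdeal (T k n)}
  {τ : Equiv.Perm (Fin n)} {c : Fin n → k}

/-- The element `x t^m` of the Rees algebra. -/
noncomputable def reesMon (m : ℕ) (x : U χ I) (hx : x ∈ filt χ I τ c m) : rees (filt χ I τ c) :=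
  ⟨Polynomial.monomial m x, by
    intro l
    rw [Polynomial.coeff_monomial]
    split_ifs with h
    · exact h ▸ hx
    · exact Submodule.zero_mem _⟩

theorem reesMon_mem_reesIdeal {m : ℕ} {x : U χ I} (hx : x ∈ filt χ I τ c m) :
    reesMon m x hx ∈ reesIdeal (filt χ I τ c) ↔ x ∈ filt χ I τ c ((m : ℤ) - 1) := by
  constructor
  · intro h
    simpa [reesMon] using h m
  · intro h l
    change (Polynomial.monomial m x).coeff l ∈ _
    rw [Polynomial.coeff_monomial]
    split_ifs with hl
    · exact hl ▸ h
    · exact zero_mem _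

theorem rees_eq_sum (f : rees (filt χ I τ c)) :
    f = ∑ m ∈ f.1.support, reesMon m (f.1.coeff m) (f.2 m) := by
  refine Subtype.ext ?_
  rw [AddSubmonoidClass.coe_finsetSum]
  exact f.1.as_sum_support

theorem reesMon_mul {l m : ℕ} {x y : U χ I} (hx : x ∈ filt χ I τ c l) (hy : y ∈ filt χ I τ c m) :
    reesMon l x hx * reesMon m y hy =
      reesMon (l + m) (x * y) (by push_cast; exact mul_mem_filt hx hy) :=
  Subtype.ext (Polynomial.monomial_mul_monomial l m x y)

/-- Algebra homomorphisms on the Rees algebra which agree on the generators of `B_c` and vanish on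
the ideal `reesIdeal` are equal. -/
theorem reesHom_ext {R : Type*} [Semiring R] [Algebra k R] {ψ ψ' : rees (filt χ I τ c) →ₐ[k] R}
    (h : ∀ x ∈ reesIdeal (filt χ I τ c), ψ x = 0) (h' : ∀ x ∈ reesIdeal (filt χ I τ c), ψ' x = 0)
    (hB : ∀ i, ψ (reesMon 1 _ (B_mem_filt χ I τ c i)) = ψ' (reesMon 1 _ (B_mem_filt χ I τ c i)))
    (hK : ∀ i, ψ (reesMon 0 _ (Kθ_mem_filt χ I τ c i)) =
      ψ' (reesMon 0 _ (Kθ_mem_filt χ I τ c i))) : ψ = ψ' := by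
  have hw : ∀ w : List (Fin n ⊕ Fin n),
      ψ (reesMon (bCount w) ((w.map (genB χ I τ c)).prod) (word_mem_filt le_rfl)) =
        ψ' (reesMon (bCount w) ((w.map (genB χ I τ c)).prod) (word_mem_filt le_rfl)) := by
    intro w
    induction w with
    | nil =>
      have : reesMon (bCount ([] : List (Fin n ⊕ Fin n))) ((([] : List (Fin n ⊕ Fin n)).map
          (genB χ I τ c)).prod) (word_mem_filt le_rfl) = 1 := rfl
      rw [this, map_one, map_one]
    | cons s w ih =>
      cases s with
      | inl i =>
        have : reesMon (bCount (Sum.inl i :: w)) (((Sum.inl i :: w).map (genB χ I τ c)).prod)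
            (word_mem_filt le_rfl) = reesMon 0 _ (Kθ_mem_filt χ I τ c i) *
            reesMon (bCount w) ((w.map (genB χ I τ c)).prod) (word_mem_filt le_rfl) := by
          rw [reesMon_mul]
          refine Subtype.ext ?_
          simp [reesMon, genB]
        rw [this, map_mul, map_mul, ih, hK]
      | inr i =>
        have : reesMon (bCount (Sum.inr i :: w)) (((Sum.inr i :: w).map (genB χ I τ c)).prod)
            (word_mem_filt le_rfl) = reesMon 1 _ (B_mem_filt χ I τ c i) *
            reesMon (bCount w) ((w.map (genB χ I τ c)).prod) (word_mem_filt le_rfl) := by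
          rw [reesMon_mul]
          refine Subtype.ext ?_
          simp [reesMon, genB, add_comm]
        rw [this, map_mul, map_mul, ih, hB]
  have hm : ∀ (m : ℕ) (x : U χ I) (hx : x ∈ filt χ I τ c m),
      ψ (reesMon m x hx) = ψ' (reesMon m x hx) := by
    intro m x hx
    induction hx using Submodule.span_induction with
    | mem x hx =>
      obtain ⟨w, hwm, rfl⟩ := hx
      change (bCount w : ℤ) ≤ m at hwm
      rcases hwm.eq_or_lt with he | hl
      · have : bCount w = m := by exact_mod_cast he
        subst this
        exact hw w
      -- A word with fewer than m letters B_i lies in 𝓕_{m-1} and therefore dies in degree m of the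
      -- associated graded algebra.
      · have := (reesMon_mem_reesIdeal (word_mem_filt hwm)).2 (word_mem_filt (c := c) (χ := χ)
          (I := I) (τ := τ) (by omega))
        rw [h _ this, h' _ this]
    | zero =>
      have : reesMon m (0 : U χ I) (zero_mem (filt χ I τ c m)) = 0 :=
        Subtype.ext (Polynomial.monomial_zero_right m)
      rw [this, map_zero, map_zero]
    | add x y hx hy ihx ihy =>
      have : reesMon m (x + y) (add_mem hx hy) = reesMon m x hx + reesMon m y hy :=
        Subtype.ext (map_add (Polynomial.monomial m) x y)
      rw [this, map_add, map_add, ihx, ihy]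
    | smul r x hx ih =>
      have : reesMon m (r • x) (Submodule.smul_mem _ r hx) = r • reesMon m x hx :=
        Subtype.ext (Polynomial.smul_monomial r m x).symm
      rw [this, map_smul, map_smul, ih]
  ext f
  rw [rees_eq_sum f, map_sum, map_sum]
  exact Finset.sum_congr rfl fun m _ => hm m _ _

theorem IsNaturalMap.surjective {φ : grB χ I τ c →ₐ[k] partialBosonization χ I τ}
    (hφ : IsNaturalMap χ I τ c φ) : Function.Surjective φ := by
  have h : partialBosonization χ I τ ≤
      ((partialBosonization χ I τ).val.comp φ).range := by
    refine Algebra.adjoin_le ?_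
    rintro _ (⟨i, rfl⟩ | ⟨i, rfl⟩)
    · exact ⟨_, congrArg Subtype.val (hφ.map_H i)⟩
    · exact ⟨_, congrArg Subtype.val (hφ.map_B i)⟩
  rintro ⟨y, hy⟩
  obtain ⟨x, hx⟩ := h hy
  exact ⟨x, Subtype.ext hx⟩

variable (hI : IsPreNicholsIdeal χ I) (hχ : ∀ i j, χ.q i j = χ.q j i)

/-- The linear map `∑ x_m t^m ↦ ∑ topPart m x_m`. -/
noncomputable def topSum : Polynomial (U χ I) →ₗ[k] U χ I :=
  Polynomial.lsum fun m => topPart hI hχ m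

@[simp] theorem topSum_monomial (m : ℕ) (x : U χ I) :
    topSum hI hχ (Polynomial.monomial m x) = topPart hI hχ m x := by
  simp [topSum, Polynomial.lsum_apply, Polynomial.sum_monomial_index]

theorem topSum_eq (f : Polynomial (U χ I)) :
    topSum hI hχ f = ∑ m ∈ f.support, topPart hI hχ m (f.coeff m) := by
  simp [topSum, Polynomial.lsum_apply, Polynomial.sum_def]

variable (hτ : ∀ i, τ (τ i) = i) (hτχ : ∀ i j, χ.q (τ i) (τ j) = χ.q i j)

/-- The algebra homomorphism from the Rees algebra of `B_c` to `H_θ ⋉ U⁻` given by taking top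
parts. -/
noncomputable def topHom : rees (filt χ I τ c) →ₐ[k] partialBosonization χ I τ :=
  AlgHom.ofLinearMap
    (LinearMap.codRestrict (Subalgebra.toSubmodule (partialBosonization χ I τ))
      (topSum hI hχ ∘ₗ (rees (filt χ I τ c)).val.toLinearMap) (by
        intro f
        rw [LinearMap.comp_apply, topSum_eq]
        exact sum_mem fun m _ => topPart_mem_partialBosonization hI hχ hτ hτχ (f.2 m)))
    (by
      refine Subtype.ext ?_
      change topSum hI hχ (Polynomial.monomial 0 1) = 1
      rw [topSum_monomial, ← nf_nil_zero_nil, topPart_nf]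
      simp)
    (by
      intro f g
      refine Subtype.ext ?_
      change topSum hI hχ (f.1 * g.1) = topSum hI hχ f.1 * topSum hI hχ g.1
      conv_lhs => rw [f.1.as_sum_support, g.1.as_sum_support]
      rw [Finset.sum_mul_sum, map_sum, topSum_eq, topSum_eq, Finset.sum_mul_sum]
      refine Finset.sum_congr rfl fun l _ => ?_
      rw [map_sum]
      refine Finset.sum_congr rfl fun m _ => ?_
      rw [Polynomial.monomial_mul_monomial, topSum_monomial]
      push_cast
      exact topPart_mul hI hχ hτ hτχ (f.2 l) (g.2 m))

theorem topHom_coe (f : rees (filt χ I τ c)) :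
    (topHom hI hχ hτ hτχ f : U χ I) = topSum hI hχ f.1 := rfl

theorem topHom_reesMon (m : ℕ) (x : U χ I) (hx : x ∈ filt χ I τ c m) :
    (topHom hI hχ hτ hτχ (reesMon m x hx) : U χ I) = topPart hI hχ m x :=
  topSum_monomial hI hχ m x

theorem topHom_eq_zero {f : rees (filt χ I τ c)} (hf : f ∈ reesIdeal (filt χ I τ c)) :
    topHom hI hχ hτ hτχ f = 0 := by
  refine Subtype.ext ?_
  rw [topHom_coe, topSum_eq]
  exact Finset.sum_eq_zero fun m _ => topPart_filt_pred hI hχ hτ hτχ (hf m)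

theorem topHom_B (i : Fin n) : topHom hI hχ hτ hτχ (reesMon 1 _ (B_mem_filt χ I τ c i)) =
    ⟨F χ I i, F_mem_partialBosonization χ I τ i⟩ := by
  refine Subtype.ext ?_
  rw [topHom_reesMon]
  simpa [genB, genF] using topPart_genB_word hI hχ hτ hτχ (c := c) [Sum.inr i] (m := 1) (by simp)

theorem topHom_K (i : Fin n) : topHom hI hχ hτ hτχ (reesMon 0 _ (Kθ_mem_filt χ I τ c i)) =
    ⟨Kθ χ I τ i, Kθ_mem_partialBosonization χ I τ i⟩ := by
  refine Subtype.ext ?_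
  rw [topHom_reesMon]
  simpa [genB, genF] using topPart_genB_word hI hχ hτ hτχ (c := c) [Sum.inl i] (m := 0) (by simp)

include hτ hτχ in
/-- The natural map, on all of `gr(B_c)`. -/
theorem IsNaturalMap.apply_mk {φ : grB χ I τ c →ₐ[k] partialBosonization χ I τ}
    (hφ : IsNaturalMap χ I τ c φ) (f : rees (filt χ I τ c)) :
    φ (Ideal.Quotient.mk _ f) = topHom hI hχ hτ hτχ f := by
  have : φ.comp (Ideal.Quotient.mkₐ k (reesIdeal (filt χ I τ c))) = topHom hI hχ hτ hτχ := by
    refine reesHom_ext (ψ' := topHom hI hχ hτ hτχ) (fun x hx => ?_) (fun x hx => ?_) (fun i => ?_)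
      fun i => ?_
    · have : Ideal.Quotient.mkₐ k (reesIdeal (filt χ I τ c)) x = 0 :=
        Ideal.Quotient.eq_zero_iff_mem.2 hx
      rw [AlgHom.comp_apply, this, map_zero]
    · exact topHom_eq_zero hI hχ hτ hτχ hx
    · rw [topHom_B]; exact hφ.map_B i
    · rw [topHom_K]; exact hφ.map_H i
  exact DFunLike.congr_fun this f

include hI hχ in
/-- The relation `N_rel = ℕ` in terms of the ideal `I`. -/
theorem Nrel_eq_univ_iff : Nrel χ I τ c = Set.univ ↔
    ∀ m, ∀ p ∈ homogTotal k n m, p ∈ I → evalB χ I τ c p ∈ filt χ I τ c ((m : ℤ) - 1) := by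
  rw [Set.eq_univ_iff_forall]
  exact ⟨fun h m p hp hpI => h m m le_rfl p hp (evalF_eq_zero χ I hpI),
    fun h d m _ p hp hp0 => h m p hp ((evalF_eq_zero_iff hI hχ).1 hp0)⟩

include hI hχ hτ hτχ

theorem existsUnique_naturalMap : ∃! φ, IsNaturalMap χ I τ c φ := by
  refine ⟨Ideal.Quotient.liftₐ _ (topHom hI hχ hτ hτχ) fun f hf => topHom_eq_zero hI hχ hτ hτχ hf,
    ⟨fun i => topHom_B hI hχ hτ hτχ i, fun i => topHom_K hI hχ hτ hτχ i⟩, fun φ hφ => ?_⟩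
  ext x
  obtain ⟨f, rfl⟩ := Ideal.Quotient.mk_surjective x
  rw [hφ.apply_mk hI hχ hτ hτχ]
  rfl

/-- The degree m part of the associated graded algebra is sent to elements with exactly m factors F,
so the kernel of φ is graded and injectivity can be tested in each degree. -/
theorem IsNaturalMap.injective_iff {φ : grB χ I τ c →ₐ[k] partialBosonization χ I τ}
    (hφ : IsNaturalMap χ I τ c φ) : Function.Injective φ ↔
      ∀ (m : ℕ), ∀ x ∈ filt χ I τ c m, topPart hI hχ m x = 0 →
        x ∈ filt χ I τ c ((m : ℤ) - 1) := by
  rw [injective_iff_map_eq_zero]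
  constructor
  · intro h m x hx h0
    have h1 := h (Ideal.Quotient.mk _ (reesMon m x hx)) (by
      rw [hφ.apply_mk hI hχ hτ hτχ]
      exact Subtype.ext ((topHom_reesMon hI hχ hτ hτχ m x hx).trans h0))
    exact (reesMon_mem_reesIdeal hx).1 (Ideal.Quotient.eq_zero_iff_mem.1 h1)
  · intro h y hy
    obtain ⟨f, rfl⟩ := Ideal.Quotient.mk_surjective y
    rw [hφ.apply_mk hI hχ hτ hτχ] at hy
    refine Ideal.Quotient.eq_zero_iff_mem.2 fun l => h l _ (f.2 l) ?_
    have h1 : topSum hI hχ f.1 = 0 := congrArg Subtype.val hy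
    -- Taking the part with l factors F isolates the l-th summand.
    have h2 := congrArg (topPart hI hχ l) h1
    rw [topSum_eq, map_sum, map_zero] at h2
    by_cases hl : l ∈ f.1.support
    · rw [Finset.sum_eq_single l] at h2
      · rwa [topPart_topPart, if_pos rfl] at h2
      · intro m _ hm
        rw [topPart_topPart, if_neg (by exact_mod_cast hm.symm)]
      · exact fun h' => absurd hl h'
    · rw [Polynomial.notMem_support_iff.1 hl, map_zero]

/-- If the relations lift, then an element of `𝓕_m` with vanishing top part is in `𝓕_{m-1}`. -/
theorem mem_filt_pred_of_topPart_eq_zero {m : ℕ}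
    (hrel : ∀ p ∈ homogTotal k n m, p ∈ I → evalB χ I τ c p ∈ filt χ I τ c ((m : ℤ) - 1))
    {x : U χ I} (hx : x ∈ filt χ I τ c m) (h0 : topPart hI hχ m x = 0) :
    x ∈ filt χ I τ c ((m : ℤ) - 1) := by
  classical
  set N := filt χ I τ c ((m : ℤ) - 1) with hN
  have hε : idealSubmodule I ≤ LinearMap.ker (counit (k := k) (n := n)) :=
    fun q hq => hI.counit_eq_zero hq
  -- The map ψ built from g is a one-sided inverse of the top part: K_a p(F) is sent to the class of
  -- K_a p(B) modulo 𝓕_{m-1}. The hypothesis `hrel` makes it well defined on T/I.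
  let g : (Fin n → ℤ) → T k n →ₗ[k] U χ I ⧸ N := fun a =>
    if a ∈ thetaLattice τ then
      N.mkQ ∘ₗ LinearMap.mulLeft k (K χ I a) ∘ₗ (evalB χ I τ c).toLinearMap ∘ₗ totalPart m
    else 0
  have hg : ∀ a, idealSubmodule I ≤ LinearMap.ker (g a) := by
    intro a p hp
    rw [LinearMap.mem_ker]
    simp only [g]
    split_ifs with ha
    · simp only [LinearMap.comp_apply]
      rw [Submodule.mkQ_apply, Submodule.Quotient.mk_eq_zero]
      have := mul_mem_filt (K_mem_filt (c := c) (χ := χ) (I := I) hτ ha)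
        (hrel _ (totalPart_mem m p) (hI.totalPart_mem m hp))
      rwa [zero_add] at this
    · rfl
  let ψ : U χ I →ₗ[k] U χ I ⧸ N := (TensorProduct.lid k (U χ I ⧸ N)).toLinearMap ∘ₗ
    TensorProduct.map ((idealSubmodule I).liftQ counit hε)
      (Finsupp.lsum k fun a => (idealSubmodule I).liftQ (g a) (hg a)) ∘ₗ toTri hI hχ
  have hψ : ∀ a L, ψ (K χ I a * evalF χ I (monomial k L)) = g a (monomial k L) := by
    intro a L
    have h1 := toTri_apply hI hχ 1 (monomial k L) a
    rw [map_one, one_mul] at h1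
    have h3 : (idealSubmodule I).liftQ counit hε (qmk I 1) = 1 := by
      have := monoLift_monomial (k := k) (n := n) (fun J => if J = [] then (1 : k) else 0) []
      change counit (1 : T k n) = 1
      simpa [counit] using this
    simp only [ψ, LinearMap.comp_apply, h1, TensorProduct.map_tmul, h3, LinearEquiv.coe_coe,
      TensorProduct.lid_tmul, one_smul]
    simp only [Finsupp.lsum_single]
    rfl
  have key : ∀ y ∈ filt χ I τ c m, ψ (topPart hI hχ m y) = N.mkQ y := by
    intro y hy
    refine LinearMap.eqOn_span (f := ψ ∘ₗ topPart hI hχ m) (g := N.mkQ) ?_ hy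
    rintro _ ⟨w, hw, rfl⟩
    rw [LinearMap.comp_apply, topPart_genB_word hI hχ hτ hτχ w hw]
    split_ifs with h
    · obtain ⟨s, a, ha, L, hL, h1, h2⟩ := word_normal_form χ I c hτ hτχ w
      rw [h1, h2, map_smul, hψ, map_smul]
      have hLm : L.length = m := by rw [hL]; exact_mod_cast h
      simp only [g, if_pos ha, LinearMap.comp_apply, totalPart_monomial, hLm]
      simp
    · change (bCount w : ℤ) ≤ m at hw
      rw [map_zero, Submodule.mkQ_apply, eq_comm, Submodule.Quotient.mk_eq_zero, hN]
      exact word_mem_filt (by omega)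
  have := key x hx
  rw [h0, map_zero] at this
  exact (Submodule.Quotient.mk_eq_zero N).1 this.symm

/-- In one direction the injectivity criterion is applied to p(B), whose top part p(F) is zero; in
the other, lifted relations allow B's to be recovered from F's modulo lower terms. -/
theorem IsNaturalMap.bijective_iff {φ : grB χ I τ c →ₐ[k] partialBosonization χ I τ}
    (hφ : IsNaturalMap χ I τ c φ) : Function.Bijective φ ↔ Nrel χ I τ c = Set.univ := by
  rw [Function.Bijective, and_iff_left (hφ.surjective),
    hφ.injective_iff hI hχ hτ hτχ, Nrel_eq_univ_iff hI hχ]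
  refine ⟨fun h m p hp hpI => h m _ (evalB_mem_filt hp) ?_,
    fun h m x hx h0 => mem_filt_pred_of_topPart_eq_zero hI hχ hτ hτχ (h m) hx h0⟩
  rw [topPart_evalB hI hχ hτ hτχ hp, evalF_eq_zero χ I hpI]

end NaturalMap

/-! ### The coproduct of U(χ), its contractions, and its restriction to B_c. -/

section Coproduct

open FreeAlgebra (ι)

variable {k : Type*} [Field k] {n : ℕ} {χ : Bicharacter k n} {I : TwoSidedIdeal (T k n)}

theorem IsPreNicholsIdeal.map_eq_zero_of_homog (hI : IsPreNicholsIdeal χ I) {X : Type*}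
    [AddCommMonoid X] [Module k X] (G : T k n →ₗ[k] X)
    (h : ∀ a, ∀ p ∈ I, p ∈ homog k a → G p = 0) {p : T k n} (hp : p ∈ I) : G p = 0 := by
  have : idealSubmodule I ≤ LinearMap.ker G :=
    hI.graded.trans (iSup_le fun a q hq => h a q hq.1 hq.2)
  exact this hp

variable (χ I)

theorem ev_E_tmul_one (p : T k n) :
    ev (fun i => E χ I i ⊗ₜ[k] (1 : U χ I)) p = evalE χ I p ⊗ₜ 1 := by
  have : ev (fun i => E χ I i ⊗ₜ[k] (1 : U χ I)) =
      Algebra.TensorProduct.includeLeft.comp (evalE χ I) := by ext i; simp [evalE]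
  rw [this]; rfl

theorem ev_one_tmul_F (p : T k n) :
    ev (fun i => (1 : U χ I) ⊗ₜ[k] F χ I i) p = 1 ⊗ₜ evalF χ I p := by
  have : ev (fun i => (1 : U χ I) ⊗ₜ[k] F χ I i) =
      Algebra.TensorProduct.includeRight.comp (evalF χ I) := by ext i; simp [evalF]
  rw [this]; rfl

theorem ev_K_tmul_E_monomial (J : List (Fin n)) :
    ev (fun i => K χ I (simpleRoot i) ⊗ₜ[k] E χ I i) (monomial k J) =
      K χ I (deg J) ⊗ₜ evalE χ I (monomial k J) := by
  induction J with
  | nil => simp [(isDouble_U χ I).K_zero, Algebra.TensorProduct.one_def]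
  | cons i J ih => rw [monomial_cons, map_mul, ih]; simp [(isDouble_U χ I).K_add]

/-- The evaluation of a monomial at the elements `r_i ⊗ K_i⁻¹`. -/
theorem ev_tmul_K_monomial (r : Fin n → U χ I) (J : List (Fin n)) :
    ev (fun i => r i ⊗ₜ[k] K χ I (-simpleRoot i)) (monomial k J) =
      ev r (monomial k J) ⊗ₜ K χ I (-deg J) := by
  induction J with
  | nil => simp [(isDouble_U χ I).K_zero, Algebra.TensorProduct.one_def]
  | cons i J ih =>
    rw [monomial_cons, map_mul, ih]
    simp only [FreeAlgebra.lift_ι_apply, Algebra.TensorProduct.tmul_mul_tmul, deg_cons, neg_add,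
      (isDouble_U χ I).K_add, map_mul]

theorem ev_tmul_K_of_mem_homog (r : Fin n → U χ I) {a : Fin n → ℕ} {p : T k n}
    (hp : p ∈ homog k a) : ev (fun i => r i ⊗ₜ[k] K χ I (-simpleRoot i)) p =
      ev r p ⊗ₜ K χ I (-toInt a) := by
  rw [homog_eq_span] at hp
  refine LinearMap.eqOn_span
    (f := (ev fun i => r i ⊗ₜ[k] K χ I (-simpleRoot i)).toLinearMap)
    (g := (TensorProduct.mk k (U χ I) (U χ I)).flip (K χ I (-toInt a)) ∘ₗ
      (ev r).toLinearMap) ?_ hp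
  rintro _ ⟨J, hJ, rfl⟩
  simp [ev_tmul_K_monomial, hJ]

variable {χ I}

theorem ev_K_tmul_E_eq_zero (hI : IsPreNicholsIdeal χ I) {p : T k n} (hp : p ∈ I) :
    ev (fun i => K χ I (simpleRoot i) ⊗ₜ[k] E χ I i) p = 0 := by
  refine hI.map_eq_zero_of_homog (ev (k := k) fun i => K χ I (simpleRoot i) ⊗ₜ[k] E χ I i).toLinearMap
    (fun a p hp hpa => ?_) hp
  rw [homog_eq_span] at hpa
  have h := LinearMap.eqOn_span
    (f := (ev fun i => K χ I (simpleRoot i) ⊗ₜ[k] E χ I i).toLinearMap)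
    (g := TensorProduct.mk k (U χ I) (U χ I) (K χ I (toInt a)) ∘ₗ
      (evalE χ I).toLinearMap) (by
        rintro _ ⟨J, hJ, rfl⟩
        simp [ev_K_tmul_E_monomial, hJ]) hpa
  rw [h]
  simp [evalE_eq_zero χ I hp]

theorem ev_F_tmul_K_eq_zero (hI : IsPreNicholsIdeal χ I) {p : T k n} (hp : p ∈ I) :
    ev (fun i => F χ I i ⊗ₜ[k] K χ I (-simpleRoot i)) p = 0 := by
  refine hI.map_eq_zero_of_homog (ev (k := k) fun i => F χ I i ⊗ₜ[k] K χ I (-simpleRoot i)).toLinearMap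
    (fun a p hp hpa => ?_) hp
  have := evalF_eq_zero χ I hp
  rw [evalF] at this
  rw [AlgHom.toLinearMap_apply, ev_tmul_K_of_mem_homog χ I _ hpa, this, TensorProduct.zero_tmul]

theorem isDouble_tensor (hχ : ∀ i j, χ.q i j = χ.q j i) : IsDouble χ
    ((fun i => E χ I i ⊗ₜ[k] (1 : U χ I)) + fun i => K χ I (simpleRoot i) ⊗ₜ[k] E χ I i)
    ((fun i => (1 : U χ I) ⊗ₜ[k] F χ I i) + fun i => F χ I i ⊗ₜ[k] K χ I (-simpleRoot i))
    (fun a => K χ I a ⊗ₜ[k] K χ I a) where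
  K_zero := by rw [(isDouble_U χ I).K_zero, Algebra.TensorProduct.one_def]
  K_add a b := by rw [(isDouble_U χ I).K_add, Algebra.TensorProduct.tmul_mul_tmul]
  K_E a i := by
    have D := isDouble_U χ I
    simp only [Pi.add_apply, mul_add, add_mul, Algebra.TensorProduct.tmul_mul_tmul, D.K_E,
      mul_one, one_mul, smul_add, ← TensorProduct.smul_tmul', TensorProduct.tmul_smul,
      D.K_comm a (simpleRoot i)]
  K_F a i := by
    have D := isDouble_U χ I
    simp only [Pi.add_apply, mul_add, add_mul, Algebra.TensorProduct.tmul_mul_tmul, D.K_F,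
      mul_one, one_mul, smul_add, ← TensorProduct.smul_tmul', TensorProduct.tmul_smul,
      D.K_comm a (-simpleRoot i)]
  E_F i j := by
    have D := isDouble_U χ I
    -- Reordering the legs costs q_{ij}⁻¹ on the left and q_{ji}⁻¹ on the right, which agree by
    -- symmetry.
    have h1 : (K χ I (simpleRoot i) * F χ I j) ⊗ₜ[k] (E χ I i * K χ I (-simpleRoot j)) =
        (F χ I j * K χ I (simpleRoot i)) ⊗ₜ[k] (K χ I (-simpleRoot j) * E χ I i) := by
      rw [D.K_F, D.K_E, TensorProduct.tmul_smul, ← TensorProduct.smul_tmul', χ.neg_left]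
      congr 2
      have := hχ i j
      simp only [Bicharacter.q] at this
      rw [this]
    simp only [Pi.add_apply, mul_add, add_mul, Algebra.TensorProduct.tmul_mul_tmul, mul_one,
      one_mul, h1, D.E_mul_F]
    split_ifs with h
    · subst h
      simp only [TensorProduct.add_tmul, TensorProduct.tmul_add, TensorProduct.sub_tmul,
        TensorProduct.tmul_sub]
      abel
    · simp only [add_zero]
      abel

variable (hI : IsPreNicholsIdeal χ I) (hχ : ∀ i j, χ.q i j = χ.q j i)

/-- The coproduct of `U(χ)`. -/
noncomputable def comul : U χ I →ₐ[k] U χ I ⊗[k] U χ I :=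
  (isDouble_tensor hχ).lift
    -- The summands of Δ(E_i), and below those of Δ(F_i), q-commute in the order required by the
    -- braided binomial formula.
    (fun p hp => hI.ev_add_eq_zero _ _ (fun i j => by
        have D := isDouble_U χ I
        simp only [Algebra.TensorProduct.tmul_mul_tmul, one_mul, mul_one, D.K_E,
          ← TensorProduct.smul_tmul']
        rfl)
      (fun p hp => by rw [ev_E_tmul_one, evalE_eq_zero χ I hp, TensorProduct.zero_tmul])
      (fun p hp => ev_K_tmul_E_eq_zero hI hp) hp)
    (fun p hp => hI.ev_add_eq_zero _ _ (fun i j => by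
        have D := isDouble_U χ I
        simp only [Algebra.TensorProduct.tmul_mul_tmul, one_mul, mul_one, D.K_F,
          TensorProduct.tmul_smul, χ.neg_left, inv_inv]
        rfl)
      (fun p hp => by rw [ev_one_tmul_F, evalF_eq_zero χ I hp, TensorProduct.tmul_zero])
      (fun p hp => ev_F_tmul_K_eq_zero hI hp) hp)

theorem comul_E (i : Fin n) : comul hI hχ (E χ I i) =
    E χ I i ⊗ₜ 1 + K χ I (simpleRoot i) ⊗ₜ E χ I i := by simp [comul]

theorem comul_F (i : Fin n) : comul hI hχ (F χ I i) =
    1 ⊗ₜ F χ I i + F χ I i ⊗ₜ K χ I (-simpleRoot i) := by simp [comul]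

theorem comul_K (a : Fin n → ℤ) : comul hI hχ (K χ I a) = K χ I a ⊗ₜ K χ I a := by simp [comul]

/-! ### Coefficients of the group elements -/

/-- The counit of `T/I`. -/
noncomputable def counitQ : QuotSpace I →ₗ[k] k :=
  (idealSubmodule I).liftQ counit fun _ hq => hI.counit_eq_zero hq

theorem counitQ_qmk (J : List (Fin n)) :
    counitQ hI (qmk I (monomial k J)) = if J = [] then 1 else 0 :=
  monoLift_monomial (k := k) (fun J => if J = [] then (1 : k) else 0) J

/-- The coefficient of `K_b` with respect to the triangular decomposition. -/
noncomputable def coeffK (b : Fin n → ℤ) : U χ I →ₗ[k] k :=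
  (TensorProduct.lid k k).toLinearMap ∘ₗ
    TensorProduct.map (counitQ hI) (counitQ hI ∘ₗ Finsupp.lapply b) ∘ₗ toTri hI hχ

theorem coeffK_nf (b : Fin n → ℤ) (J : List (Fin n)) (a : Fin n → ℤ) (L : List (Fin n)) :
    coeffK hI hχ b (nf χ I J a L) = if J = [] ∧ a = b ∧ L = [] then 1 else 0 := by
  classical
  simp only [coeffK, LinearMap.comp_apply, nf, toTri_apply, TensorProduct.map_tmul, counitQ_qmk,
    Finsupp.lapply_apply, Finsupp.single_apply, LinearEquiv.coe_coe, TensorProduct.lid_tmul]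
  by_cases h1 : J = []
  · by_cases h2 : a = b
    · simp [h1, h2, counitQ_qmk]
    · simp [h2]
  · simp [h1]

theorem coeffK_K (a b : Fin n → ℤ) : coeffK hI hχ b (K χ I a) = if a = b then 1 else 0 := by
  rw [← nf_nil_nil, coeffK_nf]; simp

theorem coeffK_E_mul (b : Fin n → ℤ) (i : Fin n) (x : U χ I) :
    coeffK hI hχ b (E χ I i * x) = 0 := by
  have : coeffK hI hχ b ∘ₗ LinearMap.mulLeft k (E χ I i) = 0 := linearMap_ext_nf fun J a L => by
    simp [E_mul_nf, coeffK_nf]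
  exact LinearMap.congr_fun this x

theorem nf_mul_F (J : List (Fin n)) (a : Fin n → ℤ) (L : List (Fin n)) (i : Fin n) :
    nf χ I J a L * F χ I i = nf χ I J a (L ++ [i]) := by
  have : evalF χ I (ι k i) = F χ I i := by simp [evalF]
  simp [nf, mul_assoc, this]

theorem nf_mul_K (J : List (Fin n)) (a : Fin n → ℤ) (L : List (Fin n)) (b : Fin n → ℤ) :
    nf χ I J a L * K χ I b = (χ.toFun b (deg L) : k) • nf χ I J (a + b) L := by
  have D := isDouble_U χ I
  have h := K_mul_evalF χ I b (monomial k L)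
  rw [act_monomial, map_smul, smul_mul_assoc, χ.neg_left] at h
  have h' : evalF χ I (monomial k L) * K χ I b =
      (χ.toFun b (deg L) : k) • (K χ I b * evalF χ I (monomial k L)) := by
    rw [h, smul_smul]; simp
  rw [nf, nf, mul_assoc, h', mul_smul_comm, D.K_add]
  simp only [mul_assoc]

theorem coeffK_mul_F (b : Fin n → ℤ) (i : Fin n) (x : U χ I) :
    coeffK hI hχ b (x * F χ I i) = 0 := by
  have : coeffK hI hχ b ∘ₗ LinearMap.mulRight k (F χ I i) = 0 := linearMap_ext_nf fun J a L => by
    simp [nf_mul_F, coeffK_nf]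
  exact LinearMap.congr_fun this x

theorem coeffK_K_mul (b a : Fin n → ℤ) (x : U χ I) :
    coeffK hI hχ b (K χ I a * x) = coeffK hI hχ (b - a) x := by
  have : coeffK hI hχ b ∘ₗ LinearMap.mulLeft k (K χ I a) = coeffK hI hχ (b - a) :=
    linearMap_ext_nf fun J d L => by
      simp only [LinearMap.comp_apply, LinearMap.mulLeft_apply, K_mul_nf, map_smul, coeffK_nf]
      by_cases h : J = [] ∧ d = b - a ∧ L = []
      · rw [if_pos h, if_pos ⟨h.1, by rw [h.2.1]; abel, h.2.2⟩, h.1]; simp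
      · rw [if_neg h, if_neg fun h' => h ⟨h'.1, by rw [← h'.2.1]; abel, h'.2.2⟩]; simp
  exact LinearMap.congr_fun this x

theorem coeffK_mul_K (b a : Fin n → ℤ) (x : U χ I) :
    coeffK hI hχ b (x * K χ I a) = coeffK hI hχ (b - a) x := by
  have : coeffK hI hχ b ∘ₗ LinearMap.mulRight k (K χ I a) = coeffK hI hχ (b - a) :=
    linearMap_ext_nf fun J d L => by
      simp only [LinearMap.comp_apply, LinearMap.mulRight_apply, nf_mul_K, map_smul, coeffK_nf]
      by_cases h : J = [] ∧ d = b - a ∧ L = []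
      · rw [if_pos h, if_pos ⟨h.1, by rw [h.2.1]; abel, h.2.2⟩, h.2.2]; simp
      · rw [if_neg h, if_neg fun h' => h ⟨h'.1, by rw [← h'.2.1]; abel, h'.2.2⟩]; simp
  exact LinearMap.congr_fun this x

/-- The map `id ⊗ coeffK b`. -/
noncomputable def contractR (b : Fin n → ℤ) : U χ I ⊗[k] U χ I →ₗ[k] U χ I :=
  (TensorProduct.rid k (U χ I)).toLinearMap ∘ₗ TensorProduct.map LinearMap.id (coeffK hI hχ b)

/-- The map `coeffK b ⊗ id`. -/
noncomputable def contractL (b : Fin n → ℤ) : U χ I ⊗[k] U χ I →ₗ[k] U χ I :=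
  (TensorProduct.lid k (U χ I)).toLinearMap ∘ₗ TensorProduct.map (coeffK hI hχ b) LinearMap.id

@[simp] theorem contractR_tmul (b : Fin n → ℤ) (x y : U χ I) :
    contractR hI hχ b (x ⊗ₜ y) = coeffK hI hχ b y • x := by simp [contractR]

@[simp] theorem contractL_tmul (b : Fin n → ℤ) (x y : U χ I) :
    contractL hI hχ b (x ⊗ₜ y) = coeffK hI hχ b x • y := by simp [contractL]

/-- The functional `coeffK` vanishes on E_i U and on U F_i. Hence one summand of Δ(E_i) survives if
multiplied from the left, and one of Δ(F_i) if multiplied from the right, which dictates the order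
in which letters are removed below. -/
theorem contractR_comul_E_mul (b : Fin n → ℤ) (i : Fin n) (z : U χ I ⊗[k] U χ I) :
    contractR hI hχ b (comul hI hχ (E χ I i) * z) = E χ I i * contractR hI hχ b z := by
  have : contractR hI hχ b ∘ₗ LinearMap.mulLeft k (comul hI hχ (E χ I i)) =
      LinearMap.mulLeft k (E χ I i) ∘ₗ contractR hI hχ b := TensorProduct.ext' fun x y => by
    simp [comul_E, add_mul, coeffK_E_mul]
  exact LinearMap.congr_fun this z

theorem contractR_mul_comul_F (b : Fin n → ℤ) (i : Fin n) (z : U χ I ⊗[k] U χ I) :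
    contractR hI hχ b (z * comul hI hχ (F χ I i)) =
      contractR hI hχ (b + simpleRoot i) z * F χ I i := by
  have : contractR hI hχ b ∘ₗ LinearMap.mulRight k (comul hI hχ (F χ I i)) =
      LinearMap.mulRight k (F χ I i) ∘ₗ contractR hI hχ (b + simpleRoot i) :=
    TensorProduct.ext' fun x y => by
      simp [comul_F, mul_add, coeffK_mul_F, coeffK_mul_K]
  exact LinearMap.congr_fun this z

theorem contractL_comul_E_mul (b : Fin n → ℤ) (i : Fin n) (z : U χ I ⊗[k] U χ I) :
    contractL hI hχ b (comul hI hχ (E χ I i) * z) =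
      E χ I i * contractL hI hχ (b - simpleRoot i) z := by
  have : contractL hI hχ b ∘ₗ LinearMap.mulLeft k (comul hI hχ (E χ I i)) =
      LinearMap.mulLeft k (E χ I i) ∘ₗ contractL hI hχ (b - simpleRoot i) :=
    TensorProduct.ext' fun x y => by
      simp [comul_E, add_mul, coeffK_E_mul, coeffK_K_mul]
  exact LinearMap.congr_fun this z

theorem contractL_mul_comul_F (b : Fin n → ℤ) (i : Fin n) (z : U χ I ⊗[k] U χ I) :
    contractL hI hχ b (z * comul hI hχ (F χ I i)) = contractL hI hχ b z * F χ I i := by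
  have : contractL hI hχ b ∘ₗ LinearMap.mulRight k (comul hI hχ (F χ I i)) =
      LinearMap.mulRight k (F χ I i) ∘ₗ contractL hI hχ b := TensorProduct.ext' fun x y => by
    simp [comul_F, mul_add, coeffK_mul_F]
  exact LinearMap.congr_fun this z

theorem deg_append (J L : List (Fin n)) : deg (J ++ L) = deg J + deg L := by
  induction J with
  | nil => simp
  | cons i J ih => simp [ih, add_assoc]

/-- `(id ⊗ coeffK b) ∘ Δ` is the projection `P_b`. -/
theorem contractR_comul (b : Fin n → ℤ) (x : U χ I) :
    contractR hI hχ b (comul hI hχ x) = P χ I b x := by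
  have : contractR hI hχ b ∘ₗ (comul hI hχ).toLinearMap = P χ I b :=
    linearMap_ext_nf fun J a L => by
      rw [LinearMap.comp_apply, AlgHom.toLinearMap_apply, P_nf hI hχ]
      induction J with
      | nil =>
        -- The F's are removed from the right end; each one shifts the index b by α_i, because of
        -- the leg K_i⁻¹ in Δ(F_i).
        induction L using List.reverseRecOn generalizing b with
        | nil =>
          rw [nf_nil_nil, comul_K, contractR_tmul, coeffK_K]
          simp
        | append_singleton L i ih =>
          rw [← nf_mul_F, map_mul, contractR_mul_comul_F, ih, deg_append, deg_cons, deg_nil,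
            add_zero]
          by_cases h : a - deg L = b + simpleRoot i
          · rw [if_pos h, if_pos (by rw [← sub_sub, h]; abel)]
          · rw [if_neg h, if_neg (fun h' => h (by rw [← h']; abel)), zero_mul]
      | cons i J ih =>
        rw [← E_mul_nf, map_mul, contractR_comul_E_mul, ih]
        split_ifs <;> simp
  exact LinearMap.congr_fun this x

/-- On the left leg it is E that leaves a group element behind, so the contraction selects by deg J
+ a, in contrast to a − deg L for the right leg. -/
theorem contractL_comul_nf (b : Fin n → ℤ) (J : List (Fin n)) (a : Fin n → ℤ) (L : List (Fin n)) :
    contractL hI hχ b (comul hI hχ (nf χ I J a L)) =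
      if deg J + a = b then nf χ I J a L else 0 := by
  induction J generalizing b with
  | nil =>
    induction L using List.reverseRecOn with
    | nil =>
      rw [nf_nil_nil, comul_K, contractL_tmul, coeffK_K]
      simp
    | append_singleton L i ih =>
      rw [← nf_mul_F, map_mul, contractL_mul_comul_F, ih]
      split_ifs <;> simp
  | cons i J ih =>
    rw [← E_mul_nf, map_mul, contractL_comul_E_mul, ih, deg_cons]
    by_cases h : deg J + a = b - simpleRoot i
    · rw [if_pos h, if_pos (by rw [add_assoc, h]; abel)]
    · rw [if_neg h, if_neg (fun h' => h (by rw [← h']; abel)), mul_zero]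

/-! ### The coproduct on `B_c` -/

variable {τ : Equiv.Perm (Fin n)} {c : Fin n → k}

section Tens

variable {A : Type*} [Ring A] [Algebra k A]

/-- The span of the tensors `x ⊗ y` with `x ∈ S` and `y ∈ S'`. -/
abbrev tens (S S' : Submodule k A) : Submodule k (A ⊗[k] A) :=
  Submodule.map₂ (TensorProduct.mk k A A) S S'

theorem tmul_mem_tens {S S' : Submodule k A} {x y : A} (hx : x ∈ S) (hy : y ∈ S') :
    x ⊗ₜ[k] y ∈ tens S S' := Submodule.apply_mem_map₂ _ hx hy

theorem mul_mem_tens {S S' R R' Q Q' : Submodule k A} (h : S * R ≤ Q) (h' : S' * R' ≤ Q')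
    {x y : A ⊗[k] A} (hx : x ∈ tens S S') (hy : y ∈ tens R R') : x * y ∈ tens Q Q' := by
  have h1 : tens S S' ≤ (tens Q Q').comap (LinearMap.mulRight k y) := by
    refine Submodule.map₂_le.2 fun a ha b hb => ?_
    have h2 : tens R R' ≤ (tens Q Q').comap (LinearMap.mulLeft k (a ⊗ₜ[k] b)) := by
      refine Submodule.map₂_le.2 fun a' ha' b' hb' => ?_
      rw [Submodule.mem_comap, LinearMap.mulLeft_apply, TensorProduct.mk_apply,
        Algebra.TensorProduct.tmul_mul_tmul]
      exact tmul_mem_tens (h (Submodule.mul_mem_mul ha ha')) (h' (Submodule.mul_mem_mul hb hb'))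
    exact h2 hy
  exact h1 hx

theorem mul_sub_mul_eq (x y z w : A) : x * y - z * w = x * (y - w) + (x - z) * w := by
  noncomm_ring

end Tens

/-- The left legs 1, B_i and K_{τ(i)}K_i⁻¹ belong to B_c, and only B_i ⊗ K_i⁻¹ has a left leg of
filtration degree 1. -/
theorem comul_B (i : Fin n) : comul hI hχ (B χ I τ c i) =
    1 ⊗ₜ F χ I i + (B χ I τ c i ⊗ₜ K χ I (-simpleRoot i) +
      c i • (K χ I (simpleRoot (τ i) - simpleRoot i) ⊗ₜ
        (E χ I (τ i) * K χ I (-simpleRoot i)))) := by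
  have D := isDouble_U χ I
  rw [B, map_add, map_smul, map_mul, comul_E, comul_F, comul_K, add_mul,
    Algebra.TensorProduct.tmul_mul_tmul, Algebra.TensorProduct.tmul_mul_tmul, one_mul,
    ← D.K_add, ← sub_eq_add_neg, TensorProduct.add_tmul, ← TensorProduct.smul_tmul', smul_add]
  abel

theorem filt_mul_le (l m : ℤ) : filt χ I τ c l * filt χ I τ c m ≤ filt χ I τ c (l + m) :=
  Submodule.mul_le.2 fun _ hx _ hy => mul_mem_filt hx hy

/-- Choosing in any factor a summand of Δ(B_i) other than B_i ⊗ K_i⁻¹ loses one B in the left leg.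
-/
theorem comul_evalB_monomial (hτ : ∀ i, τ (τ i) = i) (J : List (Fin n)) :
    comul hI hχ (evalB χ I τ c (monomial k J)) -
      evalB χ I τ c (monomial k J) ⊗ₜ K χ I (-deg J) ∈
        tens (filt χ I τ c ((J.length : ℤ) - 1)) ⊤ := by
  have D := isDouble_U χ I
  induction J with
  | nil => simp [D.K_zero, Algebra.TensorProduct.one_def]
  | cons i J ih =>
    have h1 : comul hI hχ (B χ I τ c i) - B χ I τ c i ⊗ₜ K χ I (-simpleRoot i) ∈
        tens (filt χ I τ c 0) ⊤ := by
      rw [comul_B]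
      have hK : K χ I (simpleRoot (τ i) - simpleRoot i) ∈ filt χ I τ c 0 := by
        refine K_mem_filt hτ ?_
        have := root_sub_mem τ (τ i)
        rwa [hτ] at this
      have h1 : (1 : U χ I) ∈ filt χ I τ c 0 := by
        simpa using word_mem_filt (χ := χ) (I := I) (τ := τ) (c := c) (w := []) (m := 0) le_rfl
      have := add_mem (tmul_mem_tens h1 (Submodule.mem_top (x := F χ I i)))
        (Submodule.smul_mem _ (c i) (tmul_mem_tens hK
          (Submodule.mem_top (x := E χ I (τ i) * K χ I (-simpleRoot i)))))
      convert this using 1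
      abel
    have h2 : comul hI hχ (B χ I τ c i) ∈ tens (filt χ I τ c 1) ⊤ := by
      have := add_mem (Submodule.map₂_le_map₂_left (filt_mono (by norm_num)) h1)
        (tmul_mem_tens (B_mem_filt χ I τ c i) (Submodule.mem_top (x := K χ I (-simpleRoot i))))
      simpa using this
    have h3 := mul_mem_tens (filt_mul_le _ _) le_top h2 ih
    have h4 := mul_mem_tens (filt_mul_le _ _) le_top h1
      (tmul_mem_tens (evalB_monomial_mem_filt (χ := χ) (I := I) (τ := τ) (c := c) J)
        (Submodule.mem_top (x := K χ I (-deg J))))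
    have e1 : ((i :: J).length : ℤ) - 1 = 1 + ((J.length : ℤ) - 1) := by
      push_cast [List.length_cons]; ring
    have e2 : 1 + ((J.length : ℤ) - 1) = 0 + (J.length : ℤ) := by ring
    rw [e1]
    rw [← e2] at h4
    convert add_mem h3 h4 using 1
    rw [monomial_cons, evalB_x_mul, map_mul, deg_cons, neg_add, D.K_add,
      ← Algebra.TensorProduct.tmul_mul_tmul]
    exact mul_sub_mul_eq _ _ _ _

include hI hχ in
/-- For `p` of degree `a`, the element `p(B)` agrees with `P_{-a}(p(B))` up to lower terms. -/
theorem evalB_sub_P_mem (hτ : ∀ i, τ (τ i) = i) {a : Fin n → ℕ} {p : T k n}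
    (hp : p ∈ homog k a) : P χ I (-toInt a) (evalB χ I τ c p) - evalB χ I τ c p ∈
      filt χ I τ c (((∑ i, a i : ℕ) : ℤ) - 1) := by
  rw [homog_eq_span] at hp
  refine (Submodule.span_le (p := (filt χ I τ c (((∑ i, a i : ℕ) : ℤ) - 1)).comap
    ((P χ I (-toInt a) - LinearMap.id) ∘ₗ (evalB χ I τ c).toLinearMap))).2 ?_ hp
  rintro _ ⟨J, hJ, rfl⟩
  have hlen : (J.length : ℤ) = ((∑ i, a i : ℕ) : ℤ) := by
    rw [← ht_deg, hJ]; simp [ht, toInt]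
  have h := comul_evalB_monomial hI hχ (c := c) hτ J
  rw [hlen] at h
  -- The coefficient of K_{-a} in the right leg turns the coproduct into P_{-a}, the leading term
  -- into p(B), and keeps the left legs of the remainder.
  have h2 := Submodule.mem_map_of_mem (f := contractR hI hχ (-toInt a)) h
  rw [map_sub, contractR_comul, contractR_tmul, hJ, coeffK_K, if_pos rfl, one_smul] at h2
  have h3 : Submodule.map (contractR hI hχ (-toInt a))
      (tens (filt χ I τ c (((∑ i, a i : ℕ) : ℤ) - 1)) ⊤) ≤
      filt χ I τ c (((∑ i, a i : ℕ) : ℤ) - 1) := by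
    rw [Submodule.map_le_iff_le_comap]
    refine Submodule.map₂_le.2 fun x hx y _ => ?_
    rw [Submodule.mem_comap, TensorProduct.mk_apply, contractR_tmul]
    exact Submodule.smul_mem _ _ hx
  exact h3 h2

end Coproduct

/-! ### The braided binomial formula modulo lower filtration terms. -/

section FilteredBinomial

open FreeAlgebra (ι)

variable {k : Type*} [Field k] {n : ℕ}

/-- A multiplicative increasing family of subspaces of an algebra. -/
structure IsAlgFiltration {R : Type*} [Ring R] [Algebra k R] (Γ : ℤ → Submodule k R) : Prop where
  mono : ∀ {r s}, r ≤ s → Γ r ≤ Γ s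
  mul_mem : ∀ {r s x y}, x ∈ Γ r → y ∈ Γ s → x * y ∈ Γ (r + s)
  one_mem : (1 : R) ∈ Γ 0

variable {R : Type*} [Ring R] [Algebra k R] {Γ : ℤ → Submodule k R}

theorem IsAlgFiltration.mul_mem' (hΓ : IsAlgFiltration Γ) {r s t : ℤ} (h : r + s ≤ t) {x y : R}
    (hx : x ∈ Γ r) (hy : y ∈ Γ s) : x * y ∈ Γ t := hΓ.mono h (hΓ.mul_mem hx hy)

theorem IsAlgFiltration.ev_monomial_mem (hΓ : IsAlgFiltration Γ) {x : Fin n → R}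
    (hx : ∀ i, x i ∈ Γ 1) (J : List (Fin n)) : ev x (monomial k J) ∈ Γ J.length := by
  induction J with
  | nil => simpa using hΓ.one_mem
  | cons i J ih =>
    rw [monomial_cons, map_mul, FreeAlgebra.lift_ι_apply]
    exact hΓ.mul_mem' (by push_cast [List.length_cons]; omega) (hx i) ih

theorem IsAlgFiltration.ev_mem (hΓ : IsAlgFiltration Γ) {x : Fin n → R}
    (hx : ∀ i, x i ∈ Γ 1) {m : ℕ} {p : T k n} (hp : p ∈ homogTotal k n m) : ev x p ∈ Γ m := by
  refine (Submodule.span_le (p := (Γ m).comap (ev x).toLinearMap)).2 ?_ hp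
  rintro _ ⟨J, rfl, rfl⟩
  exact hΓ.ev_monomial_mem hx J

/-- Each interchange of y_i with some x_j has an error in Γ 1 where Γ 2 would be expected, so the
total error gains one filtration step. -/
theorem IsAlgFiltration.mul_ev_sub_mem (hΓ : IsAlgFiltration Γ) {χ : Bicharacter k n}
    {x y : Fin n → R} (hx : ∀ i, x i ∈ Γ 1)
    (hxy : ∀ i j, y i * x j - (χ.q i j : k) • (x j * y i) ∈ Γ 1) (i : Fin n) (J : List (Fin n)) :
    y i * ev x (monomial k J) - ev x (actK χ i (monomial k J)) * y i ∈ Γ J.length := by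
  induction J with
  | nil => simp
  | cons j J ih =>
    have h1 := hΓ.mul_mem' (t := (j :: J).length) (by push_cast [List.length_cons]; omega)
      (hxy i j) (hΓ.ev_monomial_mem hx J)
    have h2 := (Γ (j :: J).length).smul_mem (χ.q i j : k)
      (hΓ.mul_mem' (t := (j :: J).length) (by push_cast [List.length_cons]; omega) (hx j) ih)
    convert add_mem h1 h2 using 1
    rw [monomial_cons, map_mul, map_mul, map_mul]
    simp only [actK, FreeAlgebra.lift_ι_apply, map_smul, sub_mul, mul_sub, smul_sub, mul_assoc,
      smul_mul_assoc]
    abel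

/-- The braided binomial formula up to lower terms. -/
theorem IsAlgFiltration.ev_add_sub_mem (hΓ : IsAlgFiltration Γ) {χ : Bicharacter k n}
    {x y : Fin n → R} (hx : ∀ i, x i ∈ Γ 1) (hy : ∀ i, y i ∈ Γ 1)
    (hxy : ∀ i j, y i * x j - (χ.q i j : k) • (x j * y i) ∈ Γ 1) {m : ℕ} {p : T k n}
    (hp : p ∈ homogTotal k n m) :
    ev (x + y) p - LinearMap.mul' k R (TensorProduct.map (ev x).toLinearMap (ev y).toLinearMap
      (braidedCoproduct χ p)) ∈ Γ ((m : ℤ) - 1) := by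
  set M : T k n ⊗[k] T k n →ₗ[k] R :=
    LinearMap.mul' k R ∘ₗ TensorProduct.map (ev x).toLinearMap (ev y).toLinearMap with hM
  refine (Submodule.span_le (p := (Γ ((m : ℤ) - 1)).comap
    ((ev (x + y) : T k n →ₐ[k] R).toLinearMap - M ∘ₗ braidedCoproduct χ))).2 ?_ hp
  rintro _ ⟨J, rfl, rfl⟩
  change (ev (x + y) : T k n →ₐ[k] R) (monomial k J) - M (braidedCoproduct χ (monomial k J)) ∈
    Γ ((J.length : ℤ) - 1)
  clear hp
  induction J with
  | nil =>
    have : M (braidedCoproduct χ (monomial k [])) = 1 := by simp [hM, braidedCoproduct]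
    rw [this]; simp
  | cons i J ih =>
    have h1 := hΓ.mul_mem' (t := ((i :: J).length : ℤ) - 1)
      (by push_cast [List.length_cons]; omega) (add_mem (hx i) (hy i)) ih
    -- This is the error made when the additional factor x_i + y_i is carried into the two legs of
    -- the coproduct.
    have h2 := map_coproduct_mem_of_homogTotal χ (Γ (((i :: J).length : ℤ) - 1))
      (LinearMap.mulLeft k (x i + y i) ∘ₗ M - M ∘ₗ braidedMul χ i) (m := J.length)
      (fun A B hAB => by
        have := hΓ.mul_mem' (t := ((i :: J).length : ℤ) - 1)
          (by push_cast [List.length_cons]; omega)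
          (hΓ.mul_ev_sub_mem hx hxy i A) (hΓ.ev_monomial_mem hy B)
        convert this using 1
        simp only [hM, LinearMap.sub_apply, LinearMap.comp_apply, braidedMul_tmul, map_add,
          TensorProduct.map_tmul, LinearMap.mul'_apply, LinearMap.mulLeft_apply,
          AlgHom.toLinearMap_apply, map_mul, FreeAlgebra.lift_ι_apply]
        noncomm_ring) (monomial_mem_homogTotal J)
    convert add_mem h1 h2 using 1
    rw [monomial_cons, map_mul, braidedCoproduct_x_mul]
    simp only [FreeAlgebra.lift_ι_apply, Pi.add_apply, LinearMap.sub_apply, LinearMap.comp_apply,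
      LinearMap.mulLeft_apply, mul_sub]
    abel

theorem IsPreNicholsIdeal.mul_ev_coproduct_mem {χ : Bicharacter k n} {I : TwoSidedIdeal (T k n)}
    (hI : IsPreNicholsIdeal χ I) (N : Submodule k R) (x y : Fin n → R) {m : ℕ}
    (hl : ∀ r s, r + s = m → ∀ a ∈ I, a ∈ homogTotal k n r → ∀ b ∈ homogTotal k n s,
      ev x a * ev y b ∈ N)
    (hr : ∀ r s, r + s = m → ∀ a ∈ homogTotal k n r, ∀ b ∈ I, b ∈ homogTotal k n s →
      ev x a * ev y b ∈ N) {p : T k n} (hp : p ∈ I) (hpm : p ∈ homogTotal k n m) :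
    LinearMap.mul' k R (TensorProduct.map (ev x).toLinearMap (ev y).toLinearMap
      (braidedCoproduct χ p)) ∈ N :=
  hI.map_coproduct_mem_of_homogTotal N
    (LinearMap.mul' k R ∘ₗ TensorProduct.map (ev x).toLinearMap (ev y).toLinearMap) hl hr hp hpm

/-- The tensor product of two filtrations. -/
def tensFiltration (V W : ℤ → Submodule k R) (r : ℤ) : Submodule k (R ⊗[k] R) :=
  ⨆ j, tens (V j) (W (r - j))

theorem tmul_mem_tensFiltration {V W : ℤ → Submodule k R} {i j r : ℤ} (h : i + j = r) {x y : R}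
    (hx : x ∈ V i) (hy : y ∈ W j) : x ⊗ₜ[k] y ∈ tensFiltration V W r := by
  refine Submodule.mem_iSup_of_mem i (tmul_mem_tens hx ?_)
  rwa [← h, add_sub_cancel_left]

theorem tensFiltration_le {V W : ℤ → Submodule k R} {r : ℤ} {N : Submodule k (R ⊗[k] R)}
    (h : ∀ i j, i + j = r → ∀ x ∈ V i, ∀ y ∈ W j, x ⊗ₜ[k] y ∈ N) : tensFiltration V W r ≤ N :=
  iSup_le fun i => Submodule.map₂_le.2 fun x hx y hy => h i (r - i) (by ring) x hx y hy

theorem IsAlgFiltration.tensor {V W : ℤ → Submodule k R} (hV : IsAlgFiltration V)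
    (hW : IsAlgFiltration W) : IsAlgFiltration (tensFiltration V W) where
  mono h := tensFiltration_le fun i j hij x hx y hy =>
    tmul_mem_tensFiltration (i := i) (add_sub_cancel _ _) hx (hW.mono (by omega) hy)
  mul_mem {r s x y} hx hy := by
    have h1 : tensFiltration V W r ≤
        (tensFiltration V W (r + s)).comap (LinearMap.mulRight k y) := by
      refine tensFiltration_le fun i j hij a ha b hb => ?_
      have h2 : tensFiltration V W s ≤
          (tensFiltration V W (r + s)).comap (LinearMap.mulLeft k (a ⊗ₜ[k] b)) := by
        refine tensFiltration_le fun i' j' hij' a' ha' b' hb' => ?_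
        rw [Submodule.mem_comap, LinearMap.mulLeft_apply, Algebra.TensorProduct.tmul_mul_tmul]
        exact tmul_mem_tensFiltration (by omega) (hV.mul_mem ha ha') (hW.mul_mem hb hb')
      exact h2 hy
    exact h1 hx
  one_mem := tmul_mem_tensFiltration (add_zero 0) hV.one_mem hW.one_mem

end FilteredBinomial

/-! ### The summand of Δ(B_i) involving E. -/

section KeyLemma

open FreeAlgebra (ι)

variable {k : Type*} [Field k] {n : ℕ} {χ : Bicharacter k n} {I : TwoSidedIdeal (T k n)}

theorem isAlgFiltration_wt {e f t : ℤ} (h1 : t ≤ e + f) (h2 : -t ≤ e + f) :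
    IsAlgFiltration (wt χ I e f t) where
  mono := wt_mono
  mul_mem := mul_mem_wt h1 h2
  one_mem := one_mem_wt

theorem totalPart_of_mem_homogTotal {m : ℕ} {p : T k n} (hp : p ∈ homogTotal k n m) :
    totalPart m p = p := by
  have := diag_ht_of_mem_homogTotal (fun z => if z = m then (1 : k) else 0) hp
  rw [if_pos rfl, one_smul] at this
  exact this

theorem sum_eq_ht_toInt (a : Fin n → ℕ) : ((∑ i, a i : ℕ) : ℤ) = ht (toInt a) := by
  simp [ht, toInt]

theorem totalPart_of_mem_homog {m : ℕ} {a : Fin n → ℕ} {p : T k n} (hp : p ∈ homog k a) :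
    totalPart m p = if ∑ i, a i = m then p else 0 := by
  rw [totalPart, diag_of_mem_homog _ hp, ← sum_eq_ht_toInt, ite_smul, one_smul, zero_smul]
  simp only [Nat.cast_inj]

theorem IsPreNicholsIdeal.map_mem_of_homog (hI : IsPreNicholsIdeal χ I) {X : Type*}
    [AddCommMonoid X] [Module k X] (N : Submodule k X) (G : T k n →ₗ[k] X) {m : ℕ}
    (h : ∀ a : Fin n → ℕ, ∑ i, a i = m → ∀ p ∈ I, p ∈ homog k a → G p ∈ N) {p : T k n} (hp : p ∈ I)
    (hpm : p ∈ homogTotal k n m) : G p ∈ N := by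
  have : idealSubmodule I ≤ N.comap (G ∘ₗ totalPart m) := by
    refine hI.graded.trans (iSup_le fun a q hq => ?_)
    rw [Submodule.mem_comap, LinearMap.comp_apply, totalPart_of_mem_homog hq.2]
    split_ifs with ha
    · exact h a ha q hq.1 hq.2
    · rw [map_zero]; exact N.zero_mem
  have := this hp
  rwa [Submodule.mem_comap, LinearMap.comp_apply, totalPart_of_mem_homogTotal hpm] at this

variable {τ : Equiv.Perm (Fin n)} {c : Fin n → k}

/-- The scalar in the evaluation of a monomial at the elements `c_i E_{τ(i)} K_i⁻¹`. -/
def twistScalar (χ : Bicharacter k n) (τ : Equiv.Perm (Fin n)) (c : Fin n → k) :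
    List (Fin n) → k
  | [] => 1
  | i :: J => c i * (χ.toFun (-simpleRoot i) (deg (J.map τ)) : k) * twistScalar χ τ c J

theorem deg_perm {J L : List (Fin n)} (h : J.Perm L) : deg J = deg L := by
  ext i; simp [deg, h.count_eq i]

/-- Interchanging adjacent letters i and j replaces q_{j,τ(i)} by q_{i,τ(j)}, which are equal
because q is symmetric and τ-invariant. So the scalar is common to all monomials of one multidegree.
-/
theorem twistScalar_perm (hχ : ∀ i j, χ.q i j = χ.q j i) (hτ : ∀ i, τ (τ i) = i)
    (hτχ : ∀ i j, χ.q (τ i) (τ j) = χ.q i j) {J L : List (Fin n)} (h : J.Perm L) :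
    twistScalar χ τ c J = twistScalar χ τ c L := by
  induction h with
  | nil => rfl
  | cons i h ih => rw [twistScalar, twistScalar, ih, deg_perm (h.map τ)]
  | swap i j J =>
    have hq : χ.q j (τ i) = χ.q i (τ j) := by
      have := hτχ j (τ i)
      rw [hτ] at this
      rw [← this, hχ]
    have e : ∀ i j, χ.toFun (-simpleRoot i) (deg ((j :: J).map τ)) =
        (χ.q i (τ j))⁻¹ * χ.toFun (-simpleRoot i) (deg (J.map τ)) := fun i j => by
      rw [List.map_cons, deg_cons, χ.map_add_right, χ.neg_left]; rfl
    simp only [twistScalar, e, hq, Units.val_mul]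
    ring
  | trans _ _ h1 h2 => exact h1.trans h2

theorem diagramAut_monomial (τ : Equiv.Perm (Fin n)) (J : List (Fin n)) :
    diagramAut τ (monomial k J) = monomial k (J.map τ) := by
  induction J with
  | nil => simp
  | cons i J ih => rw [monomial_cons, map_mul, ih, List.map_cons, monomial_cons]; simp [diagramAut]

variable (χ I) in
/-- The last summand in `Δ(B_i)`. -/
def twistTerm (τ : Equiv.Perm (Fin n)) (c : Fin n → k) (i : Fin n) : U χ I ⊗[k] U χ I :=
  c i • (K χ I (simpleRoot (τ i) - simpleRoot i) ⊗ₜ (E χ I (τ i) * K χ I (-simpleRoot i)))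

theorem ev_twistTerm_monomial (J : List (Fin n)) : ev (twistTerm χ I τ c) (monomial k J) =
    twistScalar χ τ c J • (K χ I (deg (J.map τ) - deg J) ⊗ₜ
      (evalE χ I (monomial k (J.map τ)) * K χ I (-deg J))) := by
  have D := isDouble_U χ I
  induction J with
  | nil => simp [twistScalar, D.K_zero, Algebra.TensorProduct.one_def]
  | cons i J ih =>
    have h : E χ I (τ i) * K χ I (-simpleRoot i) *
        (evalE χ I (monomial k (J.map τ)) * K χ I (-deg J)) =
        (χ.toFun (-simpleRoot i) (deg (J.map τ)) : k) •
          (evalE χ I (monomial k ((i :: J).map τ)) * K χ I (-deg (i :: J))) := by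
      rw [List.map_cons, monomial_cons, evalE_x_mul, deg_cons, neg_add, D.K_add, mul_assoc,
        ← mul_assoc (K χ I (-simpleRoot i)), K_mul_evalE, act_monomial, map_smul]
      simp only [smul_mul_assoc, mul_smul_comm, mul_assoc]
    have h' : K χ I (simpleRoot (τ i) - simpleRoot i) * K χ I (deg (J.map τ) - deg J) =
        K χ I (deg ((i :: J).map τ) - deg (i :: J)) := by
      rw [← D.K_add, List.map_cons, deg_cons, deg_cons]
      congr 1; abel
    rw [monomial_cons, map_mul, ih, FreeAlgebra.lift_ι_apply, twistTerm, smul_mul_smul_comm,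
      Algebra.TensorProduct.tmul_mul_tmul, h, h', TensorProduct.tmul_smul, smul_smul, twistScalar]
    congr 1; ring

/-- On a homogeneous component the evaluation is one fixed scalar times a fixed group element
tensored with (τp)(E) times another group element; τp ∈ I makes it vanish. -/
theorem ev_twistTerm_eq_zero (hI : IsPreNicholsIdeal χ I) (hχ : ∀ i j, χ.q i j = χ.q j i)
    (hτ : ∀ i, τ (τ i) = i) (hτχ : ∀ i j, χ.q (τ i) (τ j) = χ.q i j)
    (hτI : ∀ p, diagramAut τ p ∈ I ↔ p ∈ I) {p : T k n} (hp : p ∈ I) :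
    ev (twistTerm χ I τ c) p = 0 := by
  refine hI.map_eq_zero_of_homog (ev (twistTerm χ I τ c)).toLinearMap (fun a p hp hpa => ?_) hp
  rw [homog_eq_span] at hpa
  by_cases hex : ∃ L : List (Fin n), deg L = toInt a
  · obtain ⟨L, hL⟩ := hex
    have h := LinearMap.eqOn_span
      (f := (ev (twistTerm χ I τ c)).toLinearMap)
      (g := twistScalar χ τ c L • (TensorProduct.mk k (U χ I) (U χ I)
        (K χ I (deg (L.map τ) - deg L)) ∘ₗ LinearMap.mulRight k (K χ I (-deg L)) ∘ₗ
          (evalE χ I).toLinearMap ∘ₗ (diagramAut τ).toLinearMap)) (by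
          rintro _ ⟨J, hJ, rfl⟩
          have hJL : J.Perm L := List.perm_iff_count.2 fun i => by
            have := congrFun (hJ.trans hL.symm) i
            simpa [deg] using this
          simp [ev_twistTerm_monomial, diagramAut_monomial, twistScalar_perm hχ hτ hτχ hJL,
            deg_perm hJL, deg_perm (hJL.map τ)]) hpa
    rw [h]
    simp [evalE_eq_zero χ I ((hτI p).2 hp)]
  · have : {p | ∃ J, deg J = toInt a ∧ p = monomial k J} = (∅ : Set (T k n)) := by
      ext p; simp only [Set.mem_ofPred_eq, Set.mem_empty_iff_false, iff_false]
      rintro ⟨J, hJ, -⟩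
      exact hex ⟨J, hJ⟩
    rw [this, Submodule.span_empty, Submodule.mem_bot] at hpa
    rw [hpa, map_zero]

end KeyLemma

/-! ### Estimating Δ(p(B)) for p in I. -/

section KeyLemma

open FreeAlgebra (ι)

variable {k : Type*} [Field k] {n : ℕ} {χ : Bicharacter k n} {I : TwoSidedIdeal (T k n)}
  {τ : Equiv.Perm (Fin n)} {c : Fin n → k}

variable (χ I) in
/-- The filtration of `U ⊗ U` used to compare `Δ(p(B))` with `p(B) ⊗ K_{-a}`. -/
abbrev doubleFilt (r : ℤ) : Submodule k (U χ I ⊗[k] U χ I) :=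
  tensFiltration (wt χ I 0 1 (-1)) (wt χ I 1 1 0) r

theorem isAlgFiltration_doubleFilt : IsAlgFiltration (k := k) (R := U χ I ⊗[k] U χ I) (doubleFilt χ I) :=
  (isAlgFiltration_wt (by norm_num) (by norm_num)).tensor
    (isAlgFiltration_wt (by norm_num) (by norm_num))

theorem K_mem_wt_zero {e f : ℤ} (a : Fin n → ℤ) : K χ I a ∈ wt χ I e f 0 0 := by
  simpa using K_mem_wt (χ := χ) (I := I) (e := e) (f := f) (t := 0) a

theorem B_mem_wt (i : Fin n) : B χ I τ c i ∈ wt χ I 0 1 (-1) 1 :=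
  filt_le_wt 1 (B_mem_filt χ I τ c i)

theorem one_tmul_F_mem (i : Fin n) : (1 : U χ I) ⊗ₜ[k] F χ I i ∈ doubleFilt χ I 1 :=
  tmul_mem_tensFiltration (zero_add 1) one_mem_wt (F_mem_wt i)

theorem B_tmul_K_mem (i : Fin n) :
    B χ I τ c i ⊗ₜ[k] K χ I (-simpleRoot i) ∈ doubleFilt χ I 1 :=
  tmul_mem_tensFiltration (add_zero 1) (B_mem_wt i) (K_mem_wt_zero _)

theorem root_sub_mem' (hτ : ∀ i, τ (τ i) = i) (i : Fin n) :
    simpleRoot (τ i) - simpleRoot i ∈ thetaLattice τ := by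
  have := root_sub_mem τ (τ i)
  rwa [hτ] at this

theorem K_theta_mem_wt (hτ : ∀ i, τ (τ i) = i) (i : Fin n) :
    K χ I (simpleRoot (τ i) - simpleRoot i) ∈ wt χ I 0 1 (-1) 0 := by
  have := K_mem_wt (χ := χ) (I := I) (e := 0) (f := 1) (t := -1) (simpleRoot (τ i) - simpleRoot i)
  rwa [ht_of_mem_thetaLattice τ (root_sub_mem' hτ i), mul_zero] at this

theorem twistTerm_mem (hτ : ∀ i, τ (τ i) = i) (i : Fin n) :
    twistTerm χ I τ c i ∈ doubleFilt χ I 1 := by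
  refine Submodule.smul_mem _ _ (tmul_mem_tensFiltration (zero_add 1) (K_theta_mem_wt hτ i) ?_)
  exact isAlgFiltration_wt (by norm_num) (by norm_num) |>.mul_mem' (add_zero 1).le (E_mem_wt _)
    (K_mem_wt_zero _)

/-- The left legs contribute q_{ij} q_{j,τ(i)}⁻¹ up to inversion and the right legs cancel the part
that involves τ(i). Unlike the relation with 1 ⊗ F_j, this one holds without an error term. -/
theorem twistTerm_mul_B_tmul_K (hχ : ∀ i j, χ.q i j = χ.q j i) (hτ : ∀ i, τ (τ i) = i)
    (hτχ : ∀ i j, χ.q (τ i) (τ j) = χ.q i j) (i j : Fin n) :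
    twistTerm χ I τ c i * B χ I τ c j ⊗ₜ[k] K χ I (-simpleRoot j) =
      (χ.q i j : k) • (B χ I τ c j ⊗ₜ[k] K χ I (-simpleRoot j) * twistTerm χ I τ c i) := by
  have D := isDouble_U χ I
  have h1 := B_K χ I c hτ hτχ (root_sub_mem' hτ i) j
  have h2 : E χ I (τ i) * K χ I (-simpleRoot i) * K χ I (-simpleRoot j) =
      (χ.q j (τ i) : k) • (K χ I (-simpleRoot j) * (E χ I (τ i) * K χ I (-simpleRoot i))) := by
    rw [mul_assoc, D.K_comm, ← mul_assoc, D.E_K, smul_mul_assoc, χ.neg_left, inv_inv, mul_assoc]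
    rfl
  rw [twistTerm, smul_mul_assoc, mul_smul_comm, Algebra.TensorProduct.tmul_mul_tmul,
    Algebra.TensorProduct.tmul_mul_tmul, h1, h2, TensorProduct.tmul_smul,
    ← TensorProduct.smul_tmul', smul_smul, smul_smul, smul_smul, sub_eq_add_neg,
    χ.map_add_left, χ.neg_left]
  congr 1
  have h3 : χ.toFun (simpleRoot (τ i)) (simpleRoot j) = χ.q j (τ i) := hχ _ _
  have h4 : χ.toFun (simpleRoot i) (simpleRoot j) = χ.q i j := rfl
  rw [h3, h4]
  have h5 : (χ.q j (τ i) : k) ≠ 0 := Units.ne_zero _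
  have h6 : (χ.q i j : k) ≠ 0 := Units.ne_zero _
  push_cast
  field_simp


/-- `q`-commutation of the first two summands of `Δ(B_i)` with `1 ⊗ F_j`, up to lower terms. -/
theorem twist_mul_F_sub_mem (hτ : ∀ i, τ (τ i) = i) (i j : Fin n) :
    (B χ I τ c i ⊗ₜ[k] K χ I (-simpleRoot i) + twistTerm χ I τ c i) * (1 ⊗ₜ[k] F χ I j) -
      (χ.q i j : k) • ((1 ⊗ₜ[k] F χ I j) *
        (B χ I τ c i ⊗ₜ[k] K χ I (-simpleRoot i) + twistTerm χ I τ c i)) ∈ doubleFilt χ I 1 := by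
  have D := isDouble_U χ I
  have hKF : K χ I (-simpleRoot i) * F χ I j =
      (χ.q i j : k) • (F χ I j * K χ I (-simpleRoot i)) := by
    rw [D.K_F, χ.neg_left, inv_inv]; rfl
  have h1 : B χ I τ c i ⊗ₜ[k] K χ I (-simpleRoot i) * (1 ⊗ₜ[k] F χ I j) =
      (χ.q i j : k) • ((1 ⊗ₜ[k] F χ I j) * (B χ I τ c i ⊗ₜ[k] K χ I (-simpleRoot i))) := by
    rw [Algebra.TensorProduct.tmul_mul_tmul, Algebra.TensorProduct.tmul_mul_tmul, one_mul, mul_one,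
      hKF, TensorProduct.tmul_smul]
  have h2 : twistTerm χ I τ c i * (1 ⊗ₜ[k] F χ I j) =
      (χ.q i j : k) • ((1 ⊗ₜ[k] F χ I j) * twistTerm χ I τ c i) +
      ((χ.q i j : k) * c i) • (K χ I (simpleRoot (τ i) - simpleRoot i) ⊗ₜ[k]
        ((if τ i = j then K χ I (simpleRoot (τ i)) - K χ I (-simpleRoot (τ i)) else 0) *
          K χ I (-simpleRoot i))) := by
    rw [twistTerm, smul_mul_assoc, mul_smul_comm, Algebra.TensorProduct.tmul_mul_tmul,
      Algebra.TensorProduct.tmul_mul_tmul, one_mul, mul_one, mul_assoc, hKF, mul_smul_comm,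
      ← mul_assoc, D.E_mul_F, add_mul, TensorProduct.tmul_smul, TensorProduct.tmul_add, mul_smul,
      smul_add, smul_add, smul_comm (c i) (χ.q i j : k), smul_comm (c i) (χ.q i j : k),
      mul_assoc]
  -- The error comes from the commutator of E_{τ(i)} and F_j. It consists of group elements, of
  -- weight 0 in the right leg.
  have h3 : (if τ i = j then K χ I (simpleRoot (τ i)) - K χ I (-simpleRoot (τ i)) else 0) *
      K χ I (-simpleRoot i) ∈ wt χ I 1 1 0 0 := by
    refine mul_mem_wt (r := 0) (s := 0) (by norm_num) (by norm_num) ?_ (K_mem_wt_zero _)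
    split_ifs
    · exact sub_mem (K_mem_wt_zero _) (K_mem_wt_zero _)
    · exact zero_mem _
  have h4 : ((χ.q i j : k) * c i) • (K χ I (simpleRoot (τ i) - simpleRoot i) ⊗ₜ[k]
      ((if τ i = j then K χ I (simpleRoot (τ i)) - K χ I (-simpleRoot (τ i)) else 0) *
        K χ I (-simpleRoot i))) ∈ doubleFilt χ I 1 :=
    isAlgFiltration_doubleFilt.mono zero_le_one
      (Submodule.smul_mem _ _ (tmul_mem_tensFiltration (add_zero 0) (K_theta_mem_wt hτ i) h3))
  have e : ∀ X Y f Z : U χ I ⊗[k] U χ I, ∀ q : k, X * f = q • (f * X) → Y * f = q • (f * Y) + Z →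
      (X + Y) * f - q • (f * (X + Y)) = Z := fun X Y f Z q hX hY => by
    rw [add_mul, mul_add, hX, hY, smul_add]; abel
  rw [e _ _ _ _ _ h1 h2]
  exact h4

/-- The element `B_i ⊗ K_i⁻¹`. -/
abbrev leadTerm (χ : Bicharacter k n) (I : TwoSidedIdeal (T k n)) (τ : Equiv.Perm (Fin n))
    (c : Fin n → k) (i : Fin n) : U χ I ⊗[k] U χ I := B χ I τ c i ⊗ₜ[k] K χ I (-simpleRoot i)

section Relations

variable {m : ℕ}

/-- For homogeneous q the value is q(B) ⊗ K_{-deg q}, whose right leg is in H. This crude bound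
covers the top degree m, where no lifting is available yet. -/
theorem ev_leadTerm_mem_top (hI : IsPreNicholsIdeal χ I) {r : ℕ} {p : T k n} (hp : p ∈ I)
    (hpr : p ∈ homogTotal k n r) : ev (leadTerm χ I τ c) p ∈ tens (⊤ : Submodule k (U χ I))
      (H χ I) := by
  refine hI.map_mem_of_homog (tens (⊤ : Submodule k (U χ I)) (H χ I))
    (ev (leadTerm χ I τ c)).toLinearMap (fun a _ q _ hqa => ?_) hp hpr
  rw [AlgHom.toLinearMap_apply, ev_tmul_K_of_mem_homog χ I _ hqa]
  exact tmul_mem_tens trivial (Submodule.subset_span ⟨_, rfl⟩)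

/-- In degrees below m the relations lift, and the left leg gains one filtration step. -/
theorem ev_leadTerm_mem (hI : IsPreNicholsIdeal χ I)
    (hrel : ∀ r < m, ∀ p ∈ homogTotal k n r, p ∈ I → evalB χ I τ c p ∈ filt χ I τ c ((r : ℤ) - 1))
    {r : ℕ} (hr : r < m) {p : T k n} (hp : p ∈ I) (hpr : p ∈ homogTotal k n r) :
    ev (leadTerm χ I τ c) p ∈ doubleFilt χ I ((r : ℤ) - 1) := by
  refine hI.map_mem_of_homog (doubleFilt χ I ((r : ℤ) - 1))
    (ev (leadTerm χ I τ c)).toLinearMap (fun a ha q hq hqa => ?_) hp hpr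
  rw [AlgHom.toLinearMap_apply, ev_tmul_K_of_mem_homog χ I _ hqa]
  have hqr := homogTotal_of_mem_homog hqa
  rw [ha] at hqr
  exact tmul_mem_tensFiltration (add_zero _) (filt_le_wt _ (hrel r hr q hqr hq)) (K_mem_wt_zero _)

theorem exists_eq_smul_one_of_mem_homogTotal_zero {p : T k n} (hp : p ∈ homogTotal k n 0) :
    ∃ s : k, p = s • 1 := by
  induction hp using Submodule.span_induction with
  | mem x hx =>
    obtain ⟨J, hJ, rfl⟩ := hx
    rw [List.length_eq_zero_iff] at hJ
    exact ⟨1, by simp [hJ]⟩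
  | zero => exact ⟨0, by simp⟩
  | add x y _ _ hx hy =>
    obtain ⟨s, rfl⟩ := hx
    obtain ⟨t, rfl⟩ := hy
    exact ⟨s + t, by rw [add_smul]⟩
  | smul r x _ hx =>
    obtain ⟨s, rfl⟩ := hx
    exact ⟨r * s, by rw [mul_smul]⟩

variable (hI : IsPreNicholsIdeal χ I) (hχ : ∀ i j, χ.q i j = χ.q j i) (hτ : ∀ i, τ (τ i) = i)
  (hτχ : ∀ i j, χ.q (τ i) (τ j) = χ.q i j) (hτI : ∀ p, diagramAut τ p ∈ I ↔ p ∈ I)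
  (hrel : ∀ r < m, ∀ p ∈ homogTotal k n r, p ∈ I → evalB χ I τ c p ∈ filt χ I τ c ((r : ℤ) - 1))
include hI hχ hτ hτχ hτI hrel

/-- In the binomial expansion, elements of I at the twist terms vanish and elements of I at B_i ⊗
K_i⁻¹ gain a step, except in degree m. The space N is left free because U ⊗ H may be added only if s
= m. -/
theorem ev_leadTerm_add_twistTerm_mem {s : ℕ} (N : Submodule k (U χ I ⊗[k] U χ I))
    (hN : doubleFilt χ I ((s : ℤ) - 1) ≤ N)
    (hs : s ≤ m) (hN' : s = m → tens ⊤ (H χ I) ≤ N) {p : T k n} (hp : p ∈ I)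
    (hps : p ∈ homogTotal k n s) :
    ev (leadTerm χ I τ c + twistTerm χ I τ c) p ∈ N := by
  rw [ev_add_eq_coproduct χ _ _ (twistTerm_mul_B_tmul_K hχ hτ hτχ) p]
  refine hI.mul_ev_coproduct_mem N (leadTerm χ I τ c) (twistTerm χ I τ c)
    (fun r t hrt a ha har b hbt => ?_) (fun r t hrt a har b hb hbt => ?_) hp hps
  · rcases Nat.eq_zero_or_pos t with rfl | ht
    · obtain ⟨u, rfl⟩ := exists_eq_smul_one_of_mem_homogTotal_zero hbt
      rw [map_smul, map_one, mul_smul_comm, mul_one]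
      refine N.smul_mem _ ?_
      obtain rfl : r = s := by omega
      rcases hs.lt_or_eq with h | h
      · exact hN (ev_leadTerm_mem hI hrel h ha har)
      · exact hN' h (ev_leadTerm_mem_top hI ha har)
    · exact hN (isAlgFiltration_doubleFilt.mul_mem' (by omega)
        (ev_leadTerm_mem hI hrel (by omega) ha har)
        (isAlgFiltration_doubleFilt.ev_mem (twistTerm_mem hτ) hbt))
  · rw [ev_twistTerm_eq_zero hI hχ hτ hτχ hτI hb, mul_zero]
    exact N.zero_mem

/-- After splitting off 1 ⊗ F_i, terms with I in the first leg vanish. With I in the second leg, a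
positive degree in the first leaves degree less than m; only first degree 0 meets the exceptional
term in U ⊗ H. -/
theorem comul_evalB_mem {p : T k n} (hp : p ∈ I) (hpm : p ∈ homogTotal k n m) :
    comul hI hχ (evalB χ I τ c p) ∈ doubleFilt χ I ((m : ℤ) - 1) ⊔ tens ⊤ (H χ I) := by
  set f : Fin n → U χ I ⊗[k] U χ I := fun i => 1 ⊗ₜ F χ I i with hf
  have hev : comul hI hχ (evalB χ I τ c p) =
      ev (f + (leadTerm χ I τ c + twistTerm χ I τ c)) p := by
    have : (comul hI hχ).comp (evalB χ I τ c) =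
        ev (f + (leadTerm χ I τ c + twistTerm χ I τ c)) := by
      ext i
      simp only [AlgHom.comp_apply, Function.comp_apply, evalB, FreeAlgebra.lift_ι_apply, comul_B]
      rfl
    exact DFunLike.congr_fun this p
  have hΓ := isAlgFiltration_doubleFilt (χ := χ) (I := I)
  have hX : ∀ i, (leadTerm χ I τ c + twistTerm χ I τ c) i ∈ doubleFilt χ I 1 := fun i =>
    add_mem (B_tmul_K_mem i) (twistTerm_mem hτ i)
  have h1 := hΓ.ev_add_sub_mem (χ := χ) (x := f) (y := leadTerm χ I τ c + twistTerm χ I τ c)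
    one_tmul_F_mem hX (twist_mul_F_sub_mem hτ) hpm
  have h2 := hI.mul_ev_coproduct_mem (doubleFilt χ I ((m : ℤ) - 1) ⊔ tens ⊤ (H χ I)) f
    (leadTerm χ I τ c + twistTerm χ I τ c)
    (fun r t hrt a ha har b hbt => ?_) (fun r t hrt a har b hb hbt => ?_) hp hpm
  · rw [hev]
    have := add_mem (Submodule.mem_sup_left (T := tens ⊤ (H χ I)) h1) h2
    rwa [sub_add_cancel] at this
  · rw [ev_one_tmul_F, evalF_eq_zero χ I ha, TensorProduct.tmul_zero, zero_mul]
    exact zero_mem _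
  · rcases Nat.eq_zero_or_pos r with rfl | hr
    · obtain ⟨u, rfl⟩ := exists_eq_smul_one_of_mem_homogTotal_zero har
      rw [map_smul, map_one, smul_mul_assoc, one_mul]
      refine Submodule.smul_mem _ _ ?_
      obtain rfl : t = m := by omega
      exact ev_leadTerm_add_twistTerm_mem hI hχ hτ hτχ hτI hrel _ le_sup_left le_rfl
        (fun _ => le_sup_right) hb hbt
    · refine Submodule.mem_sup_left (hΓ.mul_mem' (r := r) (s := (t : ℤ) - 1) (by omega)
        (hΓ.ev_mem one_tmul_F_mem har) ?_)
      exact ev_leadTerm_add_twistTerm_mem hI hχ hτ hτχ hτI hrel _ le_rfl (by omega)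
        (fun h => by omega) hb hbt

end Relations

end KeyLemma

/-! ### Reduction of P_{-d}(p(B)) to a group element. -/

section GroupLike

open FreeAlgebra (ι)

variable {k : Type*} [Field k] {n : ℕ} {χ : Bicharacter k n} {I : TwoSidedIdeal (T k n)}
  {τ : Equiv.Perm (Fin n)} {c : Fin n → k}

variable (hI : IsPreNicholsIdeal χ I) (hχ : ∀ i j, χ.q i j = χ.q j i)

theorem coeffK_eq_zero_of_mem_wt {b : Fin n → ℤ} {r : ℤ} (h : r < -ht b) {x : U χ I}
    (hx : x ∈ wt χ I 0 1 (-1) r) : coeffK hI hχ b x = 0 := by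
  refine (wt_le_iff (N := LinearMap.ker (coeffK hI hχ b))).2 (fun J a L hJ => ?_) hx
  rw [LinearMap.mem_ker, coeffK_nf, if_neg]
  rintro ⟨-, rfl, -⟩
  omega

include hI hχ in
theorem proj_eq_zero_of_mem_wt {a b : Fin n → ℕ} {r : ℤ}
    (h : r < ht (toInt a) + ht (toInt b)) {x : U χ I} (hx : x ∈ wt χ I 1 1 0 r) :
    proj χ I a b x = 0 := by
  refine (wt_le_iff (N := LinearMap.ker (proj χ I a b))).2 (fun J d L hJ => ?_) hx
  rw [LinearMap.mem_ker, proj_nf hI hχ, if_neg]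
  rintro ⟨h1, h2⟩
  rw [← h1, ← h2, ht_deg, ht_deg] at h
  omega

-- Requiring the identity for every larger finite set as well makes it pass to sums, and allows any
-- chosen index to be included.
include hI hχ in
theorem exists_sum_proj (x : U χ I) : ∃ S : Finset ((Fin n → ℕ) × (Fin n → ℕ)), ∀ S', S ⊆ S' →
    ∑ d ∈ S', proj χ I d.1 d.2 x = x := by
  classical
  have hx : x ∈ wt χ I 0 0 0 0 := by rw [wt_zero]; trivial
  rw [wt] at hx
  induction hx using Submodule.span_induction with
  | mem x hx =>
    obtain ⟨J, a, L, -, rfl⟩ := hx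
    refine ⟨{(fun i => J.count i, fun i => L.count i)}, fun S' hS' => ?_⟩
    rw [Finset.sum_eq_single (fun i => J.count i, fun i => L.count i)]
    · rw [proj_nf hI hχ, if_pos ⟨rfl, rfl⟩]
    · intro d _ hd
      rw [proj_nf hI hχ, if_neg]
      rintro ⟨h1, h2⟩
      exact hd (Prod.ext (toInt_injective h1.symm) (toInt_injective h2.symm))
    · intro h; exact absurd (hS' (Finset.mem_singleton_self _)) h
  | zero => exact ⟨∅, fun S' _ => by simp⟩
  | add x y _ _ hx hy =>
    obtain ⟨S, hS⟩ := hx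
    obtain ⟨S₂, hS₂⟩ := hy
    refine ⟨S ∪ S₂, fun S' h => ?_⟩
    simp only [map_add, Finset.sum_add_distrib]
    rw [hS S' (Finset.union_subset_left h), hS₂ S' (Finset.union_subset_right h)]
  | smul r x _ hx =>
    obtain ⟨S, hS⟩ := hx
    refine ⟨S, fun S' h => ?_⟩
    simp only [map_smul, ← Finset.smul_sum]
    rw [hS S' h]

include hI hχ in
theorem eq_proj_zero_zero {x : U χ I}
    (h : ∀ a b : Fin n → ℕ, (a, b) ≠ (0, 0) → proj χ I a b x = 0) : x = proj χ I 0 0 x := by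
  classical
  obtain ⟨S, hS⟩ := exists_sum_proj hI hχ x
  have hx := hS (insert (0, 0) S) (Finset.subset_insert _ _)
  rw [Finset.sum_eq_single (0, 0) (fun d _ hd => h d.1 d.2 hd)
    (fun h => absurd (Finset.mem_insert_self _ _) h)] at hx
  exact hx.symm

/-- The bidegree (0,0) excludes E's and F's, so the condition in (c) concerns just the coefficient
of K_{-λ} in p(B). -/
theorem proj_zero_zero_P (b : Fin n → ℤ) (x : U χ I) :
    proj χ I 0 0 (P χ I b x) = coeffK hI hχ b x • K χ I b := by
  have : proj χ I 0 0 ∘ₗ P χ I b = (coeffK hI hχ b).smulRight (K χ I b) :=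
    linearMap_ext_nf fun J a L => by
      have h0 : toInt (0 : Fin n → ℕ) = 0 := by ext; simp [toInt]
      rw [LinearMap.comp_apply, LinearMap.smulRight_apply, P_nf hI hχ, coeffK_nf]
      by_cases hJL : J = [] ∧ L = []
      · obtain ⟨rfl, rfl⟩ := hJL
        have hp : proj χ I 0 0 (nf χ I [] a []) = nf χ I [] a [] := by
          rw [proj_nf hI hχ, if_pos (by simp [h0])]
        by_cases ha : a = b
        · subst ha
          simpa [nf_nil_nil] using hp
        · simp [ha]
      · have hp : proj χ I 0 0 (nf χ I J a L) = 0 := by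
          rw [proj_nf hI hχ, h0, if_neg]
          exact fun h => hJL ⟨(deg_eq_zero_iff J).1 h.1, (deg_eq_zero_iff L).1 h.2⟩
        have hc : ¬(J = [] ∧ a = b ∧ L = []) := fun h => hJL ⟨h.1, h.2.2⟩
        rw [if_neg hc, zero_smul]
        split_ifs
        · exact hp
        · exact map_zero _
  exact LinearMap.congr_fun this x

/-- Once the degrees a of the E's and b of the F's are fixed, the right-leg condition e − b = −d and
the left-leg condition a + e = a + b − d select the same group elements K_e. So P_{-d} can be read
off from the left leg of the coproduct. -/
theorem proj_contractL_comul (a b d : Fin n → ℕ) (x : U χ I) :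
    proj χ I a b (contractL hI hχ (toInt a + toInt b - toInt d) (comul hI hχ x)) =
      proj χ I a b (P χ I (-toInt d) x) := by
  have : proj χ I a b ∘ₗ contractL hI hχ (toInt a + toInt b - toInt d) ∘ₗ
      (comul hI hχ).toLinearMap = proj χ I a b ∘ₗ P χ I (-toInt d) :=
    linearMap_ext_nf fun J e L => by
      simp only [LinearMap.comp_apply, AlgHom.toLinearMap_apply, contractL_comul_nf, P_nf hI hχ]
      by_cases h : deg J = toInt a ∧ deg L = toInt b
      · rw [h.1, h.2]
        have : toInt a + e = toInt a + toInt b - toInt d ↔ e - toInt b = -toInt d := by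
          constructor <;> intro h <;> ext i <;> have := congrFun h i <;>
            simp only [Pi.add_apply, Pi.sub_apply, Pi.neg_apply] at this ⊢ <;> omega
        simp only [this]
      · have h0 : proj χ I a b (nf χ I J e L) = 0 := by rw [proj_nf hI hχ, if_neg h]
        split_ifs <;> simp [h0]
  exact LinearMap.congr_fun this x

/-- If all relations of degree less than `m` hold up to lower terms, then `P_{-d}(p(B))` is a
multiple of `K_{-d}` for `p ∈ I` of degree `d` with `|d| = m`. -/
theorem P_evalB_eq_smul_K (hτ : ∀ i, τ (τ i) = i) (hτχ : ∀ i j, χ.q (τ i) (τ j) = χ.q i j)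
    (hτI : ∀ p, diagramAut τ p ∈ I ↔ p ∈ I) {d : Fin n → ℕ}
    (hrel : ∀ r < ∑ i, d i, ∀ p ∈ homogTotal k n r, p ∈ I →
      evalB χ I τ c p ∈ filt χ I τ c ((r : ℤ) - 1)) {p : T k n} (hp : p ∈ I)
    (hpd : p ∈ homog k d) : P χ I (-toInt d) (evalB χ I τ c p) =
      coeffK hI hχ (-toInt d) (evalB χ I τ c p) • K χ I (-toInt d) := by
  rw [← proj_zero_zero_P]
  refine eq_proj_zero_zero hI hχ fun a b hab => ?_
  rw [← proj_contractL_comul hI hχ]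
  have h := comul_evalB_mem hI hχ hτ hτχ hτI hrel hp (homogTotal_of_mem_homog hpd)
  have h1 : doubleFilt χ I (((∑ i, d i : ℕ) : ℤ) - 1) ⊔ tens ⊤ (H χ I) ≤ LinearMap.ker
      (proj χ I a b ∘ₗ contractL hI hχ (toInt a + toInt b - toInt d)) := by
    refine sup_le (tensFiltration_le fun i j hij x hx y hy => ?_)
      (Submodule.map₂_le.2 fun x _ y hy => ?_)
    · rw [LinearMap.mem_ker, LinearMap.comp_apply, contractL_tmul, map_smul]
      rw [sum_eq_ht_toInt] at hij
      -- Here i + j = |d| − 1. Either i < |d| − |a| − |b| and the coefficient in the left leg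
      -- vanishes, or j < |a| + |b| and the projection of the right leg vanishes.
      by_cases hi : i < -ht (toInt a + toInt b - toInt d)
      · rw [coeffK_eq_zero_of_mem_wt hI hχ hi hx, zero_smul]
      · rw [sub_eq_add_neg, ht_add, ht_add, ht_neg] at hi
        rw [proj_eq_zero_of_mem_wt hI hχ (by omega) hy, smul_zero]
    · rw [LinearMap.mem_ker, TensorProduct.mk_apply, LinearMap.comp_apply, contractL_tmul, map_smul]
      -- The exceptional summand U ⊗ H meets only the bidegree (0,0), which is excluded.
      have hy0 : H χ I ≤ LinearMap.ker (proj χ I a b) := by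
        refine Submodule.span_le.2 ?_
        rintro _ ⟨e, rfl⟩
        rw [SetLike.mem_coe, LinearMap.mem_ker, ← nf_nil_nil, proj_nf hI hχ, if_neg]
        rintro ⟨h1, h2⟩
        rw [deg_nil] at h1 h2
        refine hab (Prod.ext (toInt_injective ?_) (toInt_injective ?_))
        · rw [← h1]; ext; simp [toInt]
        · rw [← h2]; ext; simp [toInt]
      rw [show proj χ I a b y = 0 from hy0 hy, smul_zero]
  exact h1 h

end GroupLike

/-! ### From the ideal to a generating family. -/

section Generators

open FreeAlgebra (ι)

variable {k : Type*} [Field k] {n : ℕ}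

/-- The component of degree `a` of a noncommutative polynomial. -/
noncomputable def homogPart (a : Fin n → ℕ) : T k n →ₗ[k] T k n :=
  diag fun b => if b = toInt a then 1 else 0

theorem homogPart_mem (a : Fin n → ℕ) (p : T k n) : homogPart a p ∈ homog k a := by
  induction p using monomial_induction with
  | hm J =>
    rw [homogPart, diag_monomial]
    split_ifs with h
    · rw [one_smul, homog_eq_span]
      exact Submodule.subset_span ⟨J, h, rfl⟩
    · rw [zero_smul]; exact zero_mem _
  | h0 => rw [map_zero]; exact zero_mem _
  | hadd p q hp hq => rw [map_add]; exact add_mem hp hq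
  | hsmul r p hp => rw [map_smul]; exact Submodule.smul_mem _ _ hp

theorem exists_sum_homogPart (p : T k n) : ∃ S : Finset (Fin n → ℕ), ∀ S', S ⊆ S' →
    ∑ a ∈ S', homogPart a p = p := by
  classical
  induction p using monomial_induction with
  | hm J =>
    refine ⟨{fun i => J.count i}, fun S' hS' => ?_⟩
    rw [Finset.sum_eq_single (fun i => J.count i)]
    · rw [homogPart, diag_monomial, if_pos (toInt_count J).symm, one_smul]
    · intro d _ hd
      rw [homogPart, diag_monomial, if_neg, zero_smul]
      exact fun h => hd (toInt_injective (h.symm.trans (toInt_count J).symm))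
    · intro h; exact absurd (hS' (Finset.mem_singleton_self _)) h
  | h0 => exact ⟨∅, fun S' _ => by simp⟩
  | hadd p q hp hq =>
    obtain ⟨S, hS⟩ := hp
    obtain ⟨S₂, hS₂⟩ := hq
    refine ⟨S ∪ S₂, fun S' h => ?_⟩
    simp only [map_add, Finset.sum_add_distrib]
    rw [hS S' (Finset.union_subset_left h), hS₂ S' (Finset.union_subset_right h)]
  | hsmul r p hp =>
    obtain ⟨S, hS⟩ := hp
    refine ⟨S, fun S' h => ?_⟩
    simp only [map_smul, ← Finset.smul_sum]
    rw [hS S' h]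

theorem totalPart_of_mem_homogTotal_ne {m r : ℕ} (h : r ≠ m) {p : T k n}
    (hp : p ∈ homogTotal k n r) : totalPart m p = 0 := by
  have := diag_ht_of_mem_homogTotal (fun z => if z = m then (1 : k) else 0) hp
  rwa [if_neg (by exact_mod_cast h), zero_smul] at this

theorem mul_mem_homogTotal {l m : ℕ} {p q : T k n} (hp : p ∈ homogTotal k n l)
    (hq : q ∈ homogTotal k n m) : p * q ∈ homogTotal k n (l + m) := by
  have h := Submodule.mul_mem_mul hp hq
  rw [homogTotal, homogTotal, Submodule.span_mul_span] at h
  refine Submodule.span_mono ?_ h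
  rintro _ ⟨_, ⟨J, rfl, rfl⟩, _, ⟨L, rfl, rfl⟩, rfl⟩
  exact ⟨J ++ L, by simp, by simp [monomial]⟩

/-- A property of elements of a two-sided ideal can be checked on products of a generator with
monomials. -/
theorem le_of_span_monomial_mul {S : Set (T k n)} {N : Submodule k (T k n)}
    (h : ∀ A, ∀ s ∈ S, ∀ B, monomial k A * s * monomial k B ∈ N) {p : T k n}
    (hp : p ∈ TwoSidedIdeal.span S) : p ∈ N := by
  rw [TwoSidedIdeal.mem_span_iff_mem_addSubgroup_closure] at hp
  refine (AddSubgroup.closure_le (K := N.toAddSubgroup)).2 ?_ hp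
  rintro _ ⟨_, ⟨p, -, s, hs, rfl⟩, q, -, rfl⟩
  change p * s * q ∈ N
  induction p using monomial_induction with
  | hm A =>
    induction q using monomial_induction with
    | hm B => exact h A s hs B
    | h0 => simp
    | hadd q r hq hr => rw [mul_add]; exact add_mem hq hr
    | hsmul t q hq => rw [mul_smul_comm]; exact N.smul_mem _ hq
  | h0 => simp
  | hadd q r hq hr => rw [add_mul, add_mul]; exact add_mem hq hr
  | hsmul t q hq => rw [smul_mul_assoc, smul_mul_assoc]; exact N.smul_mem _ hq

variable {χ : Bicharacter k n} {I : TwoSidedIdeal (T k n)} {τ : Equiv.Perm (Fin n)} {c : Fin n → k}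

theorem IsPreNicholsIdeal.span_homog_eq (hI : IsPreNicholsIdeal χ I) :
    TwoSidedIdeal.span {p | p ∈ I ∧ ∃ a, p ∈ homog k a} = I := by
  refine le_antisymm (TwoSidedIdeal.span_le.2 fun p hp => hp.1) fun p hp => ?_
  have h : idealSubmodule I ≤
      idealSubmodule (TwoSidedIdeal.span {p | p ∈ I ∧ ∃ a, p ∈ homog k a}) :=
    hI.graded.trans (iSup_le fun a q hq => TwoSidedIdeal.subset_span ⟨hq.1, a, hq.2⟩)
  exact h hp

/-- Since I is graded, the finitely many nonzero homogeneous components of each generator belong to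
I and can replace it. -/
theorem IsPreNicholsIdeal.exists_finite_homog (hI : IsPreNicholsIdeal χ I) {S : Set (T k n)}
    (hS : S.Finite) (hSI : TwoSidedIdeal.span S = I) :
    ∃ S' : Set (T k n), S'.Finite ∧ TwoSidedIdeal.span S' = I ∧ ∀ p ∈ S', ∃ a, p ∈ homog k a := by
  choose A hA using exists_sum_homogPart (k := k) (n := n)
  refine ⟨⋃ p ∈ S, (fun a => homogPart a p) '' (A p : Set (Fin n → ℕ)),
    hS.biUnion fun p _ => (A p).finite_toSet.image _, le_antisymm ?_ ?_, ?_⟩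
  · refine TwoSidedIdeal.span_le.2 ?_
    simp only [Set.iUnion_subset_iff]
    rintro p hp _ ⟨a, -, rfl⟩
    exact hI.diag_mem _ (hSI ▸ TwoSidedIdeal.subset_span hp)
  · conv_lhs => rw [← hSI]
    refine TwoSidedIdeal.span_le.2 fun p hp => ?_
    rw [← hA p _ subset_rfl]
    refine sum_mem fun a ha => TwoSidedIdeal.subset_span ?_
    exact Set.mem_biUnion hp ⟨a, ha, rfl⟩
  · simp only [Set.mem_iUnion]
    rintro _ ⟨p, -, a, -, rfl⟩
    exact ⟨a, homogPart_mem a p⟩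

variable (hI : IsPreNicholsIdeal χ I) (hχ : ∀ i j, χ.q i j = χ.q j i) (hτ : ∀ i, τ (τ i) = i)
  (hτχ : ∀ i j, χ.q (τ i) (τ j) = χ.q i j) (hτI : ∀ p, diagramAut τ p ∈ I ↔ p ∈ I)

theorem proj_zero_zero_P_eq_zero_iff (b : Fin n → ℤ) (x : U χ I) :
    proj χ I 0 0 (P χ I b x) = 0 ↔ coeffK hI hχ b x = 0 := by
  rw [proj_zero_zero_P]
  refine ⟨fun h => ?_, fun h => by rw [h, zero_smul]⟩
  simpa [coeffK_K] using congrArg (coeffK hI hχ b) h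

/-- The group element K_{-d} has weight |d| in the filtration of `filt_le_wt`, one more than the
bound allows. -/
theorem coeffK_evalB_eq_zero {d : Fin n → ℕ} {p : T k n}
    (h : evalB χ I τ c p ∈ filt χ I τ c (((∑ i, d i : ℕ) : ℤ) - 1)) :
    coeffK hI hχ (-toInt d) (evalB χ I τ c p) = 0 := by
  refine coeffK_eq_zero_of_mem_wt hI hχ ?_ (filt_le_wt _ h)
  rw [ht_neg, ← sum_eq_ht_toInt]
  omega

include hI hχ in
theorem isGoodGeneratingSet_of_Nrel {S : Set (T k n)} (hN : Nrel χ I τ c = Set.univ)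
    (hS : TwoSidedIdeal.span S = I) (hS' : ∀ p ∈ S, ∃ a, p ∈ homog k a) :
    IsGoodGeneratingSet χ I τ c S := by
  refine ⟨hS, fun p hp => ?_⟩
  obtain ⟨a, ha⟩ := hS' p hp
  refine ⟨a, ha, ?_⟩
  rw [proj_zero_zero_P_eq_zero_iff hI hχ]
  exact coeffK_evalB_eq_zero hI hχ ((Nrel_eq_univ_iff hI hχ).1 hN _ p (homogTotal_of_mem_homog ha)
    (hS ▸ TwoSidedIdeal.subset_span hp))

include hτ hτχ hτI

/-- Modulo the lower filtration step, p(B) equals P_{-d}(p(B)), which is that coefficient times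
K_{-d}. -/
theorem evalB_mem_of_coeffK_eq_zero {d : Fin n → ℕ}
    (hrel : ∀ r < ∑ i, d i, ∀ p ∈ homogTotal k n r, p ∈ I →
      evalB χ I τ c p ∈ filt χ I τ c ((r : ℤ) - 1)) {p : T k n} (hp : p ∈ I)
    (hpd : p ∈ homog k d) (h : coeffK hI hχ (-toInt d) (evalB χ I τ c p) = 0) :
    evalB χ I τ c p ∈ filt χ I τ c (((∑ i, d i : ℕ) : ℤ) - 1) := by
  have h1 := evalB_sub_P_mem hI hχ (c := c) hτ hpd
  rwa [P_evalB_eq_smul_K hI hχ hτ hτχ hτI hrel hp hpd, h, zero_smul, zero_sub,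
    Submodule.neg_mem_iff] at h1

include hI hχ

/-- The proof is by strong induction on the degree: products of monomials with a generator s inherit
the drop in filtration from s(B), and lifting below the degree of s is available by induction. -/
theorem Nrel_of_isGoodGeneratingSet {S : Set (T k n)} (hS : IsGoodGeneratingSet χ I τ c S) :
    Nrel χ I τ c = Set.univ := by
  rw [Nrel_eq_univ_iff hI hχ]
  intro m
  induction m using Nat.strong_induction_on with
  | _ m ih =>
    intro p hpm hp
    -- With the projection to degree m inserted, products of generators and monomials of any other
    -- degree may be discarded.
    suffices p ∈ (filt χ I τ c ((m : ℤ) - 1)).comap ((evalB χ I τ c).toLinearMap ∘ₗ totalPart m) by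
      rwa [Submodule.mem_comap, LinearMap.comp_apply, totalPart_of_mem_homogTotal hpm] at this
    rw [← hS.1] at hp
    refine le_of_span_monomial_mul (fun A s hs B => ?_) hp
    obtain ⟨d, hd, hsd⟩ := hS.2 s hs
    have hsI : s ∈ I := hS.1 ▸ TwoSidedIdeal.subset_span hs
    have hdeg := mul_mem_homogTotal (mul_mem_homogTotal (monomial_mem_homogTotal A)
      (homogTotal_of_mem_homog hd)) (monomial_mem_homogTotal B)
    rw [Submodule.mem_comap, LinearMap.comp_apply]
    by_cases hm : A.length + ∑ i, d i + B.length = m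
    · subst hm
      rw [totalPart_of_mem_homogTotal hdeg, AlgHom.toLinearMap_apply, map_mul, map_mul]
      have h := mul_mem_filt (mul_mem_filt (evalB_monomial_mem_filt (χ := χ) (I := I) (τ := τ)
        (c := c) A) (evalB_mem_of_coeffK_eq_zero hI hχ hτ hτχ hτI
          (fun r hr => ih r (by omega)) hsI hd
          ((proj_zero_zero_P_eq_zero_iff hI hχ _ _).1 hsd))) (evalB_monomial_mem_filt B)
      refine filt_mono ?_ h
      push_cast
      omega
    · rw [totalPart_of_mem_homogTotal_ne hm hdeg, map_zero]
      exact zero_mem _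

/-- In the least degree in which lifting fails, P_{-d}(p(B)) is a nonzero multiple of K_{-d}, and it
differs from p(B) by an element of B_c. -/
theorem exists_K_mem_Bc (hN : Nrel χ I τ c ≠ Set.univ) :
    ∃ a : Fin n → ℕ, a ≠ 0 ∧ K χ I (-toInt a) ∈ Bc χ I τ c := by
  classical
  have hex : ∃ m, ¬ ∀ p ∈ homogTotal k n m, p ∈ I →
      evalB χ I τ c p ∈ filt χ I τ c ((m : ℤ) - 1) := by
    by_contra! h
    exact hN ((Nrel_eq_univ_iff hI hχ).2 h)
  obtain ⟨m, hm, hmin⟩ : ∃ m, (¬ ∀ p ∈ homogTotal k n m, p ∈ I →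
      evalB χ I τ c p ∈ filt χ I τ c ((m : ℤ) - 1)) ∧ ∀ r < m, ∀ p ∈ homogTotal k n r, p ∈ I →
        evalB χ I τ c p ∈ filt χ I τ c ((r : ℤ) - 1) :=
    ⟨Nat.find hex, Nat.find_spec hex, fun r hr => not_not.1 (Nat.find_min hex hr)⟩
  obtain ⟨a, ha, q, hq, hqa, hqB⟩ : ∃ a : Fin n → ℕ, ∑ i, a i = m ∧ ∃ q ∈ I, q ∈ homog k a ∧
      evalB χ I τ c q ∉ filt χ I τ c ((m : ℤ) - 1) := by
    by_contra! h
    exact hm fun p hpm hp => hI.map_mem_of_homog _ (evalB χ I τ c).toLinearMap h hp hpm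
  subst ha
  have hqm := homogTotal_of_mem_homog hqa
  refine ⟨a, ?_, ?_⟩
  -- In degree zero I contains no nonzero constant, so nothing can fail to lift.
  · rintro rfl
    rw [show ∑ i, (0 : Fin n → ℕ) i = 0 by simp] at hqm
    obtain ⟨s, rfl⟩ := exists_eq_smul_one_of_mem_homogTotal_zero hqm
    have h1 : counit (1 : T k n) = 1 := by
      have := monoLift_monomial (k := k) (n := n) (fun J => if J = [] then (1 : k) else 0) []
      simpa [counit] using this
    have := hI.counit_eq_zero hq
    rw [map_smul, h1, smul_eq_mul, mul_one] at this
    subst this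
    exact hqB (by rw [zero_smul, map_zero]; exact zero_mem _)
  · have hz : coeffK hI hχ (-toInt a) (evalB χ I τ c q) ≠ 0 := fun h =>
      hqB (evalB_mem_of_coeffK_eq_zero hI hχ hτ hτχ hτI hmin hq hqa h)
    have h1 := filt_le_Bc _ (evalB_sub_P_mem hI hχ (c := c) hτ hqa)
    have h2 := filt_le_Bc _ (evalB_mem_filt (χ := χ) (I := I) (τ := τ) (c := c) hqm)
    have h3 := add_mem h1 h2
    rw [sub_add_cancel, P_evalB_eq_smul_K hI hχ hτ hτχ hτI hmin hq hqa] at h3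
    exact (Submodule.smul_mem_iff _ hz).1 h3

end Generators

/-! ### Splitting ℤⁿ along the τ-orbits. -/

section Lattice

variable {n : ℕ} {τ : Equiv.Perm (Fin n)} {R : Set (Fin n)}

/-- The sublattice of `ℤⁿ` generated by the `α_i` with `i ∈ R`. -/
def repLattice (R : Set (Fin n)) : AddSubgroup (Fin n → ℤ) :=
  AddSubgroup.closure (simpleRoot '' R)

theorem exists_add_eq (hR : IsOrbitReps τ R) (a : Fin n → ℤ) :
    ∃ r ∈ repLattice R, ∃ b ∈ thetaLattice τ, r + b = a := by
  rw [← AddSubgroup.mem_sup]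
  have ha : a = ∑ i, a i • simpleRoot i := by
    ext j
    simp [Finset.sum_apply, simpleRoot, Pi.single_apply]
  rw [ha]
  refine sum_mem fun i _ => AddSubgroup.zsmul_mem _ ?_ _
  obtain ⟨j, ⟨hj, h | h⟩, -⟩ := hR i
  · exact AddSubgroup.mem_sup_left (AddSubgroup.subset_closure ⟨j, hj, by rw [h]⟩)
  · rw [← add_sub_cancel (simpleRoot (τ i)) (simpleRoot i)]
    exact add_mem (AddSubgroup.mem_sup_left (AddSubgroup.subset_closure ⟨j, hj, by rw [h]⟩))
      (AddSubgroup.mem_sup_right (root_sub_mem τ i))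

theorem add_apply_of_mem_thetaLattice (hτ : ∀ i, τ (τ i) = i) {a : Fin n → ℤ}
    (ha : a ∈ thetaLattice τ) (i : Fin n) : a i + a (τ i) = 0 := by
  induction ha using AddSubgroup.closure_induction with
  | mem x hx =>
    obtain ⟨j, rfl⟩ := hx
    have h1 : i = τ j ↔ τ i = j := by
      constructor
      · rintro rfl; exact hτ j
      · rintro rfl; exact (hτ i).symm
    have h2 : τ i = τ j ↔ i = j := τ.injective.eq_iff
    simp only [simpleRoot, Pi.sub_apply, Pi.single_apply, h1, h2]
    ring
  | zero => simp
  | add x y _ _ hx hy => simp only [Pi.add_apply]; omega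
  | neg x _ hx => simp only [Pi.neg_apply]; omega

theorem apply_eq_zero_of_mem_repLattice {a : Fin n → ℤ} (ha : a ∈ repLattice R) {i : Fin n}
    (hi : i ∉ R) : a i = 0 := by
  induction ha using AddSubgroup.closure_induction with
  | mem x hx =>
    obtain ⟨j, hj, rfl⟩ := hx
    have : i ≠ j := by rintro rfl; exact hi hj
    simp [simpleRoot, this]
  | zero => rfl
  | add x y _ _ hx hy => simp [hx, hy]
  | neg x _ hx => simp [hx]

/-- Elements of the lattice of H_θ are antisymmetric under τ, while those of the other lattice are
supported on R, which meets each orbit once. -/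
theorem eq_zero_of_mem_repLattice_of_mem_thetaLattice (hτ : ∀ i, τ (τ i) = i)
    (hR : IsOrbitReps τ R) {a : Fin n → ℤ} (ha : a ∈ repLattice R) (ha' : a ∈ thetaLattice τ) :
    a = 0 := by
  ext i
  have h := add_apply_of_mem_thetaLattice hτ ha' i
  by_cases hi : i ∈ R
  · by_cases hi' : τ i ∈ R
    -- An index with i and τ(i) both in R is fixed by τ, and antisymmetry then gives 2 a_i = 0 in ℤ.
    · have : i = τ i := (hR i).unique ⟨hi, Or.inl rfl⟩ ⟨hi', Or.inr rfl⟩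
      rw [← this] at h
      simp only [Pi.zero_apply]; omega
    · rw [apply_eq_zero_of_mem_repLattice ha hi', add_zero] at h
      exact h
  · exact apply_eq_zero_of_mem_repLattice ha hi

end Lattice

/-! ### The Iwasawa decomposition. -/

section Iwasawa

open FreeAlgebra (ι)

variable {k : Type*} [Field k] {n : ℕ} {χ : Bicharacter k n} {I : TwoSidedIdeal (T k n)}
  {τ : Equiv.Perm (Fin n)} {c : Fin n → k} {R : Set (Fin n)}

theorem K_mem_HR {r : Fin n → ℤ} (hr : r ∈ repLattice R) : K χ I r ∈ HR χ I R := by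
  have D := isDouble_U χ I
  suffices h : K χ I r ∈ HR χ I R ∧ K χ I (-r) ∈ HR χ I R from h.1
  induction hr using AddSubgroup.closure_induction with
  | mem x hx =>
    obtain ⟨i, hi, rfl⟩ := hx
    exact ⟨Algebra.subset_adjoin (Or.inl ⟨i, hi, rfl⟩), Algebra.subset_adjoin (Or.inr ⟨i, hi, rfl⟩)⟩
  | zero => rw [neg_zero, D.K_zero]; exact ⟨one_mem _, one_mem _⟩
  | add x y _ _ hx hy =>
    rw [neg_add, D.K_add, D.K_add]
    exact ⟨mul_mem hx.1 hy.1, mul_mem hx.2 hy.2⟩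
  | neg x _ hx => rw [neg_neg]; exact hx.symm

theorem HR_le_span : Subalgebra.toSubmodule (HR χ I R) ≤
    Submodule.span k {x | ∃ r ∈ repLattice R, x = K χ I r} := by
  have D := isDouble_U χ I
  rw [HR, Algebra.adjoin_eq_span]
  refine Submodule.span_mono fun x hx => ?_
  induction hx using Submonoid.closure_induction with
  | mem x hx =>
    rcases hx with ⟨i, hi, rfl⟩ | ⟨i, hi, rfl⟩
    · exact ⟨_, AddSubgroup.subset_closure ⟨i, hi, rfl⟩, rfl⟩
    · exact ⟨_, neg_mem (AddSubgroup.subset_closure ⟨i, hi, rfl⟩), rfl⟩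
  | one => exact ⟨0, zero_mem _, D.K_zero.symm⟩
  | mul x y _ _ hx hy =>
    obtain ⟨r, hr, rfl⟩ := hx
    obtain ⟨s, hs, rfl⟩ := hy
    exact ⟨r + s, add_mem hr hs, (D.K_add r s).symm⟩

theorem evalE_mem_Uplus (p : T k n) : evalE χ I p ∈ Uplus χ I := by
  rw [Uplus, Algebra.adjoin_range_eq_range_freeAlgebra_lift]
  exact ⟨p, rfl⟩

theorem exists_evalE_eq {x : U χ I} (hx : x ∈ Uplus χ I) : ∃ p, evalE χ I p = x := by
  rw [Uplus, Algebra.adjoin_range_eq_range_freeAlgebra_lift] at hx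
  exact hx

theorem K_mem_Bc (hτ : ∀ i, τ (τ i) = i) {a : Fin n → ℤ} (ha : a ∈ thetaLattice τ) :
    K χ I a ∈ Bc χ I τ c := filt_le_Bc 0 (K_mem_filt hτ ha)

theorem iwasawaMap_tmul (u : Uplus χ I) (h : HR χ I R) (b : Bc χ I τ c) :
    iwasawaMap χ I τ c R ((u ⊗ₜ h) ⊗ₜ b) = u * h * b := by
  simp [iwasawaMap]

theorem evalB_sub_evalF_mem (L : List (Fin n)) :
    evalB χ I τ c (monomial k L) - evalF χ I (monomial k L) ∈ wt χ I 0 1 0 (L.length - 1) := by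
  have h := genB_word_sub_mem (χ := χ) (I := I) (τ := τ) (c := c) (L.map Sum.inr)
  have h1 : ((L.map Sum.inr).map (genB χ I τ c)).prod = evalB χ I τ c (monomial k L) := by
    clear h
    induction L with
    | nil => simp
    | cons i L ih => simp [monomial_cons, evalB_x_mul, genB, ← ih]
  have h2 : ((L.map Sum.inr).map (genF χ I τ)).prod = evalF χ I (monomial k L) := by
    clear h h1
    induction L with
    | nil => simp
    | cons i L ih => simp [monomial_cons, evalF_x_mul, genF, ← ih]
  have h3 : bCount (L.map Sum.inr : List (Fin n ⊕ Fin n)) = L.length := by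
    clear h h1 h2
    induction L with
    | nil => simp
    | cons i L ih => simp_all
  rwa [h1, h2, h3] at h

/-- Modulo monomials with fewer F's, F_L may be replaced by B_L, and K_a splits along the two
lattices. No lifting of relations is needed. -/
theorem iwasawaMap_surjective (hτ : ∀ i, τ (τ i) = i) (hR : IsOrbitReps τ R) :
    Function.Surjective (iwasawaMap χ I τ c R) := by
  have D := isDouble_U χ I
  -- The shift by one makes the base case the bound −1 on the number of F's, which no monomial
  -- satisfies.
  have key : ∀ m : ℕ, wt χ I 0 1 0 ((m : ℤ) - 1) ≤ LinearMap.range (iwasawaMap χ I τ c R) := by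
    intro m
    induction m with
    | zero => exact wt_le_iff.2 fun J a L h => by push_cast at h; omega
    | succ m ih =>
      refine wt_le_iff.2 fun J a L h => ?_
      obtain ⟨r, hr, b, hb, rfl⟩ := exists_add_eq hR a
      have h1 : evalE χ I (monomial k J) * K χ I r * (K χ I b * evalB χ I τ c (monomial k L)) ∈
          LinearMap.range (iwasawaMap χ I τ c R) :=
        ⟨(⟨_, evalE_mem_Uplus (monomial k J)⟩ ⊗ₜ ⟨_, K_mem_HR hr⟩) ⊗ₜ ⟨_, mul_mem (K_mem_Bc hτ hb)
          (filt_le_Bc _ (evalB_monomial_mem_filt L))⟩, iwasawaMap_tmul _ _ _⟩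
      have h2 : nf χ I J (r + b) [] * (evalB χ I τ c (monomial k L) - evalF χ I (monomial k L)) ∈
          wt χ I 0 1 0 ((m : ℤ) - 1) := by
        refine (isAlgFiltration_wt (by norm_num) (by norm_num)).mul_mem' ?_
          (nf_mem_wt (r := 0) (by simp)) (evalB_sub_evalF_mem L)
        push_cast at h
        omega
      have := sub_mem h1 (ih h2)
      convert this using 1
      simp only [nf, monomial_nil, map_one, D.K_add, mul_sub, mul_assoc, one_mul]
      abel
  intro x
  have hx : x ∈ LinearMap.range (iwasawaMap χ I τ c R) := by
    rw [span_nf_eq_top (LinearMap.range (iwasawaMap χ I τ c R)) fun J a L =>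
      key (L.length + 1) (nf_mem_wt (by push_cast; omega))]
    trivial
  exact hx

variable (hI : IsPreNicholsIdeal χ I) (hχ : ∀ i j, χ.q i j = χ.q j i) (hτ : ∀ i, τ (τ i) = i)
  (hτχ : ∀ i j, χ.q (τ i) (τ j) = χ.q i j)

section Injective

theorem add_neg_one_smul_self {A : Type*} [Ring A] [Algebra k A] (x : A) : x + (-1 : k) • x = 0 := by
  rw [neg_one_smul, add_neg_cancel]

include hτ hτχ in
theorem topPart_mem_span {m : ℤ} {x : U χ I} (hx : x ∈ filt χ I τ c m) : topPart hI hχ m x ∈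
    Submodule.span k {y | ∃ a ∈ thetaLattice τ, ∃ L, y = K χ I a * evalF χ I (monomial k L)} := by
  refine (filt_le_iff (N := (Submodule.span k {y | ∃ a ∈ thetaLattice τ, ∃ L,
    y = K χ I a * evalF χ I (monomial k L)}).comap (topPart hI hχ m))).2 (fun w hw => ?_) hx
  rw [Submodule.mem_comap, topPart_genB_word hI hχ hτ hτχ w hw]
  split_ifs
  · obtain ⟨s, a, ha, L, -, -, h⟩ := word_normal_form (χ := χ) (I := I) (c := c) hτ hτχ w
    rw [h]
    exact Submodule.smul_mem _ _ (Submodule.subset_span ⟨a, ha, L, rfl⟩)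
  · exact zero_mem _

open Classical in
/-- The projection onto the component `ξ ⊗ k[r + Λ] ⊗ U⁻` of the triangular decomposition, where
`Λ` is the lattice of `H_θ`. -/
noncomputable def cosetOp (τ : Equiv.Perm (Fin n)) (ξ : QuotSpace I →ₗ[k] k) (r : Fin n → ℤ) :
    U χ I →ₗ[k] U χ I :=
  triOp hI hχ (ξ.smulRight (qmk I 1)) fun a => if a - r ∈ thetaLattice τ then LinearMap.id else 0

/-- The product involves only group elements K_{s+a} with a in the lattice of H_θ. As the two
lattices meet trivially, s + a lies in the coset of r only for s = r. -/
theorem cosetOp_apply (hR : IsOrbitReps τ R) (ξ : QuotSpace I →ₗ[k] k) {r s : Fin n → ℤ}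
    (hr : r ∈ repLattice R) (hs : s ∈ repLattice R) (hτ : ∀ i, τ (τ i) = i) (p : T k n) {y : U χ I}
    (hy : y ∈ Submodule.span k {y | ∃ a ∈ thetaLattice τ, ∃ L,
      y = K χ I a * evalF χ I (monomial k L)}) :
    cosetOp hI hχ τ ξ r (evalE χ I p * K χ I s * y) =
      if s = r then ξ (qmk I p) • (K χ I r * y) else 0 := by
  classical
  have D := isDouble_U χ I
  have h := LinearMap.eqOn_span
    (f := cosetOp hI hχ τ ξ r ∘ₗ LinearMap.mulLeft k (evalE χ I p * K χ I s))
    (g := if s = r then ξ (qmk I p) • LinearMap.mulLeft k (K χ I r) else 0) (by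
      rintro _ ⟨a, ha, L, rfl⟩
      have e : evalE χ I p * K χ I s * (K χ I a * evalF χ I (monomial k L)) =
          evalE χ I p * K χ I (s + a) * evalF χ I (monomial k L) := by
        simp only [D.K_add, mul_assoc]
      rw [LinearMap.comp_apply, LinearMap.mulLeft_apply, e, cosetOp, triOp_apply]
      by_cases hsr : s = r
      · subst hsr
        rw [if_pos rfl, if_pos (by simpa using ha), LinearMap.smulRight_apply, map_smul,
          evalEQ_qmk, map_one, LinearMap.id_apply, evalFQ_qmk, D.K_add, LinearMap.smul_apply,
          LinearMap.mulLeft_apply, smul_mul_assoc, smul_mul_assoc, one_mul, mul_assoc]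
      · rw [if_neg hsr, if_neg]
        · simp
        · intro h
          refine hsr (sub_eq_zero.1 (eq_zero_of_mem_repLattice_of_mem_thetaLattice hτ hR
            (sub_mem hs hr) ?_))
          have := sub_mem h ha
          rwa [show s + a - r - a = s - r by abel] at this) hy
  rw [LinearMap.comp_apply, LinearMap.mulLeft_apply] at h
  rw [h]
  split_ifs <;> simp

-- If all coefficients lie in 𝓕_m, the top part of the relation separates into its U⁺ and group
-- components, so every coefficient has vanishing top part. Lifting of relations then moves it to
-- 𝓕_{m-1}, and the descent ends at 𝓕_{-1} = 0.
include hI hχ hτχ in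
theorem eq_zero_of_sum_eq_zero (hτ : ∀ i, τ (τ i) = i) (hR : IsOrbitReps τ R)
    (hN : Nrel χ I τ c = Set.univ) {κ : Type*} (v : Module.Basis κ k (QuotSpace I))
    (f : κ × repLattice R →₀ Bc χ I τ c)
    (hf : f.sum (fun x b => evalEQ χ I (v x.1) * K χ I x.2 * (b : U χ I)) = 0) : f = 0 := by
  classical
  have D := isDouble_U χ I
  choose p hp using fun a => qmk_surjective I (v a)
  have desc : ∀ m : ℕ, (∀ x, (f x : U χ I) ∈ filt χ I τ c ((m : ℤ) - 1)) → f = 0 := by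
    intro m
    induction m with
    | zero =>
      intro h
      ext x
      have := h x
      rwa [filt_of_neg (by norm_num), Submodule.mem_bot] at this
    | succ m ih =>
      intro h
      push_cast at h
      simp only [add_sub_cancel_right] at h
      refine ih fun x => ?_
      refine mem_filt_pred_of_topPart_eq_zero hI hχ hτ hτχ
        ((Nrel_eq_univ_iff hI hχ).1 hN m) (h x) ?_
      -- The dual basis functional and the coset of x.2 single out the coefficient at x; afterwards
      -- the group element is cancelled.
      have h1 := congrArg (cosetOp hI hχ τ (v.coord x.1) x.2 ∘ₗ topPart hI hχ m) hf
      rw [map_zero, map_finsuppSum, Finsupp.sum, Finset.sum_eq_single x] at h1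
      · rw [← hp, evalEQ_qmk, LinearMap.comp_apply, topPart_evalE_mul_K_mul,
          cosetOp_apply hI hχ hR _ x.2.2 x.2.2 hτ _ (topPart_mem_span hI hχ hτ hτχ (h x)),
          if_pos rfl, hp, Module.Basis.coord_apply, Module.Basis.repr_self, Finsupp.single_eq_same,
          one_smul] at h1
        have := congrArg (K χ I (-x.2) * ·) h1
        simpa [← mul_assoc, D.K_neg_mul] using this
      · intro y _ hy
        rw [← hp, evalEQ_qmk, LinearMap.comp_apply, topPart_evalE_mul_K_mul,
          cosetOp_apply hI hχ hR _ x.2.2 y.2.2 hτ _ (topPart_mem_span hI hχ hτ hτχ (h y)), hp,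
          Module.Basis.coord_apply, Module.Basis.repr_self]
        split_ifs with h2
        · rw [Finsupp.single_eq_of_ne, zero_smul]
          exact fun h3 => hy (Prod.ext h3.symm (Subtype.ext h2))
        · rfl
      · intro hx
        rw [Finsupp.notMem_support_iff.1 hx]
        simp
  choose d hd using fun x => exists_mem_filt (f x).2
  refine desc (f.support.sup d + 1) fun x => ?_
  push_cast
  rw [add_sub_cancel_right]
  by_cases hx : x ∈ f.support
  · exact filt_mono (by exact_mod_cast Finset.le_sup hx) (hd x)
  · rw [Finsupp.notMem_support_iff.1 hx]
    exact zero_mem _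

-- A basis of T/I and the group elements of the lattice of R write every tensor as a finite sum with
-- coefficients in B_c. Existence of such expressions is enough, since the preceding result shows
-- that the coefficients are determined by the image.
include hI hχ hτχ in
theorem iwasawaMap_injective (hτ : ∀ i, τ (τ i) = i) (hR : IsOrbitReps τ R)
    (hN : Nrel χ I τ c = Set.univ) : Function.Injective (iwasawaMap χ I τ c R) := by
  set v := Module.Basis.ofVectorSpace k (QuotSpace I)
  have hv : ∀ q, evalEQ χ I q ∈ Uplus χ I := fun q => by
    obtain ⟨p, rfl⟩ := qmk_surjective I q
    exact evalE_mem_Uplus p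
  set vE : QuotSpace I →ₗ[k] Uplus χ I := (evalEQ χ I).codRestrict
    (Subalgebra.toSubmodule (Uplus χ I)) hv with hvE
  set Φ : (_ × repLattice R →₀ Bc χ I τ c) →ₗ[k]
      (Uplus χ I ⊗[k] HR χ I R) ⊗[k] Bc χ I τ c :=
    Finsupp.lsum k fun x => TensorProduct.mk k (Uplus χ I ⊗[k] HR χ I R) (Bc χ I τ c)
      (vE (v x.1) ⊗ₜ ⟨K χ I x.2, K_mem_HR x.2.2⟩) with hΦ
  have hsurj : ∀ t, t ∈ LinearMap.range Φ := by
    intro t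
    induction t using TensorProduct.induction_on with
    | zero => exact zero_mem _
    | add x y hx hy => exact add_mem hx hy
    | tmul x b =>
      induction x using TensorProduct.induction_on with
      | zero => rw [TensorProduct.zero_tmul]; exact zero_mem _
      | add x y hx hy => rw [TensorProduct.add_tmul]; exact add_mem hx hy
      | tmul u h =>
        obtain ⟨p, hp⟩ := exists_evalE_eq u.2
        obtain rfl : vE (qmk I p) = u := Subtype.ext hp
        obtain ⟨h, hh⟩ := h
        have hh' := HR_le_span hh
        have hspan : Submodule.span k {x | ∃ r ∈ repLattice R, x = K χ I r} ≤
            Subalgebra.toSubmodule (HR χ I R) := by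
          refine Submodule.span_le.2 ?_
          rintro _ ⟨r, hr, rfl⟩
          exact K_mem_HR hr
        induction hh' using Submodule.span_induction with
        | mem x hx =>
          obtain ⟨r, hr, rfl⟩ := hx
          have : (⊤ : Submodule k (QuotSpace I)) ≤ (LinearMap.range Φ).comap
              ((TensorProduct.mk k _ _).flip b ∘ₗ
                (TensorProduct.mk k _ _).flip (⟨K χ I r, hh⟩ : HR χ I R) ∘ₗ vE) := by
            rw [← v.span_eq]
            refine Submodule.span_le.2 ?_
            rintro _ ⟨a, rfl⟩
            exact ⟨Finsupp.single (a, ⟨r, hr⟩) b, by simp [hΦ]⟩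
          exact this (x := qmk I p) trivial
        | zero =>
          rw [show (⟨0, hh⟩ : HR χ I R) = 0 from rfl, TensorProduct.tmul_zero,
            TensorProduct.zero_tmul]
          exact zero_mem _
        | add x y hx hy ihx ihy =>
          rw [show (⟨x + y, hh⟩ : HR χ I R) = ⟨x, hspan hx⟩ + ⟨y, hspan hy⟩ from rfl,
            TensorProduct.tmul_add, TensorProduct.add_tmul]
          exact add_mem (ihx _) (ihy _)
        | smul s x hx ih =>
          rw [show (⟨s • x, hh⟩ : HR χ I R) = s • ⟨x, hspan hx⟩ from rfl,
            TensorProduct.tmul_smul, ← TensorProduct.smul_tmul']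
          exact Submodule.smul_mem _ _ (ih _)
  have hΦ_apply : ∀ f, iwasawaMap χ I τ c R (Φ f) =
      f.sum fun x b => evalEQ χ I (v x.1) * K χ I x.2 * (b : U χ I) := fun f => by
    rw [hΦ, Finsupp.lsum_apply, map_finsuppSum]
    refine Finsupp.sum_congr fun x _ => ?_
    rw [TensorProduct.mk_apply, iwasawaMap_tmul]
    rfl
  intro t t' h
  obtain ⟨f, rfl⟩ := hsurj t
  obtain ⟨g, rfl⟩ := hsurj t'
  have h0 : f + (-1 : k) • g = 0 := by
    refine eq_zero_of_sum_eq_zero hI hχ hτχ hτ hR hN v _ ?_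
    rw [← hΦ_apply, map_add, map_smul, map_add, map_smul, h]
    exact add_neg_one_smul_self (k := k) (A := U χ I) _
  have hfg : f = g := by
    ext x
    have := congrArg Subtype.val (DFunLike.congr_fun h0 x)
    simpa [← sub_eq_add_neg, sub_eq_zero] using this
  rw [hfg]

end Injective

-- If lifting fails, some K_{-λ} with λ ≠ 0 lies in B_c. Factoring it as K_r K_b along the two
-- lattices produces a second preimage, which contradicts injectivity.
include hI hχ hτχ in
theorem iwasawaMap_bijective_iff (hτ : ∀ i, τ (τ i) = i) (hτI : ∀ p, diagramAut τ p ∈ I ↔ p ∈ I)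
    (hR : IsOrbitReps τ R) :
    Function.Bijective (iwasawaMap χ I τ c R) ↔ Nrel χ I τ c = Set.univ := by
  have D := isDouble_U χ I
  refine ⟨fun hbij => ?_, fun hN =>
    ⟨iwasawaMap_injective hI hχ hτχ hτ hR hN, iwasawaMap_surjective hτ hR⟩⟩
  by_contra hN
  obtain ⟨a, ha, hKa⟩ := exists_K_mem_Bc hI hχ hτ hτχ hτI hN
  obtain ⟨r, hr, b, hb, hrb⟩ := exists_add_eq hR (-toInt a)
  -- The lattice of H_θ lies in height zero, whereas −λ has negative height.
  have hr0 : r ≠ 0 := by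
    rintro rfl
    have h := congrArg ht hrb
    rw [ht_add, ht_of_mem_thetaLattice τ hb, ht_neg, ← sum_eq_ht_toInt, ht_zero] at h
    refine ha (funext fun i => ?_)
    have h' : ∑ i, a i = 0 := by omega
    exact Finset.sum_eq_zero_iff.1 h' i (Finset.mem_univ i)
  have heq := hbij.1 (a₁ := ((1 : Uplus χ I) ⊗ₜ[k] (1 : HR χ I R)) ⊗ₜ[k] (⟨_, hKa⟩ : Bc χ I τ c))
    (a₂ := ((1 : Uplus χ I) ⊗ₜ[k] (⟨_, K_mem_HR hr⟩ : HR χ I R)) ⊗ₜ[k]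
      (⟨_, K_mem_Bc hτ hb⟩ : Bc χ I τ c))
    (by rw [iwasawaMap_tmul, iwasawaMap_tmul]; simp [← hrb, D.K_add])
  -- Coefficient functionals on the three factors separate the tensors: in the middle factor the
  -- coefficient of K_0 is 1 for the unit and 0 for K_r.
  have h1 := congrArg (LinearMap.mul' k k ∘ₗ TensorProduct.map
    (LinearMap.mul' k k ∘ₗ TensorProduct.map
      (coeffK hI hχ 0 ∘ₗ (Uplus χ I).val.toLinearMap)
      (coeffK hI hχ 0 ∘ₗ (HR χ I R).val.toLinearMap))
    (coeffK hI hχ (-toInt a) ∘ₗ (Bc χ I τ c).val.toLinearMap)) heq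
  have h2 : coeffK hI hχ 0 1 = 1 := by rw [← D.K_zero, coeffK_K, if_pos rfl]
  simp [h2, coeffK_K, hr0] at h1

end Iwasawa

end PreNichols

/-! ### The main theorem. -/

theorem theorem2p11 {k : Type*} [Field k] {n : ℕ}
    (χ : PreNichols.Bicharacter k n) (hχ : ∀ i j, χ.q i j = χ.q j i)
    (I : TwoSidedIdeal (PreNichols.T k n)) (hI : PreNichols.IsPreNicholsIdeal χ I)
    (τ : Equiv.Perm (Fin n)) (hτ : ∀ i, τ (τ i) = i)
    (hτχ : ∀ i j, χ.q (τ i) (τ j) = χ.q i j)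
    (hτI : ∀ p, PreNichols.diagramAut τ p ∈ I ↔ p ∈ I)
    (c : Fin n → k) :
    -- the decompositions that define the projections `P` and `proj`
    DirectSum.IsInternal (PreNichols.UKG χ I) ∧
    DirectSum.IsInternal (PreNichols.UHU χ I) ∧
    -- the natural map `φ` exists and is unique
    (∃! φ, PreNichols.IsNaturalMap χ I τ c φ) ∧
    (∀ φ, PreNichols.IsNaturalMap χ I τ c φ →
      Function.Surjective φ ∧
      [Function.Bijective φ,
        PreNichols.Nrel χ I τ c = Set.univ,
        ∃ S, PreNichols.IsGoodGeneratingSet χ I τ c S].TFAE ∧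
      -- the Iwasawa decomposition
      (∀ R, PreNichols.IsOrbitReps τ R →
        (Function.Bijective φ ↔ Function.Bijective (PreNichols.iwasawaMap χ I τ c R)))) ∧
    -- if `I` is finitely generated, finitely many `p_j` suffice
    ((∃ S : Set (PreNichols.T k n), S.Finite ∧ TwoSidedIdeal.span S = I) →
      (PreNichols.Nrel χ I τ c = Set.univ ↔
        ∃ S, S.Finite ∧ PreNichols.IsGoodGeneratingSet χ I τ c S)) ∧
    (PreNichols.Nrel χ I τ c ≠ Set.univ →
      ∃ a : Fin n → ℕ, a ≠ 0 ∧
        PreNichols.K χ I (-PreNichols.toInt a) ∈ PreNichols.Bc χ I τ c) := by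
  refine ⟨(PreNichols.UKG_aux hI hχ).1, (PreNichols.UHU_aux hI hχ).1, PreNichols.existsUnique_naturalMap hI hχ hτ hτχ,
    fun φ hφ => ⟨hφ.surjective, ?_, fun R hR => ?_⟩, ?_, PreNichols.exists_K_mem_Bc hI hχ hτ hτχ hτI⟩
  · tfae_have 1 ↔ 2 := hφ.bijective_iff hI hχ hτ hτχ
    -- The family of all homogeneous elements of I serves as the generating set.
    tfae_have 2 → 3 := fun h =>
      ⟨_, PreNichols.isGoodGeneratingSet_of_Nrel hI hχ h hI.span_homog_eq fun p hp => hp.2⟩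
    tfae_have 3 → 2 := fun ⟨S, hS⟩ => PreNichols.Nrel_of_isGoodGeneratingSet hI hχ hτ hτχ hτI hS
    tfae_finish
  · rw [hφ.bijective_iff hI hχ hτ hτχ, PreNichols.iwasawaMap_bijective_iff hI hχ hτχ hτ hτI hR]
  · rintro ⟨S, hS, hSI⟩
    refine ⟨fun h => ?_, fun ⟨S', _, hS'⟩ => PreNichols.Nrel_of_isGoodGeneratingSet hI hχ hτ hτχ hτI hS'⟩
    obtain ⟨S', hfin, hspan, hhom⟩ := hI.exists_finite_homog hS hSI
    exact ⟨S', hfin, PreNichols.isGoodGeneratingSet_of_Nrel hI hχ h hspan hhom⟩
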